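/- Let $V\hookrightarrow H\cong H^*\hookrightarrow V^*$ be a Gelfand triple of real Hilbert spaces with dense and compact embedding $V\hookrightarrow H$, and let $a\colon V\times V\to\mathbb R$ be a continuous bilinear form with $a(v,v)+\omega_0\|v\|_H^2\ge\alpha_0\|v\|_V^2$ for all $v\in V$, for some $\alpha_0>0$, $\omega_0\ge 0$. Define $A,A^*\colon V\to V^*$ by $\langle Ay,v\rangle=a(y,v)=\langle A^*v,y\rangle$. Let $(\omega,\varrho)$ be a $\sigma$-finite measure space, $B\colon L^2(\omega)\to V^*$ linear and continuous with adjoint $B^*\colon V\to L^2(\omega)$, let $y_0,y_d\in H$, $\delta_0>0$, and $u_a,u_b\in L^\infty(\omega)$ with $u_a<u_b$ almost everywhere. Suppose that $$U_{ad}=\{u\in L^2(\omega): u_a\le u\le u_b \text{ a.e. in }\omega\}$$ is nonempty and bounded in $L^2(\omega)$ (this holds automatically if $\varrho$ is finite). For $T>0$ let $U_{ad}(0,T)=\{u\in L^2((0,T)\times\omega): u(t)\in U_{ad}\text{ for a.e. }t\in(0,T)\}$ and $W(0,T)=H^1(0,T;V^*)\cap L^2(0,T;V)\hookrightarrow C([0,T];H)$.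 For $T>0$ put $\delta(T)=\inf\{\|y(T)-y_d\|_H-\delta_0 : u\in U_{ad}(0,T)\}$, where $y\in W(0,T)$ solves $\partial_t y+Ay=Bu$, $y(0)=y_0$. For $\nu>0$ and $u\in U_{ad}(0,1)$ let $S(\nu,u)=y\in W(0,1)$ be the solution of $\partial_t y+\nu Ay=\nu Bu$ on $(0,1)$, $y(0)=y_0$, and let $\bar u(\nu)$ be the set of all minimizers of $u\mapsto\|S(\nu,u)(1)-y_d\|_H$ over $U_{ad}(0,1)$. The system has the unique continuation property at $\nu$ if for every $p_1\in H$ and the solution $p\in W(0,1)$ of $-\partial_t p+\nu A^*p=0$, $p(1)=p_1$, the following holds: if $B^*p=0$ almost everywhere on some measurable $\Lambda\subset(0,1)\times\omega$ of nonzero product measure, then $p=0$. 1. Let $\nu>0$ with $\delta(\nu)>-\delta_0$, and suppose that the unique continuation property holds at $\nu$. Then $\bar u(\nu)\neq\emptyset$ and the integral $$\int_0^1\langle Bu(t)-Ay(t),p(t)\rangle\,dt$$ has the same value for all $u\in\bar u(\nu)$, where $y=S(\nu,u)$ and $p\in W(0,1)$ solves $-\partial_t p+\nu A^*p=0$, $p(1)=(y(1)-y_d)/\|y(1)-y_d\|_H$.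 Moreover, $\delta(\cdot)$ is differentiable at $\nu$ and this common value is $\delta'(\nu)$. 2. If the unique continuation property holds at every $\nu>0$ with $\delta(\nu)>-\delta_0$, then $\delta(\cdot)$ is continuously differentiable in a neighbourhood of each such $\nu$. -/

import Mathlib

open MeasureTheory Set Topology
open scoped ENNReal

noncomputable section

/-- Lebesgue measure on the open interval `(0, T)`. -/
def timeMeasure (T : ℝ) : Measure ℝ := volume.restrict (Ioo 0 T)

/-- `g` is the weak (distributional) derivative of `f` on `(0, T)`. -/
def HasWeakTimeDeriv {E : Type*} [NormedAddCommGroup E] [NormedSpace ℝ E]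
    (T : ℝ) (f g : ℝ → E) : Prop :=
  ∀ φ : ℝ → ℝ, ContDiff ℝ (⊤ : ℕ∞) φ → HasCompactSupport φ → tsupport φ ⊆ Ioo 0 T →
    ∫ t, deriv φ t • f t ∂(timeMeasure T) = -∫ t, φ t • g t ∂(timeMeasure T)

/-- A parabolic control system: a Gelfand triple `V ↪ H ≅ H* ↪ V*` with dense compact embedding
`ι : V → H`, a continuous bilinear form `a` on `V` with a Gårding inequality, a control operator
`B : L²(ω, ϱ) → V*`, initial state, desired state, tolerance `δ₀`, and bounds on the controls. -/
structure ControlSystem (V H : Type*) [NormedAddCommGroup V] [InnerProductSpace ℝ V]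
    [NormedAddCommGroup H] [InnerProductSpace ℝ H]
    {ω : Type*} [MeasurableSpace ω] (ϱ : Measure ω) where
  /-- the embedding of `V` into `H` -/
  ι : V →L[ℝ] H
  ι_injective : Function.Injective ι
  ι_denseRange : DenseRange ι
  ι_compact : IsCompactOperator ι
  /-- the bilinear form; as a map `V → V*` it is the operator `A` -/
  a : V →L[ℝ] StrongDual ℝ V
  garding : ∃ α₀ > 0, ∃ ω₀ ≥ 0, ∀ v : V, α₀ * ‖v‖ ^ 2 ≤ a v v + ω₀ * ‖ι v‖ ^ 2
  /-- the control operator -/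
  B : Lp ℝ 2 ϱ →L[ℝ] StrongDual ℝ V
  /-- the initial state -/
  y₀ : H
  /-- the desired state -/
  y_d : H
  /-- the radius of the target ball -/
  δ₀ : ℝ
  δ₀_pos : 0 < δ₀
  /-- the lower bound of the controls -/
  u_a : ω → ℝ
  /-- the upper bound of the controls -/
  u_b : ω → ℝ
  u_a_memLp : MemLp u_a ∞ ϱ
  u_b_memLp : MemLp u_b ∞ ϱ
  u_a_lt_u_b : ∀ᵐ x ∂ϱ, u_a x < u_b x

namespace ControlSystem

variable {V H : Type*} [NormedAddCommGroup V] [InnerProductSpace ℝ V]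
  [NormedAddCommGroup H] [InnerProductSpace ℝ H]
  {ω : Type*} [MeasurableSpace ω] {ϱ : Measure ω} (S : ControlSystem V H ϱ)

/-- The embedding `V ↪ H ≅ H* ↪ V*`, `v ↦ (w ↦ ⟪v, w⟫_H)`. -/
def toVDual : V →L[ℝ] StrongDual ℝ V :=
  ((innerSL ℝ : H →L[ℝ] H →L[ℝ] ℝ).bilinearComp S.ι S.ι)

/-- The adjoint `A* : V → V*`, `⟨A* p, v⟩ = a(v, p)`. -/
def aStar : V →L[ℝ] StrongDual ℝ V := S.a.flip

/-- The adjoint `B* : V → L²(ω, ϱ)`, characterised by `⟪B* p, w⟫_{L²} = ⟨B w, p⟩`. -/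
def BStar (p : V) : Lp ℝ 2 ϱ :=
  (InnerProductSpace.toDual ℝ (Lp ℝ 2 ϱ)).symm (S.B.flip p)

/-- `y` belongs to `W(0, T) = H¹(0, T; V*) ∩ L²(0, T; V)` and has the weak time derivative `y'`. -/
def MemW (T : ℝ) (y : ℝ → V) (y' : ℝ → StrongDual ℝ V) : Prop :=
  MemLp y 2 (timeMeasure T) ∧ MemLp y' 2 (timeMeasure T) ∧
    HasWeakTimeDeriv T (fun t => S.toVDual (y t)) y'

/-- The value at time `τ ∈ [0, T]` of the representative of `y` in `C([0, T]; H)` is `h`. -/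
def HasTrace (T : ℝ) (y : ℝ → V) (τ : ℝ) (h : H) : Prop :=
  ∃ c : ℝ → H, ContinuousOn c (Icc 0 T) ∧ (∀ᵐ t ∂(timeMeasure T), c t = S.ι (y t)) ∧ c τ = h

/-- The set `U_ad ⊆ L²(ω, ϱ)` given by the pointwise bounds. -/
def Uad : Set (Lp ℝ 2 ϱ) := {u | ∀ᵐ x ∂ϱ, S.u_a x ≤ u x ∧ u x ≤ S.u_b x}

/-- The admissible controls on `(0, T)`: the elements `u` of `L²((0, T) × ω) = L²(0, T; L²(ω))`
with `u(t) ∈ U_ad` for almost every `t`. -/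
def UadT (T : ℝ) : Set (ℝ → Lp ℝ 2 ϱ) :=
  {u | MemLp u 2 (timeMeasure T) ∧ ∀ᵐ t ∂(timeMeasure T), u t ∈ S.Uad}

/-- `y ∈ W(0, T)` solves `∂ₜ y + ν A y = ν B u` on `(0, T)`, `y(0) = y₀`. -/
def IsState (T ν : ℝ) (u : ℝ → Lp ℝ 2 ϱ) (y : ℝ → V) : Prop :=
  S.MemW T y (fun t => ν • (S.B (u t) - S.a (y t))) ∧ S.HasTrace T y 0 S.y₀

/-- `p ∈ W(0, 1)` solves `-∂ₜ p + ν A* p = 0` on `(0, 1)`, `p(1) = p₁`. -/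
def IsAdjointState (ν : ℝ) (p₁ : H) (p : ℝ → V) : Prop :=
  S.MemW 1 p (fun t => ν • S.aStar (p t)) ∧ S.HasTrace 1 p 1 p₁

/-- `h ∈ H` is the final value `y(T)` of the state `y` belonging to the control `u`. -/
def IsFinalValue (T ν : ℝ) (u : ℝ → Lp ℝ 2 ϱ) (h : H) : Prop :=
  ∃ y : ℝ → V, S.IsState T ν u y ∧ S.HasTrace T y T h

/-- The minimal distance value function
`δ(T) = inf {‖y[u](T) - y_d‖ - δ₀ : u ∈ U_ad(0, T)}`, where `∂ₜ y + A y = B u`, `y(0) = y₀`. -/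
def delta (T : ℝ) : ℝ :=
  sInf {d | ∃ u ∈ S.UadT T, ∃ h, S.IsFinalValue T 1 u h ∧ d = ‖h - S.y_d‖ - S.δ₀}

/-- The set `ū(ν)` of minimizers over `U_ad(0, 1)` of `‖y(1) - y_d‖`,
where `∂ₜ y + ν A y = ν B u` on `(0, 1)`, `y(0) = y₀`. -/
def minimizers (ν : ℝ) : Set (ℝ → Lp ℝ 2 ϱ) :=
  {u | u ∈ S.UadT 1 ∧ ∃ h, S.IsFinalValue 1 ν u h ∧
    ∀ u' ∈ S.UadT 1, ∀ h', S.IsFinalValue 1 ν u' h' → ‖h - S.y_d‖ ≤ ‖h' - S.y_d‖}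

/-- The unique continuation property on `(0, 1) × ω`: if an adjoint state `p` with some terminal
value in `H` satisfies `B* p = 0` almost everywhere on a set of nonzero measure, then `p = 0`. -/
def UniqueContinuation (ν : ℝ) : Prop :=
  ∀ (p₁ : H) (p : ℝ → V), S.IsAdjointState ν p₁ p →
    ∀ Λ : Set (ℝ × ω), MeasurableSet Λ → (timeMeasure 1).prod ϱ Λ ≠ 0 →
      (∀ᵐ t ∂(timeMeasure 1), ∀ᵐ x ∂ϱ, (t, x) ∈ Λ → S.BStar (p t) x = 0) →
      ∀ᵐ t ∂(timeMeasure 1), p t = 0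

/-- The values `∫₀¹ ⟨B u - A y, p⟩ dt`, where `u` runs through `ū(ν)`, `y` is the state of `u` and
`p` is the adjoint state with `p(1) = (y(1) - y_d) / ‖y(1) - y_d‖`. -/
def derivativeValues (ν : ℝ) : Set ℝ :=
  {d | ∃ u ∈ S.minimizers ν, ∃ (y : ℝ → V) (h : H) (p : ℝ → V),
    S.IsState 1 ν u y ∧ S.HasTrace 1 y 1 h ∧
    S.IsAdjointState ν (‖h - S.y_d‖⁻¹ • (h - S.y_d)) p ∧
    d = ∫ t, (S.B (u t) - S.a (y t)) (p t) ∂(timeMeasure 1)}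

end ControlSystem

end

/-! ### Integrals over the unit time interval -/

/-! Rescaling time to the unit interval turns `δ(ν) + δ₀` into the minimum of `‖L_ν u + b_ν‖` over
one fixed nonempty, bounded, closed, convex set of controls in `L²(0,1; L²(ω))` (`delta_eq`). Here
`L_ν u + b_ν = y(1) - y_d`, and only this affine map depends on `ν`. The theorem is then an instance
of Danskin's envelope theorem (`hasDerivAt_minNorm`): where the minimizer `u₀` is unique and the
minimum is positive, the minimum has the same derivative as `ν ↦ ‖L_ν u₀ + b_ν‖` with `u₀` frozen.

Dependence on `ν`. The equation is moved from `V*` to `V` by the Riesz map and reads `(J y)' + ν A y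
= f` with `J = ι†ι`. The energy inequality bounds a `C¹` function by its data, and such data are
dense, so a solution operator arises by continuous extension. A `C¹` function solves the equation
for every `ν`, with a right-hand side affine in `ν`; this yields a resolvent identity
(`isResolventFamily_solutionOp`), hence norm differentiability of `L_ν` and `b_ν` with continuous
derivatives.

Envelope argument. Weak compactness is replaced by an intersection property of nested bounded closed
convex sets (`exists_forall_mem_of_antitone_convex`). As `ν' → ν`, minimizers for `ν'` converge
weakly to the unique minimizer for `ν`, while the final values converge strongly, because norm
convergence to the element of least norm of a convex set forces strong convergence. Weak times
strong convergence gives both the derivative and its continuity in `ν`.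

Uniqueness (`minimizer_unique`). Two minimizers `u`, `v` have the same final value, with `z = y(1) -
y_d ≠ 0`. Let `p` be the adjoint state with `p(1) = z`. Exchanging `u` and `v` on a rectangle in
time and space keeps them admissible, so the first order condition, used in both directions, gives
`∫ (u - v) B*p = 0` over every rectangle, whence `(u - v) B*p = 0` almost everywhere. If `u ≠ v`,
then `B*p` vanishes on a set of positive measure, unique continuation gives `p = 0`, and so `z = 0`,
a contradiction.

Formula. The `ν`-derivative of `y(1)` is the final value of the solution with source `B u - A y` and
zero initial value (`controlEndOpDeriv_add`). Pairing it with the normalised `z` and using duality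
(`IsAdjointState.duality`) produces the stated integral. -/

instance timeMeasure_isFiniteMeasure (T : ℝ) : IsFiniteMeasure (timeMeasure T) := by
  unfold timeMeasure; infer_instance

lemma ae_timeMeasure_mem (T : ℝ) : ∀ᵐ t ∂(timeMeasure T), t ∈ Ioo 0 T :=
  ae_restrict_mem measurableSet_Ioo

section TimeIntegrals

variable {E F G : Type*} [NormedAddCommGroup E] [NormedSpace ℝ E]
  [NormedAddCommGroup F] [NormedSpace ℝ F] [NormedAddCommGroup G] [NormedSpace ℝ G]

lemma integral_timeMeasure_one (f : ℝ → E) :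
    ∫ t, f t ∂(timeMeasure 1) = ∫ t in (0 : ℝ)..1, f t := by
  rw [intervalIntegral.integral_of_le zero_le_one, integral_Ioc_eq_integral_Ioo, timeMeasure]

omit [NormedSpace ℝ E] in
lemma MeasureTheory.Integrable.intervalIntegrable_timeMeasure {f : ℝ → E}
    (hf : Integrable f (timeMeasure 1)) : IntervalIntegrable f volume 0 1 :=
  (intervalIntegrable_iff_integrableOn_Ioo_of_le zero_le_one).2 hf

omit [NormedSpace ℝ E] in
lemma IntervalIntegrable.mono_unit {f : ℝ → E} (hf : IntervalIntegrable f volume 0 1)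
    {s t : ℝ} (hs : s ∈ Icc (0 : ℝ) 1) (ht : t ∈ Icc (0 : ℝ) 1) :
    IntervalIntegrable f volume s t := by
  refine hf.mono_set ?_
  rw [uIcc_of_le zero_le_one]
  exact OrdConnected.uIcc_subset inferInstance hs ht

lemma intervalIntegral_eq_integral_ite_lt (g : ℝ → E) {t : ℝ} (ht : t ∈ Ioo (0 : ℝ) 1) :
    ∫ s in (0 : ℝ)..t, g s = ∫ s, (if s < t then g s else 0) ∂(timeMeasure 1) := by
  have h : (fun s => if s < t then g s else 0) = (Iio t).indicator g := by
    ext s; simp [indicator_apply]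
  rw [h, integral_indicator measurableSet_Iio, timeMeasure,
    Measure.restrict_restrict measurableSet_Iio, intervalIntegral.integral_of_le ht.1.le,
    integral_Ioc_eq_integral_Ioo]
  congr 2
  ext s
  simp only [mem_inter_iff, mem_Iio, mem_Ioo]
  exact ⟨fun h => ⟨h.2, h.1, h.2.trans ht.2⟩, fun h => ⟨h.2.1, h.1⟩⟩

lemma intervalIntegral_eq_integral_ite_gt (f : ℝ → E) {s : ℝ} (hs : s ∈ Ioo (0 : ℝ) 1) :
    ∫ t in s..1, f t = ∫ t, (if s < t then f t else 0) ∂(timeMeasure 1) := by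
  have h : (fun t => if s < t then f t else 0) = (Ioi s).indicator f := by
    ext t; simp [indicator_apply]
  rw [h, integral_indicator measurableSet_Ioi, timeMeasure,
    Measure.restrict_restrict measurableSet_Ioi, intervalIntegral.integral_of_le hs.2.le,
    integral_Ioc_eq_integral_Ioo]
  congr 2
  ext t
  simp only [mem_inter_iff, mem_Ioi, mem_Ioo]
  exact ⟨fun h => ⟨h.1, hs.1.trans h.1, h.2⟩, fun h => ⟨h.1, h.2.2⟩⟩

/-- Fubini's theorem on the triangle `0 < s < t < 1`. -/
lemma integral_bilin_primitive_swap [CompleteSpace E] [CompleteSpace F] [CompleteSpace G]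
    (L : E →L[ℝ] F →L[ℝ] G) {f : ℝ → E} {g : ℝ → F}
    (hf : Integrable f (timeMeasure 1)) (hg : Integrable g (timeMeasure 1)) :
    ∫ t, L (f t) (∫ s in (0 : ℝ)..t, g s) ∂(timeMeasure 1)
      = ∫ s, L (∫ t in s..1, f t) (g s) ∂(timeMeasure 1) := by
  have hint : Integrable (fun z : ℝ × ℝ => if z.2 < z.1 then L (f z.1) (g z.2) else 0)
      ((timeMeasure 1).prod (timeMeasure 1)) := by
    have h : (fun z : ℝ × ℝ => if z.2 < z.1 then L (f z.1) (g z.2) else 0)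
        = {z : ℝ × ℝ | z.2 < z.1}.indicator (fun z => L (f z.1) (g z.2)) := by
      ext z; simp [indicator_apply]
    rw [h]
    exact (hf.op_fst_snd (op := fun x y => L x y) (by fun_prop) ⟨‖L‖, L.le_opNorm₂⟩ hg).indicator
      (measurableSet_lt measurable_snd measurable_fst)
  have h1 : ∀ᵐ t ∂(timeMeasure 1), L (f t) (∫ s in (0 : ℝ)..t, g s)
      = ∫ s, (if s < t then L (f t) (g s) else 0) ∂(timeMeasure 1) := by
    filter_upwards [ae_timeMeasure_mem 1] with t ht
    rw [intervalIntegral_eq_integral_ite_lt g ht, ← ContinuousLinearMap.integral_comp_comm]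
    · refine integral_congr_ae (ae_of_all _ fun s => ?_)
      simp only; split_ifs <;> simp
    · have h : (fun s => if s < t then g s else 0) = (Iio t).indicator g := by
        ext s; simp [indicator_apply]
      rw [h]; exact hg.indicator measurableSet_Iio
  have h2 : ∀ᵐ s ∂(timeMeasure 1), L (∫ t in s..1, f t) (g s)
      = ∫ t, (if s < t then L (f t) (g s) else 0) ∂(timeMeasure 1) := by
    filter_upwards [ae_timeMeasure_mem 1] with s hs
    rw [intervalIntegral_eq_integral_ite_gt f hs]
    change L.flip (g s) _ = _
    rw [← ContinuousLinearMap.integral_comp_comm]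
    · refine integral_congr_ae (ae_of_all _ fun t => ?_)
      simp only; split_ifs <;> simp
    · have h : (fun t => if s < t then f t else 0) = (Ioi s).indicator f := by
        ext t; simp [indicator_apply]
      rw [h]; exact hf.indicator measurableSet_Ioi
  rw [integral_congr_ae h1, integral_congr_ae h2]
  exact integral_integral_swap hint

lemma eq_zero_of_tsupport_subset_Ioo {φ : ℝ → ℝ} {T : ℝ} (hs : tsupport φ ⊆ Ioo 0 T) :
    φ 0 = 0 ∧ φ T = 0 := by
  constructor
  · exact image_eq_zero_of_notMem_tsupport fun h => lt_irrefl _ (hs h).1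
  · exact image_eq_zero_of_notMem_tsupport fun h => lt_irrefl _ (hs h).2

lemma MeasureTheory.Integrable.continuousOn_primitive {g : ℝ → E}
    (hg : Integrable g (timeMeasure 1)) :
    ContinuousOn (fun t => ∫ s in (0 : ℝ)..t, g s) (Icc 0 1) := by
  have := intervalIntegral.continuousOn_primitive_interval
    (f := g) (μ := volume) (a := 0) (b := 1) (by
      rw [uIcc_of_le zero_le_one]; exact (integrableOn_Icc_iff_integrableOn_Ioo).2 hg)
  rwa [uIcc_of_le zero_le_one] at this

lemma MeasureTheory.Integrable.continuous_smul_timeMeasure {f : ℝ → E} {T : ℝ}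
    (hf : Integrable f (timeMeasure T)) {ψ : ℝ → ℝ} (hψ : Continuous ψ) :
    Integrable (fun t => ψ t • f t) (timeMeasure T) := by
  obtain ⟨M, hM⟩ := isCompact_Icc.exists_bound_of_continuousOn (hψ.continuousOn (s := Icc 0 T))
  refine hf.bdd_smul M hψ.aestronglyMeasurable ?_
  filter_upwards [ae_timeMeasure_mem T] with t ht
  exact hM t (Ioo_subset_Icc_self ht)

/-- A primitive of `g` has weak derivative `g`. -/
lemma hasWeakTimeDeriv_of_ae_eq_primitive [CompleteSpace E] {f g : ℝ → E} {C : E}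
    (hg : Integrable g (timeMeasure 1))
    (h : ∀ᵐ t ∂(timeMeasure 1), f t = C + ∫ s in (0 : ℝ)..t, g s) :
    HasWeakTimeDeriv 1 f g := by
  intro φ hφ hc hs
  have hd : Continuous (deriv φ) := hφ.continuous_deriv (by simp)
  have hdi : Integrable (deriv φ) (timeMeasure 1) :=
    (hd.integrableOn_Icc (a := 0) (b := 1)).mono_set Ioo_subset_Icc_self
  have hFTC : ∀ a b : ℝ, ∫ t in a..b, deriv φ t = φ b - φ a := fun a b =>
    intervalIntegral.integral_deriv_eq_sub (fun x _ => (hφ.differentiable (by simp)) x)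
      (hd.intervalIntegrable _ _)
  obtain ⟨h0, h1⟩ := eq_zero_of_tsupport_subset_Ioo hs
  have key := integral_bilin_primitive_swap (ContinuousLinearMap.lsmul ℝ ℝ : ℝ →L[ℝ] E →L[ℝ] E)
    hdi hg
  simp only [ContinuousLinearMap.lsmul_apply] at key
  have hint : Integrable (fun t => deriv φ t • ∫ s in (0 : ℝ)..t, g s) (timeMeasure 1) := by
    exact ((hd.continuousOn.smul hg.continuousOn_primitive).integrableOn_Icc).mono_set Ioo_subset_Icc_self
  calc ∫ t, deriv φ t • f t ∂(timeMeasure 1)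
      = ∫ t, (deriv φ t • C + deriv φ t • ∫ s in (0 : ℝ)..t, g s) ∂(timeMeasure 1) := by
        refine integral_congr_ae ?_
        filter_upwards [h] with t ht
        rw [ht, smul_add]
    _ = ∫ s, (∫ t in s..1, deriv φ t) • g s ∂(timeMeasure 1) := by
        rw [integral_add (hdi.smul_const C) hint, key, integral_smul_const,
          integral_timeMeasure_one, hFTC, h0, h1, sub_zero, zero_smul, zero_add]
    _ = -∫ t, φ t • g t ∂(timeMeasure 1) := by
        rw [← integral_neg]
        refine integral_congr_ae (ae_of_all _ fun s => ?_)
        simp only [hFTC, h1, zero_sub, neg_smul]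

open scoped ContDiff in
/-- A smooth function with compact support in `(0, 1)` and integral zero is the derivative of
a smooth function with compact support in `(0, 1)`. -/
lemma exists_primitive_of_integral_eq_zero {θ : ℝ → ℝ} (hθ : ContDiff ℝ ∞ θ)
    (hc : HasCompactSupport θ) (hs : tsupport θ ⊆ Ioo 0 1) (h0 : ∫ t in (0 : ℝ)..1, θ t = 0) :
    ∃ φ : ℝ → ℝ, ContDiff ℝ ∞ φ ∧ HasCompactSupport φ ∧ tsupport φ ⊆ Ioo 0 1 ∧ deriv φ = θ := by
  rcases (tsupport θ).eq_empty_or_nonempty with he | hne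
  · refine ⟨0, contDiff_const, HasCompactSupport.zero, by simp, ?_⟩
    rw [tsupport_eq_empty_iff] at he
    rw [he]; ext x; simp
  obtain ⟨a, ha, hal⟩ := hc.isCompact.exists_isLeast hne
  obtain ⟨b, hb, hbu⟩ := hc.isCompact.exists_isGreatest hne
  have hzero : ∀ x, x ∉ Icc a b → θ x = 0 := fun x hx =>
    image_eq_zero_of_notMem_tsupport fun h => hx ⟨hal h, hbu h⟩
  have hder : ∀ x, HasDerivAt (fun x => ∫ t in (0 : ℝ)..x, θ t) (θ x) x := fun x =>
    hθ.continuous.integral_hasStrictDerivAt 0 x |>.hasDerivAt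
  have hderiv : deriv (fun x => ∫ t in (0 : ℝ)..x, θ t) = θ := funext fun x => (hder x).deriv
  -- To the left of `a` nothing has been integrated yet; to the right of `b` the whole integral,
  -- which is zero, has been collected.
  have hsupp : Function.support (fun x => ∫ t in (0 : ℝ)..x, θ t) ⊆ Icc a b := by
    intro x hx
    by_contra hxn
    apply hx
    rcases lt_or_ge x a with hxa | hxa
    · refine (intervalIntegral.integral_congr (g := fun _ => (0 : ℝ)) fun t ht => hzero t ?_).trans
        (by simp)
      rintro ⟨h1, _⟩
      have h3 := ht.2
      have : t ≤ max 0 x := h3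
      rcases le_max_iff.1 this with h | h
      · linarith [(hs ha).1]
      · linarith
    · have hxb : b < x := by by_contra! h; exact hxn ⟨hxa, h⟩
      have h1 : ∫ t in x..1, θ t = 0 := by
        refine (intervalIntegral.integral_congr (g := fun _ => (0 : ℝ))
          fun t ht => hzero t ?_).trans (by simp)
        rintro ⟨_, h1⟩
        have : min x 1 ≤ t := ht.1
        rcases min_le_iff.1 this with h | h
        · linarith
        · linarith [(hs hb).2]
      have := intervalIntegral.integral_add_adjacent_intervals
        (μ := volume) (hθ.continuous.intervalIntegrable 0 x)
        (hθ.continuous.intervalIntegrable x 1)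
      rw [h0, h1, add_zero] at this
      exact this
  have hts : tsupport (fun x => ∫ t in (0 : ℝ)..x, θ t) ⊆ Icc a b :=
    closure_minimal hsupp isClosed_Icc
  refine ⟨_, ?_, HasCompactSupport.of_support_subset_isCompact isCompact_Icc hsupp,
    hts.trans fun x hx => ⟨(hs ha).1.trans_le hx.1, hx.2.trans_lt (hs hb).2⟩, hderiv⟩
  exact contDiff_infty_iff_deriv.2 ⟨fun x => (hder x).differentiableAt, by rwa [hderiv]⟩

open scoped ContDiff in
/-- The du Bois-Reymond lemma: a function with weak derivative zero is constant. -/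
lemma HasWeakTimeDeriv.ae_const [CompleteSpace E] {f : ℝ → E} (hf : Integrable f (timeMeasure 1))
    (h : HasWeakTimeDeriv 1 f (fun _ => 0)) : ∃ C, ∀ᵐ t ∂(timeMeasure 1), f t = C := by
  -- A reference bump supported in `[1/4, 3/4]`, of integral one after normalisation. The constant
  -- will be the mean of `f` against it.
  let ρ : ContDiffBump (1 / 2 : ℝ) := ⟨1 / 8, 1 / 4, by norm_num, by norm_num⟩
  set φ₀ : ℝ → ℝ := ρ.normed volume with hφ₀
  have hφs : ContDiff ℝ ∞ φ₀ := ρ.contDiff_normed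
  have hφc : HasCompactSupport φ₀ := ρ.hasCompactSupport_normed
  have hφt : tsupport φ₀ ⊆ Ioo 0 1 := by
    rw [hφ₀, ρ.tsupport_normed_eq, Real.closedBall_eq_Icc]
    intro x hx
    simp only [ρ, mem_Icc] at hx
    constructor <;> linarith [hx.1, hx.2]
  have hint : ∀ θ : ℝ → ℝ, tsupport θ ⊆ Ioo 0 1 → ∫ t in (0 : ℝ)..1, θ t = ∫ t, θ t := by
    intro θ hθ
    rw [← integral_timeMeasure_one, timeMeasure]
    exact setIntegral_eq_integral_of_forall_compl_eq_zero fun x hx =>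
      image_eq_zero_of_notMem_tsupport fun h => hx (hθ h)
  have hφ1 : ∫ t in (0 : ℝ)..1, φ₀ t = 1 := by
    rw [hint _ hφt]; exact ρ.integral_normed
  have hsm : ∀ ψ : ℝ → ℝ, Continuous ψ → Integrable (fun t => ψ t • f t) (timeMeasure 1) :=
    fun ψ hψ => hf.continuous_smul_timeMeasure hψ
  refine ⟨∫ t, φ₀ t • f t ∂(timeMeasure 1), ?_⟩
  set C := ∫ t, φ₀ t • f t ∂(timeMeasure 1)
  have hloc : LocallyIntegrableOn (fun t => f t - C) (Ioo (0 : ℝ) 1) volume :=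
    IntegrableOn.locallyIntegrableOn (hf.sub (integrable_const C))
  have := isOpen_Ioo.ae_eq_zero_of_integral_contDiff_smul_eq_zero hloc fun ψ hψ hψc hψs => by
    set c := ∫ t in (0 : ℝ)..1, ψ t with hcdef
    -- Subtracting `c φ₀` makes the mean of `ψ` zero, so the difference is the derivative of an
    -- admissible test function.
    have hθt : tsupport (fun t => ψ t - c * φ₀ t) ⊆ Ioo 0 1 := by
      refine (tsupport_sub _ _).trans (union_subset hψs ?_)
      exact (tsupport_mul_subset_right).trans hφt
    obtain ⟨φ, h1, h2, h3, h4⟩ := exists_primitive_of_integral_eq_zero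
      (θ := fun t => ψ t - c * φ₀ t) (hψ.sub (contDiff_const.mul hφs))
      (hψc.sub hφc.mul_left) hθt (by
        rw [intervalIntegral.integral_sub (hψ.continuous.intervalIntegrable _ _)
          ((hφs.continuous.intervalIntegrable _ _).const_mul c),
          intervalIntegral.integral_const_mul, hφ1, ← hcdef, mul_one, sub_self])
    have h5 := h φ h1 h2 h3
    rw [h4] at h5
    simp only [smul_zero, integral_zero, neg_zero, sub_smul, mul_smul] at h5
    have hφi : Integrable (fun t => c • φ₀ t • f t) (timeMeasure 1) :=
      (hsm φ₀ hφs.continuous).smul c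
    rw [integral_sub (hsm ψ hψ.continuous) hφi, integral_smul] at h5
    have h6 : ∫ x, ψ x • (f x - C) = ∫ x, ψ x • (f x - C) ∂(timeMeasure 1) := by
      rw [timeMeasure]
      refine (setIntegral_eq_integral_of_forall_compl_eq_zero fun x hx => ?_).symm
      rw [image_eq_zero_of_notMem_tsupport fun h => hx (hψs h), zero_smul]
    have hψi : Integrable ψ (timeMeasure 1) :=
      (hψ.continuous.integrableOn_Icc (a := 0) (b := 1)).mono_set Ioo_subset_Icc_self
    rw [h6]
    simp only [smul_sub]
    rw [integral_sub (hsm ψ hψ.continuous) (hψi.smul_const C), integral_smul_const,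
      integral_timeMeasure_one ψ]
    exact h5
  rw [timeMeasure, ae_restrict_iff' measurableSet_Ioo]
  filter_upwards [this] with t ht hmem
  exact sub_eq_zero.1 (ht hmem)

lemma HasWeakTimeDeriv.sub {T : ℝ} {f₁ f₂ g₁ g₂ : ℝ → E} (h₁ : HasWeakTimeDeriv T f₁ g₁)
    (h₂ : HasWeakTimeDeriv T f₂ g₂) (hf₁ : Integrable f₁ (timeMeasure T))
    (hf₂ : Integrable f₂ (timeMeasure T)) (hg₁ : Integrable g₁ (timeMeasure T))
    (hg₂ : Integrable g₂ (timeMeasure T)) :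
    HasWeakTimeDeriv T (fun t => f₁ t - f₂ t) (fun t => g₁ t - g₂ t) := by
  intro φ hφ hc hs
  have hd : Continuous (deriv φ) := hφ.continuous_deriv (by simp)
  simp only [smul_sub]
  rw [integral_sub (hf₁.continuous_smul_timeMeasure hd) (hf₂.continuous_smul_timeMeasure hd),
    integral_sub (hg₁.continuous_smul_timeMeasure hφ.continuous)
      (hg₂.continuous_smul_timeMeasure hφ.continuous), h₁ φ hφ hc hs, h₂ φ hφ hc hs]
  abel

lemma HasWeakTimeDeriv.congr {T : ℝ} {f₁ f₂ g₁ g₂ : ℝ → E} (h : HasWeakTimeDeriv T f₁ g₁)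
    (hf : f₁ =ᵐ[timeMeasure T] f₂) (hg : g₁ =ᵐ[timeMeasure T] g₂) :
    HasWeakTimeDeriv T f₂ g₂ := by
  intro φ hφ hc hs
  rw [← integral_congr_ae (hf.mono fun t ht => congrArg (deriv φ t • ·) ht),
    ← integral_congr_ae (hg.mono fun t ht => congrArg (φ t • ·) ht)]
  exact h φ hφ hc hs

/-- A function with an integrable weak derivative is a primitive of it. -/
lemma HasWeakTimeDeriv.ae_eq_primitive [CompleteSpace E] {f g : ℝ → E}
    (h : HasWeakTimeDeriv 1 f g)
    (hf : Integrable f (timeMeasure 1)) (hg : Integrable g (timeMeasure 1)) :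
    ∃ C, ∀ᵐ t ∂(timeMeasure 1), f t = C + ∫ s in (0 : ℝ)..t, g s := by
  have hp : HasWeakTimeDeriv 1 (fun t => ∫ s in (0 : ℝ)..t, g s) g :=
    hasWeakTimeDeriv_of_ae_eq_primitive (C := 0) hg (ae_of_all _ fun t => by simp)
  have hpi : Integrable (fun t => ∫ s in (0 : ℝ)..t, g s) (timeMeasure 1) :=
    hg.continuousOn_primitive.integrableOn_Icc.mono_set Ioo_subset_Icc_self
  obtain ⟨C, hC⟩ := HasWeakTimeDeriv.ae_const (hf.sub hpi)
    ((h.sub hp hf hpi hg hg).congr (ae_of_all _ fun _ => rfl) (ae_of_all _ fun _ => by simp))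
  refine ⟨C, hC.mono fun t ht => ?_⟩
  rw [← ht]; simp

/-- If all integrals `∫ s in 0..t, g s` vanish, so does `g`. -/
lemma ae_eq_zero_of_primitive_eq_zero [CompleteSpace E] {g : ℝ → E}
    (hg : Integrable g (timeMeasure 1))
    (h : ∀ t ∈ Icc (0 : ℝ) 1, ∫ s in (0 : ℝ)..t, g s = 0) : ∀ᵐ t ∂(timeMeasure 1), g t = 0 := by
  have hw : HasWeakTimeDeriv 1 (fun _ => (0 : E)) g := by
    refine hasWeakTimeDeriv_of_ae_eq_primitive (C := 0) hg ?_
    filter_upwards [ae_timeMeasure_mem 1] with t ht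
    rw [h t (Ioo_subset_Icc_self ht), add_zero]
  have := isOpen_Ioo.ae_eq_zero_of_integral_contDiff_smul_eq_zero
    (IntegrableOn.locallyIntegrableOn hg) fun ψ hψ hψc hψs => by
      have h5 := hw ψ hψ hψc hψs
      simp only [smul_zero, integral_zero] at h5
      rw [← neg_eq_zero, h5, neg_inj, timeMeasure]
      refine (setIntegral_eq_integral_of_forall_compl_eq_zero fun x hx => ?_).symm
      rw [image_eq_zero_of_notMem_tsupport fun h => hx (hψs h), zero_smul]
  rw [timeMeasure, ae_restrict_iff' measurableSet_Ioo]
  exact this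

end TimeIntegrals

/-! ### Linear evolution equations on the unit interval -/

open scoped InnerProductSpace BoundedContinuousFunction

lemma measurePreserving_one_sub :
    MeasurePreserving (fun t : ℝ => 1 - t) (timeMeasure 1) (timeMeasure 1) := by
  have h := (Measure.measurePreserving_sub_left (volume : Measure ℝ) 1).restrict_preimage
    (measurableSet_Ioo (a := (0 : ℝ)) (b := 1))
  have h2 : (fun t : ℝ => 1 - t) ⁻¹' Ioo 0 1 = Ioo 0 1 := by
    ext t; simp only [mem_preimage, mem_Ioo]; constructor <;> rintro ⟨h, h'⟩ <;> constructor <;> linarith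
  rwa [h2] at h

section LinearTheory

variable {V H : Type*} [NormedAddCommGroup V] [InnerProductSpace ℝ V] [CompleteSpace V]
  [NormedAddCommGroup H] [InnerProductSpace ℝ H] [CompleteSpace H]

/-- The operator `ι† ∘ ι` representing the `H`-inner product on `V`. -/
noncomputable def gramOp (ι : V →L[ℝ] H) : V →L[ℝ] V := ι.adjoint ∘L ι

lemma inner_gramOp (ι : V →L[ℝ] H) (v w : V) : ⟪gramOp ι v, w⟫_ℝ = ⟪ι v, ι w⟫_ℝ := by
  simp [gramOp, ContinuousLinearMap.adjoint_inner_left]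

lemma inner_gramOp_right (ι : V →L[ℝ] H) (v w : V) : ⟪v, gramOp ι w⟫_ℝ = ⟪gramOp ι v, w⟫_ℝ := by
  rw [inner_gramOp, real_inner_comm, inner_gramOp, real_inner_comm]

/-- Gårding's inequality for an operator on `V` with respect to `ι : V → H`. -/
def IsGarding (ι : V →L[ℝ] H) (A : V →L[ℝ] V) : Prop :=
  ∃ α > 0, ∃ ω₀ ≥ 0, ∀ v : V, α * ‖v‖ ^ 2 ≤ ⟪A v, v⟫_ℝ + ω₀ * ‖ι v‖ ^ 2

omit [CompleteSpace H] in
lemma IsGarding.adjoint {ι : V →L[ℝ] H} {A : V →L[ℝ] V} (h : IsGarding ι A) :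
    IsGarding ι A.adjoint := by
  obtain ⟨α, hα, ω₀, hω, h⟩ := h
  refine ⟨α, hα, ω₀, hω, fun v => ?_⟩
  rw [ContinuousLinearMap.adjoint_inner_left, real_inner_comm]
  exact h v

/-- Energy inequality with Gronwall's argument. -/
lemma energy_inequality {ι : V →L[ℝ] H} {A : V →L[ℝ] V} {α ω₀ ν : ℝ} (hα : 0 < α)
    (hG : ∀ v : V, α * ‖v‖ ^ 2 ≤ ⟪A v, v⟫_ℝ + ω₀ * ‖ι v‖ ^ 2) (hν : 0 < ν)
    {z ζ : ℝ → V} (hζ : Continuous ζ) (hz : ∀ t, HasDerivAt z (ζ t) t) {t : ℝ} (ht : 0 ≤ t) :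
    Real.exp (-(2 * ν * ω₀) * t) * ‖ι (z t)‖ ^ 2
      + ν * α * ∫ s in (0 : ℝ)..t, Real.exp (-(2 * ν * ω₀) * s) * ‖z s‖ ^ 2
    ≤ ‖ι (z 0)‖ ^ 2 + (ν * α)⁻¹ *
      ∫ s in (0 : ℝ)..t, Real.exp (-(2 * ν * ω₀) * s) * ‖gramOp ι (ζ s) + ν • A (z s)‖ ^ 2 := by
  have hzc : Continuous z := continuous_iff_continuousAt.2 fun t => (hz t).continuousAt
  set k := 2 * ν * ω₀ with hk
  set f : ℝ → V := fun s => gramOp ι (ζ s) + ν • A (z s) with hf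
  have hfc : Continuous f := by fun_prop
  have c1 : Continuous fun s => Real.exp (-k * s) * ‖z s‖ ^ 2 := by fun_prop
  have c2 : Continuous fun s => Real.exp (-k * s) * ‖f s‖ ^ 2 := by fun_prop
  -- The terms of the inequality that vary with `t`, collected on one side; it suffices that `m`
  -- decreases.
  let m : ℝ → ℝ := fun t => Real.exp (-k * t) * ‖ι (z t)‖ ^ 2
      + ν * α * (∫ s in (0 : ℝ)..t, Real.exp (-k * s) * ‖z s‖ ^ 2)
      - (ν * α)⁻¹ * ∫ s in (0 : ℝ)..t, Real.exp (-k * s) * ‖f s‖ ^ 2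
  have hm : ∀ t, HasDerivAt m ((Real.exp (-k * t) * (-k)) * ‖ι (z t)‖ ^ 2
      + Real.exp (-k * t) * (2 * ⟪ι (z t), ι (ζ t)⟫_ℝ)
      + ν * α * (Real.exp (-k * t) * ‖z t‖ ^ 2)
      - (ν * α)⁻¹ * (Real.exp (-k * t) * ‖f t‖ ^ 2)) t := by
    intro t
    have e1 : HasDerivAt (fun t => Real.exp (-k * t)) (Real.exp (-k * t) * (-k)) t := by
      simpa using ((hasDerivAt_id t).const_mul (-k)).exp
    have e2 : HasDerivAt (fun t => ‖ι (z t)‖ ^ 2) (2 * ⟪ι (z t), ι (ζ t)⟫_ℝ) t :=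
      (ι.hasFDerivAt.comp_hasDerivAt t (hz t)).norm_sq
    have e3 := (c1.integral_hasStrictDerivAt 0 t).hasDerivAt
    have e4 := (c2.integral_hasStrictDerivAt 0 t).hasDerivAt
    exact ((e1.mul e2).add (e3.const_mul (ν * α))).sub (e4.const_mul (ν * α)⁻¹)
  have hanti : Antitone m := by
    refine antitone_of_hasDerivAt_nonpos hm fun t => ?_
    have h1 : ⟪ι (z t), ι (ζ t)⟫_ℝ = ⟪f t, z t⟫_ℝ - ν * ⟪A (z t), z t⟫_ℝ := by
      rw [hf]; simp only
      rw [inner_add_left, inner_gramOp, real_inner_smul_left, real_inner_comm]; ring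
    -- Young's inequality with weight `ν α`: Gårding supplies `-2 ν α ‖z‖²`, of which one half
    -- absorbs this term and the other half is kept in the estimate. The exponent `k = 2 ν ω₀`
    -- cancels the remaining `‖ι z‖²`.
    have h2 : 2 * ⟪f t, z t⟫_ℝ ≤ (ν * α)⁻¹ * ‖f t‖ ^ 2 + ν * α * ‖z t‖ ^ 2 := by
      have h3 := real_inner_le_norm (f t) (z t)
      have h4 : 0 ≤ (ν * α)⁻¹ * (‖f t‖ - ν * α * ‖z t‖) ^ 2 := by positivity
      have h5 : (ν * α)⁻¹ * (‖f t‖ - ν * α * ‖z t‖) ^ 2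
          = (ν * α)⁻¹ * ‖f t‖ ^ 2 - 2 * (‖f t‖ * ‖z t‖) + ν * α * ‖z t‖ ^ 2 := by
        have : (ν * α)⁻¹ * (ν * α) = 1 := inv_mul_cancel₀ (by positivity)
        linear_combination (ν * α * ‖z t‖ ^ 2 - 2 * ‖f t‖ * ‖z t‖) * this
      linarith
    have h6 := mul_le_mul_of_nonneg_left (hG (z t)) hν.le
    have h7 : -k * ‖ι (z t)‖ ^ 2 + 2 * ⟪ι (z t), ι (ζ t)⟫_ℝ + ν * α * ‖z t‖ ^ 2
        - (ν * α)⁻¹ * ‖f t‖ ^ 2 ≤ 0 := by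
      rw [h1, hk]; nlinarith
    have h8 := mul_nonpos_of_nonneg_of_nonpos (Real.exp_pos (-k * t)).le h7
    simp only [Pi.zero_apply]
    linarith
  have h := hanti ht
  simp only [m, mul_zero, Real.exp_zero, one_mul, intervalIntegral.integral_same, add_zero,
    sub_zero] at h
  linarith

/-- If `J ∘ Y` is differentiable with `J = ι† ∘ ι` and `Y` continuous, then `⟪J Y, Y⟫` is
differentiable. -/
lemma hasDerivAt_inner_gramOp {ι : V →L[ℝ] H} {Y : ℝ → V} {D : V} {t : ℝ}
    (hY : ContinuousAt Y t) (hD : HasDerivAt (fun s => gramOp ι (Y s)) D t) :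
    HasDerivAt (fun s => ⟪gramOp ι (Y s), Y s⟫_ℝ) (2 * ⟪D, Y t⟫_ℝ) t := by
  rw [hasDerivAt_iff_tendsto_slope] at hD ⊢
  -- Since `J` is symmetric, the difference quotient of `⟪J Y, Y⟫` is that of `J Y` paired with `Y s
  -- + Y t`. Hence `Y` itself need not be differentiable.
  have h1 : Filter.Tendsto (fun s => Y s + Y t) (𝓝[≠] t) (𝓝 (Y t + Y t)) :=
    (hY.mono_left nhdsWithin_le_nhds).add tendsto_const_nhds
  have h2 := hD.inner (𝕜 := ℝ) h1
  have h3 : 2 * ⟪D, Y t⟫_ℝ = ⟪D, Y t + Y t⟫_ℝ := by rw [inner_add_right]; ring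
  rw [h3]
  refine h2.congr fun s => ?_
  simp only [slope_def_module, real_inner_smul_left, inner_sub_left, inner_add_right, smul_eq_mul]
  have h4 : ⟪gramOp ι (Y t), Y s⟫_ℝ = ⟪gramOp ι (Y s), Y t⟫_ℝ := by
    rw [inner_gramOp, inner_gramOp, real_inner_comm]
  rw [h4]
  ring

/-- Uniqueness for the time-integrated homogeneous equation. -/
lemma ae_eq_zero_of_gramOp_eq_primitive {ι : V →L[ℝ] H} (hι : Function.Injective ι)
    {A : V →L[ℝ] V} (hG : IsGarding ι A) {ν : ℝ} (hν : 0 < ν) {y : ℝ → V}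
    (hy : Integrable y (timeMeasure 1))
    (h : ∀ᵐ t ∂(timeMeasure 1), gramOp ι (y t) = -(ν • A (∫ s in (0 : ℝ)..t, y s))) :
    ∀ᵐ t ∂(timeMeasure 1), y t = 0 := by
  obtain ⟨α, hα, ω₀, hω, hG⟩ := hG
  refine ae_eq_zero_of_primitive_eq_zero hy ?_
  -- The energy argument is run on the primitive `Y`, which is continuous into `V` and solves `(J
  -- Y)' = -ν A Y`, `Y 0 = 0`; the function `y` is only integrable.
  set Y : ℝ → V := fun t => ∫ s in (0 : ℝ)..t, y s with hYdef
  have hYc : ContinuousOn Y (Icc 0 1) := hy.continuousOn_primitive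
  have hJY : ∀ t ∈ Icc (0 : ℝ) 1, gramOp ι (Y t) = ∫ s in (0 : ℝ)..t, -(ν • A (Y s)) := by
    intro t ht
    rw [hYdef]
    simp only
    rw [← ContinuousLinearMap.intervalIntegral_comp_comm _
      (hy.intervalIntegrable_timeMeasure.mono_unit (by simp) ht)]
    refine intervalIntegral.integral_congr_ae ?_
    rw [timeMeasure, ae_restrict_iff' measurableSet_Ioo] at h
    filter_upwards [h, Measure.ae_ne volume t] with s hs hst hmem
    rw [uIoc_of_le ht.1] at hmem
    exact hs ⟨hmem.1, (lt_of_le_of_ne hmem.2 hst).trans_le ht.2⟩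
  have hder : ∀ t ∈ Ioo (0 : ℝ) 1, HasDerivAt (fun s => gramOp ι (Y s)) (-(ν • A (Y t))) t := by
    intro t ht
    have hc : ContinuousOn (fun s => -(ν • A (Y s))) (Icc 0 1) :=
      (A.continuous.comp_continuousOn hYc |>.const_smul ν).neg
    have hca : ContinuousAt (fun s => -(ν • A (Y s))) t := hc.continuousAt (Icc_mem_nhds ht.1 ht.2)
    have := intervalIntegral.integral_hasDerivAt_right (a := 0) (b := t)
      ((hc.mono (by rw [uIcc_of_le ht.1.le]; exact Icc_subset_Icc_right ht.2.le)).intervalIntegrable)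
      (hc.stronglyMeasurableAtFilter_nhdsWithin measurableSet_Icc t |>.filter_mono (by
        rw [nhdsWithin_eq_nhds.2 (Icc_mem_nhds ht.1 ht.2)])) hca
    refine this.congr_of_eventuallyEq ?_
    filter_upwards [Icc_mem_nhds ht.1 ht.2] with s hs
    exact hJY s hs
  let m : ℝ → ℝ := fun t => Real.exp (-(2 * ν * ω₀) * t) * ⟪gramOp ι (Y t), Y t⟫_ℝ
  have hmd : ∀ t ∈ Ioo (0 : ℝ) 1, HasDerivAt m
      (Real.exp (-(2 * ν * ω₀) * t) * (-(2 * ν * ω₀)) * ⟪gramOp ι (Y t), Y t⟫_ℝ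
        + Real.exp (-(2 * ν * ω₀) * t) * (2 * ⟪-(ν • A (Y t)), Y t⟫_ℝ)) t := by
    intro t ht
    have e1 : HasDerivAt (fun t => Real.exp (-(2 * ν * ω₀) * t))
        (Real.exp (-(2 * ν * ω₀) * t) * (-(2 * ν * ω₀))) t := by
      simpa using ((hasDerivAt_id t).const_mul (-(2 * ν * ω₀))).exp
    exact e1.mul (hasDerivAt_inner_gramOp (hYc.continuousAt (Icc_mem_nhds ht.1 ht.2)) (hder t ht))
  have hanti : AntitoneOn m (Icc 0 1) := by
    refine antitoneOn_of_deriv_nonpos (convex_Icc 0 1) ?_ ?_ ?_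
    · exact ((Real.continuous_exp.comp (continuous_const.mul continuous_id)).continuousOn).mul
        (((gramOp ι).continuous.comp_continuousOn hYc).inner hYc)
    · rw [interior_Icc]
      exact fun t ht => (hmd t ht).differentiableAt.differentiableWithinAt
    · rw [interior_Icc]
      intro t ht
      rw [(hmd t ht).deriv, inner_neg_left, real_inner_smul_left, inner_gramOp,
        real_inner_self_eq_norm_sq]
      have h1 := hG (Y t)
      have h2 : 0 ≤ α * ‖Y t‖ ^ 2 := by positivity
      have h3 := mul_nonneg hν.le (h2.trans h1)
      have h4 := mul_nonneg (Real.exp_pos (-(2 * ν * ω₀) * t)).le h3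
      nlinarith
  intro t ht
  have h1 := hanti (left_mem_Icc.2 zero_le_one) ht ht.1
  have hY0 : Y 0 = 0 := by simp [hYdef]
  simp only [m, hY0, mul_zero, inner_gramOp, real_inner_self_eq_norm_sq, map_zero, norm_zero,
    ne_eq, OfNat.ofNat_ne_zero, not_false_eq_true, zero_pow] at h1
  have h2 : ‖ι (Y t)‖ ^ 2 ≤ 0 := by
    by_contra! h3
    exact absurd h1 (not_le.2 (mul_pos (Real.exp_pos _) h3))
  have h3 : ι (Y t) = 0 := by
    rw [← norm_eq_zero]; exact pow_eq_zero_iff two_ne_zero |>.1 (le_antisymm h2 (by positivity))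
  exact hι (by rw [h3, map_zero])

end LinearTheory

/-! ### The solution operator, by extension from `C¹` functions -/

/-- The space `L²(0, 1; E)`. -/
noncomputable abbrev TimeL2 (E : Type*) [NormedAddCommGroup E] := Lp E 2 (timeMeasure 1)

lemma L2_norm_sq {γ E : Type*} [MeasurableSpace γ] {m : Measure γ} [NormedAddCommGroup E]
    [InnerProductSpace ℝ E] (f : Lp E 2 m) : ‖f‖ ^ 2 = ∫ x, ‖f x‖ ^ 2 ∂m := by
  rw [← real_inner_self_eq_norm_sq, L2.inner_def]
  simp only [real_inner_self_eq_norm_sq]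

lemma TimeL2.integrable {E : Type*} [NormedAddCommGroup E] (f : TimeL2 E) :
    Integrable f (timeMeasure 1) :=
  (Lp.memLp f).integrable (by norm_num)

section LinearTheory

variable {V H : Type*} [NormedAddCommGroup V] [InnerProductSpace ℝ V] [CompleteSpace V]
  [NormedAddCommGroup H] [InnerProductSpace ℝ H] [CompleteSpace H]

/-- The function `t ↦ z₀ + ∫₀ᵗ ζ` on `[0, 1]`, extended by its boundary values. -/
noncomputable def clampedPrimitive : V × (ℝ →ᵇ V) →ₗ[ℝ] (ℝ →ᵇ V) where
  toFun d := BoundedContinuousFunction.ofNormedAddCommGroup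
    (fun t => d.1 + ∫ s in (0 : ℝ)..(max 0 (min t 1)), d.2 s)
    (continuous_const.add ((intervalIntegral.continuous_primitive
      (fun a b => d.2.continuous.intervalIntegrable a b) 0).comp (by fun_prop)))
    (‖d.1‖ + ‖d.2‖) (fun t => by
      refine (norm_add_le _ _).trans (add_le_add_right ?_ _)
      have h0 : 0 ≤ max 0 (min t 1) := le_max_left _ _
      have h1 : max 0 (min t 1) ≤ 1 := max_le zero_le_one (min_le_right _ _)
      refine (intervalIntegral.norm_integral_le_of_norm_le_const
        fun s _ => d.2.norm_coe_le_norm s).trans ?_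
      rw [sub_zero, abs_of_nonneg h0]
      exact mul_le_of_le_one_right (norm_nonneg _) h1)
  map_add' d e := by
    ext t
    simp only [BoundedContinuousFunction.coe_ofNormedAddCommGroup, Prod.fst_add, Prod.snd_add,
      BoundedContinuousFunction.coe_add, Pi.add_apply]
    rw [intervalIntegral.integral_add (d.2.continuous.intervalIntegrable _ _)
      (e.2.continuous.intervalIntegrable _ _)]
    abel
  map_smul' c d := by
    ext t
    simp [intervalIntegral.integral_smul, smul_add]

omit [CompleteSpace V] in
lemma clampedPrimitive_apply (d : V × (ℝ →ᵇ V)) {t : ℝ} (ht : t ∈ Icc (0 : ℝ) 1) :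
    clampedPrimitive d t = d.1 + ∫ s in (0 : ℝ)..t, d.2 s := by
  simp [clampedPrimitive, min_eq_left ht.2, max_eq_right ht.1]

/-- The data `(J z' + ν A z, ι z₀)` of the `C¹` function `z = z₀ + ∫ ζ`. -/
noncomputable def evolutionDatum (ι : V →L[ℝ] H) (A : V →L[ℝ] V) (ν : ℝ) :
    V × (ℝ →ᵇ V) →ₗ[ℝ] TimeL2 V × H :=
  LinearMap.prod
    ((BoundedContinuousFunction.toLp 2 (timeMeasure 1) ℝ).toLinearMap ∘ₗ
      (((gramOp ι).compLeftContinuousBounded ℝ).toLinearMap ∘ₗ LinearMap.snd ℝ V (ℝ →ᵇ V)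
        + ν • (A.compLeftContinuousBounded ℝ).toLinearMap ∘ₗ clampedPrimitive))
    (ι.toLinearMap ∘ₗ LinearMap.fst ℝ V (ℝ →ᵇ V))

/-- The `C¹` function `z = z₀ + ∫ ζ` in `L²(0, 1; V) × C([0, 1]; H)`. -/
noncomputable def evolutionPath (ι : V →L[ℝ] H) :
    V × (ℝ →ᵇ V) →ₗ[ℝ] TimeL2 V × (ℝ →ᵇ H) :=
  LinearMap.prod ((BoundedContinuousFunction.toLp 2 (timeMeasure 1) ℝ).toLinearMap ∘ₗ
    clampedPrimitive) ((ι.compLeftContinuousBounded ℝ).toLinearMap ∘ₗ clampedPrimitive)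

/-- The solution operator of `(J y)' + ν A y = f`, `y(0) = h`, with values `(y, trace of y)`. -/
noncomputable def solutionOp (ι : V →L[ℝ] H) (A : V →L[ℝ] V) (ν : ℝ) :
    TimeL2 V × H →L[ℝ] TimeL2 V × (ℝ →ᵇ H) :=
  (evolutionPath ι).extendOfNorm (evolutionDatum ι A ν)

lemma evolutionDatum_fst_ae (ι : V →L[ℝ] H) (A : V →L[ℝ] V) (ν : ℝ) (d : V × (ℝ →ᵇ V)) :
    ∀ᵐ t ∂(timeMeasure 1), (evolutionDatum ι A ν d).1 t
      = gramOp ι (d.2 t) + ν • A (clampedPrimitive d t) := by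
  filter_upwards [BoundedContinuousFunction.coeFn_toLp (p := 2) (μ := timeMeasure 1) (𝕜 := ℝ)
    ((gramOp ι).compLeftContinuousBounded ℝ d.2
      + ν • A.compLeftContinuousBounded ℝ (clampedPrimitive d))] with t ht
  exact ht

lemma evolutionDatum_snd (ι : V →L[ℝ] H) (A : V →L[ℝ] V) (ν : ℝ) (d : V × (ℝ →ᵇ V)) :
    (evolutionDatum ι A ν d).2 = ι d.1 := rfl

omit [CompleteSpace V] [CompleteSpace H] in
lemma evolutionPath_fst_ae (ι : V →L[ℝ] H) (d : V × (ℝ →ᵇ V)) :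
    ∀ᵐ t ∂(timeMeasure 1), (evolutionPath ι d).1 t = clampedPrimitive d t :=
  BoundedContinuousFunction.coeFn_toLp (p := 2) (μ := timeMeasure 1) (𝕜 := ℝ) (clampedPrimitive d)

omit [CompleteSpace V] [CompleteSpace H] in
lemma evolutionPath_snd (ι : V →L[ℝ] H) (d : V × (ℝ →ᵇ V)) (t : ℝ) :
    (evolutionPath ι d).2 t = ι (clampedPrimitive d t) := rfl

/-- The energy inequality at time `1` controls the `L²(0,1; V)` part, and at an arbitrary time the
supremum norm in `H`. The exponential weights are harmless on `[0,1]`. -/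
lemma evolutionPath_bound {ι : V →L[ℝ] H} {A : V →L[ℝ] V} (hG : IsGarding ι A) {ν : ℝ}
    (hν : 0 < ν) : ∃ C, ∀ d, ‖evolutionPath ι d‖ ≤ C * ‖evolutionDatum ι A ν d‖ := by
  obtain ⟨α, hα, ω₀, hω, hG⟩ := hG
  set k := 2 * ν * ω₀ with hk
  have hk0 : 0 ≤ k := by positivity
  set b := (ν * α)⁻¹ with hb
  have hb0 : 0 < b := by positivity
  -- `exp k` undoes the weight, one factor `1 + b` bounds the data, and the other covers the
  -- division by `ν α` in the `L²` part. The `√2` passes from the maximum norm of the product to the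
  -- Euclidean one.
  refine ⟨√(Real.exp k * (1 + b) * (1 + b)) * √2, fun d => ?_⟩
  rw [mul_assoc]
  set D := √2 * ‖evolutionDatum ι A ν d‖ with hD
  have hD2 : ‖(evolutionDatum ι A ν d).1‖ ^ 2 + ‖ι d.1‖ ^ 2 ≤ D ^ 2 := by
    have h1 := norm_fst_le (evolutionDatum ι A ν d)
    have h2 := norm_snd_le (evolutionDatum ι A ν d)
    rw [evolutionDatum_snd] at h2
    rw [hD, mul_pow, Real.sq_sqrt zero_le_two]
    nlinarith [norm_nonneg (evolutionDatum ι A ν d).1, norm_nonneg (ι d.1)]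
  let z : ℝ → V := fun t => d.1 + ∫ s in (0 : ℝ)..t, d.2 s
  have hz : ∀ t, HasDerivAt z (d.2 t) t := fun t =>
    ((d.2.continuous.integral_hasStrictDerivAt 0 t).hasDerivAt).const_add d.1
  have hzc : Continuous z := continuous_iff_continuousAt.2 fun t => (hz t).continuousAt
  have hzp : ∀ t ∈ Icc (0 : ℝ) 1, clampedPrimitive d t = z t := fun t ht =>
    clampedPrimitive_apply d ht
  let f : ℝ → V := fun t => gramOp ι (d.2 t) + ν • A (z t)
  have hfc : Continuous f := by fun_prop
  have hfn : ‖(evolutionDatum ι A ν d).1‖ ^ 2 = ∫ t in (0 : ℝ)..1, ‖f t‖ ^ 2 := by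
    rw [L2_norm_sq, ← integral_timeMeasure_one]
    refine integral_congr_ae ?_
    filter_upwards [evolutionDatum_fst_ae ι A ν d, ae_timeMeasure_mem 1] with t ht ht2
    rw [ht, hzp t (Ioo_subset_Icc_self ht2)]
  have hzn : ‖(evolutionPath ι d).1‖ ^ 2 = ∫ t in (0 : ℝ)..1, ‖z t‖ ^ 2 := by
    rw [L2_norm_sq, ← integral_timeMeasure_one]
    refine integral_congr_ae ?_
    filter_upwards [evolutionPath_fst_ae ι d, ae_timeMeasure_mem 1] with t ht ht2
    rw [ht, hzp t (Ioo_subset_Icc_self ht2)]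
  have hint : ∀ g : ℝ → ℝ, Continuous g → (∀ t, 0 ≤ g t) → ∀ t ∈ Icc (0 : ℝ) 1,
      ∫ s in (0 : ℝ)..t, Real.exp (-k * s) * g s ≤ ∫ s in (0 : ℝ)..1, g s := by
    intro g hg hg0 t ht
    calc ∫ s in (0 : ℝ)..t, Real.exp (-k * s) * g s ≤ ∫ s in (0 : ℝ)..t, g s := by
          refine intervalIntegral.integral_mono_on ht.1
            ((by fun_prop : Continuous fun s => Real.exp (-k * s) * g s).intervalIntegrable _ _)
            (hg.intervalIntegrable _ _) fun s hs => ?_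
          refine mul_le_of_le_one_left (hg0 s) (Real.exp_le_one_iff.2 ?_)
          nlinarith [hs.1]
      _ ≤ ∫ s in (0 : ℝ)..1, g s :=
          intervalIntegral.integral_mono_interval le_rfl ht.1 ht.2 (ae_of_all _ hg0)
            (hg.intervalIntegrable _ _)
  have hE : ∀ t ∈ Icc (0 : ℝ) 1, Real.exp (-k * t) * ‖ι (z t)‖ ^ 2
      + ν * α * ∫ s in (0 : ℝ)..t, Real.exp (-k * s) * ‖z s‖ ^ 2 ≤ (1 + b) * D ^ 2 := by
    intro t ht
    refine (energy_inequality hα hG hν d.2.continuous hz ht.1).trans ?_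
    have h1 := hint (fun s => ‖f s‖ ^ 2) (by fun_prop) (fun s => by positivity) t ht
    rw [← hfn] at h1
    have h2 := mul_le_mul_of_nonneg_left h1 hb0.le
    have h3 : ‖ι (z 0)‖ ^ 2 = ‖ι d.1‖ ^ 2 := by simp [z]
    rw [h3]
    have h4 : 0 ≤ b * ‖ι d.1‖ ^ 2 := by positivity
    have h5 : 0 ≤ ‖(evolutionDatum ι A ν d).1‖ ^ 2 := by positivity
    calc _ ≤ ‖ι d.1‖ ^ 2 + b * ‖(evolutionDatum ι A ν d).1‖ ^ 2 := by gcongr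
      _ ≤ (1 + b) * (‖(evolutionDatum ι A ν d).1‖ ^ 2 + ‖ι d.1‖ ^ 2) := by linarith
      _ ≤ (1 + b) * D ^ 2 := by gcongr
  have hexp : ∀ t ∈ Icc (0 : ℝ) 1, 1 ≤ Real.exp k * Real.exp (-k * t) := by
    intro t ht
    rw [← Real.exp_add]
    exact Real.one_le_exp (by nlinarith [ht.1, ht.2])
  have hD0 : 0 ≤ D := by positivity
  have hb1 : 1 ≤ 1 + b := by linarith
  have key : ∀ x : ℝ, 0 ≤ x → x ^ 2 ≤ Real.exp k * (1 + b) * (1 + b) * D ^ 2 →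
      x ≤ √(Real.exp k * (1 + b) * (1 + b)) * D := by
    intro x hx h
    refine (sq_le_sq₀ hx (by positivity)).1 ?_
    rwa [mul_pow, Real.sq_sqrt (by positivity)]
  refine max_le ?_ ?_
  · refine key _ (norm_nonneg _) ?_
    rw [hzn]
    have h1 : (∫ t in (0 : ℝ)..1, ‖z t‖ ^ 2)
        ≤ Real.exp k * ∫ t in (0 : ℝ)..1, Real.exp (-k * t) * ‖z t‖ ^ 2 := by
      rw [← intervalIntegral.integral_const_mul]
      refine intervalIntegral.integral_mono_on zero_le_one
        ((by fun_prop : Continuous fun t => ‖z t‖ ^ 2).intervalIntegrable _ _)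
        ((by fun_prop : Continuous fun s => Real.exp k * (Real.exp (-k * s) *
          ‖z s‖ ^ 2)).intervalIntegrable _ _) fun t ht => ?_
      rw [← mul_assoc]
      exact le_mul_of_one_le_left (by positivity) (hexp t ht)
    have h2 := hE 1 (right_mem_Icc.2 zero_le_one)
    have h3 : 0 ≤ Real.exp (-k * 1) * ‖ι (z 1)‖ ^ 2 := by positivity
    have h4 : ν * α * (∫ s in (0 : ℝ)..1, Real.exp (-k * s) * ‖z s‖ ^ 2) ≤ (1 + b) * D ^ 2 := by
      linarith
    have h5 := mul_le_mul_of_nonneg_left h4 hb0.le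
    rw [← mul_assoc, hb, inv_mul_cancel₀ (by positivity), one_mul, ← hb] at h5
    calc _ ≤ Real.exp k * (b * ((1 + b) * D ^ 2)) :=
          h1.trans (mul_le_mul_of_nonneg_left h5 (Real.exp_pos k).le)
      _ ≤ Real.exp k * ((1 + b) * ((1 + b) * D ^ 2)) := by gcongr; linarith
      _ = _ := by ring
  · rw [BoundedContinuousFunction.norm_le (by positivity)]
    intro t
    have hct : max 0 (min t 1) ∈ Icc (0 : ℝ) 1 :=
      ⟨le_max_left _ _, max_le zero_le_one (min_le_right _ _)⟩
    refine key _ (norm_nonneg _) ?_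
    have h0 : (evolutionPath ι d).2 t = ι (z (max 0 (min t 1))) := rfl
    change ‖(evolutionPath ι d).2 t‖ ^ 2 ≤ _
    rw [h0]
    set τ := max 0 (min t 1)
    have h2 := hE τ hct
    have h3 : 0 ≤ ν * α * ∫ s in (0 : ℝ)..τ, Real.exp (-k * s) * ‖z s‖ ^ 2 :=
      mul_nonneg (by positivity) (intervalIntegral.integral_nonneg hct.1 fun s _ => by positivity)
    have h4 : Real.exp (-k * τ) * ‖ι (z τ)‖ ^ 2 ≤ (1 + b) * D ^ 2 := by linarith
    calc ‖ι (z τ)‖ ^ 2 ≤ Real.exp k * Real.exp (-k * τ) * ‖ι (z τ)‖ ^ 2 :=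
          le_mul_of_one_le_left (by positivity) (hexp τ hct)
      _ ≤ Real.exp k * ((1 + b) * D ^ 2) := by
          rw [mul_assoc]; exact mul_le_mul_of_nonneg_left h4 (Real.exp_pos k).le
      _ ≤ Real.exp k * ((1 + b) * D ^ 2) * (1 + b) := le_mul_of_one_le_right (by positivity) hb1
      _ = _ := by ring

/-- The data of `C¹` functions are dense. -/
lemma denseRange_evolutionDatum {ι : V →L[ℝ] H} (hι : Function.Injective ι)
    (hd : DenseRange ι) {A : V →L[ℝ] V} (hG : IsGarding ι A) {ν : ℝ} (hν : 0 < ν) :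
    DenseRange (evolutionDatum ι A ν) := by
  -- Density is proved through orthogonal complements, so the product is given its Hilbert norm; the
  -- topology is unchanged.
  set Λ : V × (ℝ →ᵇ V) →ₗ[ℝ] WithLp 2 (TimeL2 V × H) :=
    (WithLp.linearEquiv 2 ℝ (TimeL2 V × H)).symm.toLinearMap ∘ₗ evolutionDatum ι A ν with hΛ
  suffices h : DenseRange Λ from
    (WithLp.ofLp_surjective 2).denseRange.comp h (WithLp.prod_continuous_ofLp 2 (TimeL2 V) H)
  have hrange : (LinearMap.range Λ : Set _) = range Λ := rfl
  rw [DenseRange, ← hrange, Submodule.dense_iff_topologicalClosure_eq_top,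
    Submodule.topologicalClosure_eq_top_iff, Submodule.eq_bot_iff]
  intro w hw
  have horth : ∀ d, ⟪Λ d, w⟫_ℝ = 0 := fun d =>
    Submodule.inner_right_of_mem_orthogonal (LinearMap.mem_range_self _ d) hw
  set g := w.fst with hg
  have hgi : Integrable g (timeMeasure 1) := TimeL2.integrable g
  have hinner : ∀ d, ⟪Λ d, w⟫_ℝ
      = (∫ t, ⟪gramOp ι (d.2 t) + ν • A (clampedPrimitive d t), g t⟫_ℝ ∂(timeMeasure 1))
        + ⟪ι d.1, w.snd⟫_ℝ := by
    intro d
    rw [WithLp.prod_inner_apply, L2.inner_def]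
    congr 1
    refine integral_congr_ae ?_
    filter_upwards [evolutionDatum_fst_ae ι A ν d] with t ht
    rw [← ht]
    rfl
  -- After Fubini, orthogonality to the data of `(0, ζ)` says that `q` is orthogonal to `ζ`. Hence
  -- `q = 0`, which is the integrated backward adjoint equation for `g` with terminal value zero.
  set q : ℝ → V := fun s => gramOp ι (g s) + ∫ t in s..1, ν • A.adjoint (g t) with hq
  have hAg : Integrable (fun t => ν • A.adjoint (g t)) (timeMeasure 1) :=
    (A.adjoint.integrable_comp hgi).smul ν
  have hJg : MemLp (fun t => gramOp ι (g t)) 2 (timeMeasure 1) :=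
    (gramOp ι).comp_memLp g
  have hPc : ContinuousOn (fun s => ∫ t in s..1, ν • A.adjoint (g t)) (Icc 0 1) := by
    have h1 : EqOn (fun s => ∫ t in s..1, ν • A.adjoint (g t))
        (fun s => (∫ t in (0 : ℝ)..1, ν • A.adjoint (g t))
          - ∫ t in (0 : ℝ)..s, ν • A.adjoint (g t)) (Icc 0 1) := by
      intro s hs
      simp only
      rw [intervalIntegral.integral_interval_sub_left hAg.intervalIntegrable_timeMeasure
        (hAg.intervalIntegrable_timeMeasure.mono_unit (by simp) hs)]
    exact (continuousOn_const.sub hAg.continuousOn_primitive).congr h1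
  have hPL : MemLp (fun s => ∫ t in s..1, ν • A.adjoint (g t)) 2 (timeMeasure 1) := by
    obtain ⟨M, hM⟩ := isCompact_Icc.exists_bound_of_continuousOn hPc
    refine MemLp.of_bound ?_ M ?_
    · exact (hPc.mono Ioo_subset_Icc_self).aestronglyMeasurable measurableSet_Ioo
    · filter_upwards [ae_timeMeasure_mem 1] with t ht
      exact hM t (Ioo_subset_Icc_self ht)
  have hqL : MemLp q 2 (timeMeasure 1) := hJg.add hPL
  have hq0 : hqL.toLp q = 0 := by
    have hdense := BoundedContinuousFunction.toLp_denseRange (p := 2) V (timeMeasure 1) ℝ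
      ENNReal.ofNat_ne_top
    refine hdense.eq_zero_of_inner_right ℝ ?_
    intro ζ
    have h0 := (hinner (0, ζ)).symm.trans (horth (0, ζ))
    simp only [map_zero, inner_zero_left, add_zero] at h0
    have hζi : Integrable (fun t => ζ t) (timeMeasure 1) :=
      (TimeL2.integrable (BoundedContinuousFunction.toLp 2 (timeMeasure 1) ℝ ζ)).congr
        (BoundedContinuousFunction.coeFn_toLp (p := 2) (μ := timeMeasure 1) (𝕜 := ℝ) ζ)
    have hswap := integral_bilin_primitive_swap (innerSL ℝ : V →L[ℝ] V →L[ℝ] ℝ) hAg hζi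
    have hi1 : Integrable (fun t => ⟪gramOp ι (g t), ζ t⟫_ℝ) (timeMeasure 1) := by
      refine (L2.integrable_inner (𝕜 := ℝ) (hJg.toLp _)
        (BoundedContinuousFunction.toLp 2 (timeMeasure 1) ℝ ζ)).congr ?_
      filter_upwards [hJg.coeFn_toLp,
        BoundedContinuousFunction.coeFn_toLp (p := 2) (μ := timeMeasure 1) (𝕜 := ℝ) ζ] with t h1 h2
      rw [h1, h2]
    have hi2 : Integrable (fun t => ⟪ν • A.adjoint (g t), ∫ s in (0 : ℝ)..t, ζ s⟫_ℝ)
        (timeMeasure 1) := by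
      obtain ⟨M, hM⟩ := isCompact_Icc.exists_bound_of_continuousOn hζi.continuousOn_primitive
      refine (hAg.norm.mul_const M).mono' ?_ ?_
      · exact hAg.1.inner
          ((hζi.continuousOn_primitive.mono Ioo_subset_Icc_self).aestronglyMeasurable
            measurableSet_Ioo)
      · filter_upwards [ae_timeMeasure_mem 1] with t ht
        exact (norm_inner_le_norm _ _).trans
          (mul_le_mul_of_nonneg_left (hM t (Ioo_subset_Icc_self ht)) (norm_nonneg _))
    have hi3 : Integrable (fun s => ⟪∫ t in s..1, ν • A.adjoint (g t), ζ s⟫_ℝ)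
        (timeMeasure 1) := by
      refine (L2.integrable_inner (𝕜 := ℝ) (hPL.toLp _)
        (BoundedContinuousFunction.toLp 2 (timeMeasure 1) ℝ ζ)).congr ?_
      filter_upwards [hPL.coeFn_toLp,
        BoundedContinuousFunction.coeFn_toLp (p := 2) (μ := timeMeasure 1) (𝕜 := ℝ) ζ] with t h1 h2
      rw [h1, h2]
    rw [L2.inner_def]
    calc _ = ∫ t, (⟪gramOp ι (g t), ζ t⟫_ℝ + ⟪∫ s in t..1, ν • A.adjoint (g s), ζ t⟫_ℝ)
          ∂(timeMeasure 1) := by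
          refine integral_congr_ae ?_
          filter_upwards [hqL.coeFn_toLp,
            BoundedContinuousFunction.coeFn_toLp (p := 2) (μ := timeMeasure 1) (𝕜 := ℝ) ζ]
            with t h1 h2
          rw [h1, h2, real_inner_comm, hq, ← inner_add_left]
      _ = (∫ t, ⟪gramOp ι (g t), ζ t⟫_ℝ ∂(timeMeasure 1))
          + ∫ t, ⟪ν • A.adjoint (g t), ∫ s in (0 : ℝ)..t, ζ s⟫_ℝ ∂(timeMeasure 1) := by
          rw [integral_add hi1 hi3]
          congr 1
          exact hswap.symm
      _ = ∫ t, ⟪gramOp ι (ζ t) + ν • A (clampedPrimitive (0, ζ) t), g t⟫_ℝ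
          ∂(timeMeasure 1) := by
          rw [← integral_add hi1 hi2]
          refine integral_congr_ae ?_
          filter_upwards [ae_timeMeasure_mem 1] with t ht
          rw [clampedPrimitive_apply _ (Ioo_subset_Icc_self ht), inner_add_left,
            real_inner_smul_left, real_inner_smul_left, ContinuousLinearMap.adjoint_inner_left,
            real_inner_comm (ζ t), inner_gramOp_right, zero_add, real_inner_comm (g t),
            real_inner_comm (A _) (g t)]
      _ = 0 := h0
  have hqa : ∀ᵐ t ∂(timeMeasure 1), q t = 0 := by
    have h1 := hqL.coeFn_toLp
    rw [hq0] at h1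
    filter_upwards [h1, Lp.coeFn_zero V 2 (timeMeasure 1)] with t h1 h2
    rw [← h1, h2]; rfl
  have hgz : ∀ᵐ t ∂(timeMeasure 1), g t = 0 := by
    -- Reversing time turns `q = 0` into the forward homogeneous equation for the adjoint operator,
    -- to which the uniqueness lemma applies.
    have hrev : ∀ᵐ t ∂(timeMeasure 1), g (1 - t) = 0 := by
      refine ae_eq_zero_of_gramOp_eq_primitive hι hG.adjoint hν
        (measurePreserving_one_sub.integrable_comp_of_integrable hgi) ?_
      filter_upwards [measurePreserving_one_sub.quasiMeasurePreserving.ae hqa,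
        ae_timeMeasure_mem 1] with t ht ht2
      rw [intervalIntegral.integral_comp_sub_left (fun s => g s) 1, sub_zero,
        ← ContinuousLinearMap.intervalIntegral_comp_comm _
          (hgi.intervalIntegrable_timeMeasure.mono_unit
            ⟨by linarith [ht2.2], by linarith [ht2.1]⟩ (by simp)),
        ← intervalIntegral.integral_smul]
      exact eq_neg_of_add_eq_zero_left ht
    filter_upwards [measurePreserving_one_sub.quasiMeasurePreserving.ae hrev] with t ht
    simpa using ht
  have hg0 : g = 0 := by
    ext1
    filter_upwards [hgz, Lp.coeFn_zero V 2 (timeMeasure 1)] with t h1 h2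
    rw [h1, h2]; rfl
  have hh0 : w.snd = 0 := by
    refine hd.eq_zero_of_inner_right ℝ ?_
    intro v
    have h0 := horth (v, 0)
    rw [WithLp.prod_inner_apply] at h0
    change ⟪_, g⟫_ℝ + ⟪ι v, w.snd⟫_ℝ = 0 at h0
    rw [hg0, inner_zero_right, zero_add] at h0
    exact h0
  have : w.ofLp = 0 := Prod.ext hg0 hh0
  exact (WithLp.ofLp_eq_zero 2).1 this

end LinearTheory

/-! ### Weak solutions: existence, traces, uniqueness -/

instance timeMeasure_one_isProbabilityMeasure : IsProbabilityMeasure (timeMeasure 1) :=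
  ⟨by simp [timeMeasure]⟩

lemma TimeL2.integral_norm_le {E : Type*} [NormedAddCommGroup E] (f : TimeL2 E) :
    ∫ t, ‖f t‖ ∂(timeMeasure 1) ≤ ‖f‖ := by
  rw [integral_norm_eq_lintegral_enorm (Lp.aestronglyMeasurable f), ← eLpNorm_one_eq_lintegral_enorm,
    Lp.norm_def]
  exact ENNReal.toReal_mono (Lp.eLpNorm_ne_top f)
    (eLpNorm_le_eLpNorm_of_exponent_le one_le_two (Lp.aestronglyMeasurable f))

lemma TimeL2.continuous_integral_smul {E : Type*} [NormedAddCommGroup E] [NormedSpace ℝ E]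
    {ψ : ℝ → ℝ} (hψ : Continuous ψ) :
    Continuous fun f : TimeL2 E => ∫ t, ψ t • f t ∂(timeMeasure 1) := by
  obtain ⟨M, hM⟩ := isCompact_Icc.exists_bound_of_continuousOn (hψ.continuousOn (s := Icc 0 1))
  have hi : ∀ f : TimeL2 E, Integrable (fun t => ψ t • f t) (timeMeasure 1) := fun f =>
    (TimeL2.integrable f).continuous_smul_timeMeasure hψ
  have hM0 : 0 ≤ M := (norm_nonneg _).trans (hM 0 (by simp))
  let L : TimeL2 E →ₗ[ℝ] E :=
    { toFun := fun f => ∫ t, ψ t • f t ∂(timeMeasure 1)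
      map_add' := fun f g => ?_
      map_smul' := fun c f => ?_ }
  refine (L.mkContinuous M fun f => ?_).continuous
  rotate_left
  · change ∫ t, ψ t • (f + g : TimeL2 E) t ∂(timeMeasure 1) = _
    rw [← integral_add (hi f) (hi g)]
    refine integral_congr_ae ?_
    filter_upwards [Lp.coeFn_add f g] with t ht
    rw [ht, Pi.add_apply, smul_add]
  · rw [RingHom.id_apply, ← integral_smul]
    refine integral_congr_ae ?_
    filter_upwards [Lp.coeFn_smul c f] with t ht
    rw [ht, Pi.smul_apply, smul_comm]
  · change ‖∫ t, ψ t • f t ∂(timeMeasure 1)‖ ≤ _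
    refine (norm_integral_le_of_norm_le ((TimeL2.integrable f).norm.const_mul M) ?_).trans ?_
    · filter_upwards [ae_timeMeasure_mem 1] with t ht
      rw [norm_smul]
      exact mul_le_mul_of_nonneg_right (hM t (Ioo_subset_Icc_self ht)) (norm_nonneg _)
    · rw [integral_const_mul]
      exact mul_le_mul_of_nonneg_left (TimeL2.integral_norm_le f) hM0

/-- For a fixed test function both sides of the definition are continuous in `L²`. This carries the
differential equation from the dense class of `C¹` data to all data. -/
lemma isClosed_setOf_hasWeakTimeDeriv (E : Type*) [NormedAddCommGroup E] [NormedSpace ℝ E] :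
    IsClosed {q : TimeL2 E × TimeL2 E | HasWeakTimeDeriv 1 q.1 q.2} := by
  simp only [HasWeakTimeDeriv, ofPred_forall]
  refine isClosed_iInter fun φ => isClosed_iInter fun hφ => isClosed_iInter fun _ =>
    isClosed_iInter fun _ => ?_
  exact isClosed_eq
    ((TimeL2.continuous_integral_smul (hφ.continuous_deriv (by simp))).comp continuous_fst)
    ((TimeL2.continuous_integral_smul hφ.continuous).comp continuous_snd).neg

lemma eqOn_Icc_of_ae_eq_timeMeasure {E : Type*} [NormedAddCommGroup E] {f g : ℝ → E} {T : ℝ}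
    (hT : 0 < T) (h : f =ᵐ[timeMeasure T] g) (hf : ContinuousOn f (Icc 0 T))
    (hg : ContinuousOn g (Icc 0 T)) :
    EqOn f g (Icc 0 T) := by
  rw [timeMeasure, restrict_Ioo_eq_restrict_Icc] at h
  exact Measure.eqOn_Icc_of_ae_eq volume hT.ne h hf hg

section LinearTheory

variable {V H : Type*} [NormedAddCommGroup V] [InnerProductSpace ℝ V] [CompleteSpace V]
  [NormedAddCommGroup H] [InnerProductSpace ℝ H] [CompleteSpace H]
  {ι : V →L[ℝ] H} {A : V →L[ℝ] V} {ν : ℝ}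

/-- Density of the data and the energy bound are what identify the extension. The properties of
`solutionOp` below are checked on such data and extended by continuity. -/
lemma solutionOp_datum (hι : Function.Injective ι) (hd : DenseRange ι) (hG : IsGarding ι A)
    (hν : 0 < ν) (d : V × (ℝ →ᵇ V)) :
    solutionOp ι A ν (evolutionDatum ι A ν d) = evolutionPath ι d :=
  LinearMap.extendOfNorm_eq (denseRange_evolutionDatum hι hd hG hν) (evolutionPath_bound hG hν) d

lemma solutionOp_snd_ae (hι : Function.Injective ι) (hd : DenseRange ι) (hG : IsGarding ι A)
    (hν : 0 < ν) (w : TimeL2 V × H) :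
    ∀ᵐ t ∂(timeMeasure 1), (solutionOp ι A ν w).2 t = ι ((solutionOp ι A ν w).1 t) := by
  have key : BoundedContinuousFunction.toLp 2 (timeMeasure 1) ℝ (solutionOp ι A ν w).2
      = ι.compLpL 2 (timeMeasure 1) (solutionOp ι A ν w).1 := by
    refine (denseRange_evolutionDatum hι hd hG hν).induction_on
      (p := fun w => BoundedContinuousFunction.toLp 2 (timeMeasure 1) ℝ (solutionOp ι A ν w).2
        = ι.compLpL 2 (timeMeasure 1) (solutionOp ι A ν w).1) w
      (isClosed_eq (by fun_prop) (by fun_prop)) fun d => ?_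
    rw [solutionOp_datum hι hd hG hν]
    ext1
    filter_upwards [BoundedContinuousFunction.coeFn_toLp (p := 2) (μ := timeMeasure 1) (𝕜 := ℝ)
      (evolutionPath ι d).2, ι.coeFn_compLpL (evolutionPath ι d).1, evolutionPath_fst_ae ι d]
      with t h1 h2 h3
    rw [h1, h2, h3, evolutionPath_snd]
  filter_upwards [BoundedContinuousFunction.coeFn_toLp (p := 2) (μ := timeMeasure 1) (𝕜 := ℝ)
      (solutionOp ι A ν w).2, ι.coeFn_compLpL (solutionOp ι A ν w).1] with t h1 h2
  rw [← h1, ← h2, key]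

lemma solutionOp_snd_zero (hι : Function.Injective ι) (hd : DenseRange ι) (hG : IsGarding ι A)
    (hν : 0 < ν) (w : TimeL2 V × H) : (solutionOp ι A ν w).2 0 = w.2 := by
  refine (denseRange_evolutionDatum hι hd hG hν).induction_on
    (p := fun w => (solutionOp ι A ν w).2 0 = w.2) w
    (isClosed_eq ?_ continuous_snd) fun d => ?_
  · exact (BoundedContinuousFunction.evalCLM ℝ (0 : ℝ)).continuous.comp
      (continuous_snd.comp (solutionOp ι A ν).continuous)
  · rw [solutionOp_datum hι hd hG hν, evolutionPath_snd, clampedPrimitive_apply _ (by simp),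
      intervalIntegral.integral_same, add_zero, evolutionDatum_snd]

lemma solutionOp_hasWeakTimeDeriv (hι : Function.Injective ι) (hd : DenseRange ι)
    (hG : IsGarding ι A) (hν : 0 < ν) (w : TimeL2 V × H) :
    HasWeakTimeDeriv 1 (fun t => gramOp ι ((solutionOp ι A ν w).1 t))
      (fun t => w.1 t - ν • A ((solutionOp ι A ν w).1 t)) := by
  have key : HasWeakTimeDeriv 1 ((gramOp ι).compLpL 2 (timeMeasure 1) (solutionOp ι A ν w).1)
      (w.1 - ν • A.compLpL 2 (timeMeasure 1) (solutionOp ι A ν w).1 : TimeL2 V) := by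
    refine (denseRange_evolutionDatum hι hd hG hν).induction_on
      (p := fun w => HasWeakTimeDeriv 1
        ((gramOp ι).compLpL 2 (timeMeasure 1) (solutionOp ι A ν w).1)
        (w.1 - ν • A.compLpL 2 (timeMeasure 1) (solutionOp ι A ν w).1 : TimeL2 V)) w ?_ ?_
    · refine (isClosed_setOf_hasWeakTimeDeriv V).preimage
        (f := fun w : TimeL2 V × H =>
          ((gramOp ι).compLpL 2 (timeMeasure 1) (solutionOp ι A ν w).1,
            (w.1 - ν • A.compLpL 2 (timeMeasure 1) (solutionOp ι A ν w).1 : TimeL2 V))) ?_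
      refine Continuous.prodMk (by fun_prop) (continuous_fst.sub (by fun_prop))
    · intro d
      rw [solutionOp_datum hι hd hG hν]
      have hJ : Integrable (fun t => gramOp ι (d.2 t)) (timeMeasure 1) :=
        (((gramOp ι).continuous.comp d.2.continuous).integrableOn_Icc (a := 0) (b := 1)).mono_set
          Ioo_subset_Icc_self
      refine (hasWeakTimeDeriv_of_ae_eq_primitive (C := gramOp ι d.1)
        (f := fun t => gramOp ι (clampedPrimitive d t)) hJ ?_).congr ?_ ?_
      · filter_upwards [ae_timeMeasure_mem 1] with t ht
        rw [clampedPrimitive_apply _ (Ioo_subset_Icc_self ht), map_add,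
          ContinuousLinearMap.intervalIntegral_comp_comm _ (d.2.continuous.intervalIntegrable _ _)]
      · filter_upwards [(gramOp ι).coeFn_compLpL (evolutionPath ι d).1, evolutionPath_fst_ae ι d]
          with t h1 h2
        rw [h1, h2]
      · filter_upwards [Lp.coeFn_sub (evolutionDatum ι A ν d).1
          (ν • A.compLpL 2 (timeMeasure 1) (evolutionPath ι d).1),
          Lp.coeFn_smul ν (A.compLpL 2 (timeMeasure 1) (evolutionPath ι d).1),
          A.coeFn_compLpL (evolutionPath ι d).1, evolutionPath_fst_ae ι d,
          evolutionDatum_fst_ae ι A ν d] with t h1 h2 h3 h4 h5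
        rw [h1, Pi.sub_apply, h2, Pi.smul_apply, h3, h4, h5, add_sub_cancel_right]
  refine key.congr ((gramOp ι).coeFn_compLpL _) ?_
  filter_upwards [Lp.coeFn_sub w.1 (ν • A.compLpL 2 (timeMeasure 1) (solutionOp ι A ν w).1),
    Lp.coeFn_smul ν (A.compLpL 2 (timeMeasure 1) (solutionOp ι A ν w).1),
    A.coeFn_compLpL (solutionOp ι A ν w).1] with t h1 h2 h3
  rw [h1, Pi.sub_apply, h2, Pi.smul_apply, h3]

/-- The time-integrated form of `(J y)' = g` on all of `[0, 1]`. -/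
lemma adjoint_trace_eq_primitive {y g : ℝ → V} {c : ℝ → H} (hy : Integrable y (timeMeasure 1))
    (hg : Integrable g (timeMeasure 1)) (h : HasWeakTimeDeriv 1 (fun t => gramOp ι (y t)) g)
    (hc : ContinuousOn c (Icc 0 1)) (hcy : ∀ᵐ t ∂(timeMeasure 1), c t = ι (y t)) :
    ∀ t ∈ Icc (0 : ℝ) 1, ι.adjoint (c t) = ι.adjoint (c 0) + ∫ s in (0 : ℝ)..t, g s := by
  obtain ⟨C, hC⟩ := h.ae_eq_primitive ((gramOp ι).integrable_comp hy) hg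
  have heq := eqOn_Icc_of_ae_eq_timeMeasure one_pos (f := fun t => ι.adjoint (c t))
    (g := fun t => C + ∫ s in (0 : ℝ)..t, g s)
    (by filter_upwards [hC, hcy] with t h1 h2; rw [h2, ← h1]; rfl)
    (ι.adjoint.continuous.comp_continuousOn hc) (continuousOn_const.add hg.continuousOn_primitive)
  intro t ht
  have h0 := heq (left_mem_Icc.2 zero_le_one)
  simp only [intervalIntegral.integral_same, add_zero] at h0
  rw [h0]
  exact heq ht

/-- Weak solutions of the evolution equation with the same data coincide. -/
lemma weakSolution_unique (hι : Function.Injective ι) (hG : IsGarding ι A) (hν : 0 < ν)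
    {f y₁ y₂ : ℝ → V} {c₁ c₂ : ℝ → H} (hf : Integrable f (timeMeasure 1))
    (hy₁ : Integrable y₁ (timeMeasure 1)) (hy₂ : Integrable y₂ (timeMeasure 1))
    (h₁ : HasWeakTimeDeriv 1 (fun t => gramOp ι (y₁ t)) (fun t => f t - ν • A (y₁ t)))
    (h₂ : HasWeakTimeDeriv 1 (fun t => gramOp ι (y₂ t)) (fun t => f t - ν • A (y₂ t)))
    (hc₁ : ContinuousOn c₁ (Icc 0 1)) (hc₂ : ContinuousOn c₂ (Icc 0 1))
    (hcy₁ : ∀ᵐ t ∂(timeMeasure 1), c₁ t = ι (y₁ t))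
    (hcy₂ : ∀ᵐ t ∂(timeMeasure 1), c₂ t = ι (y₂ t)) (h0 : c₁ 0 = c₂ 0) :
    y₁ =ᵐ[timeMeasure 1] y₂ ∧ EqOn c₁ c₂ (Icc 0 1) := by
  have hA₁ : Integrable (fun t => ν • A (y₁ t)) (timeMeasure 1) := (A.integrable_comp hy₁).smul ν
  have hA₂ : Integrable (fun t => ν • A (y₂ t)) (timeMeasure 1) := (A.integrable_comp hy₂).smul ν
  have e₁ := adjoint_trace_eq_primitive hy₁ (hf.sub hA₁) h₁ hc₁ hcy₁
  have e₂ := adjoint_trace_eq_primitive hy₂ (hf.sub hA₂) h₂ hc₂ hcy₂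
  have hz : ∀ᵐ t ∂(timeMeasure 1), y₁ t - y₂ t = 0 := by
    refine ae_eq_zero_of_gramOp_eq_primitive hι hG hν (hy₁.sub hy₂) ?_
    filter_upwards [ae_timeMeasure_mem 1, hcy₁, hcy₂] with t ht h3 h4
    have ht' := Ioo_subset_Icc_self ht
    have e3 := e₁ t ht'
    have e4 := e₂ t ht'
    rw [h3] at e3
    rw [h4] at e4
    have hii : ∀ g : ℝ → V, Integrable g (timeMeasure 1) → IntervalIntegrable g volume 0 t :=
      fun g hg => hg.intervalIntegrable_timeMeasure.mono_unit (by simp) ht'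
    simp only [Pi.sub_apply] at e3 e4
    rw [intervalIntegral.integral_sub (hii _ hf) (hii _ hA₁), intervalIntegral.integral_smul,
      ContinuousLinearMap.intervalIntegral_comp_comm _ (hii _ hy₁)] at e3
    rw [intervalIntegral.integral_sub (hii _ hf) (hii _ hA₂), intervalIntegral.integral_smul,
      ContinuousLinearMap.intervalIntegral_comp_comm _ (hii _ hy₂)] at e4
    rw [intervalIntegral.integral_sub (hii _ hy₁) (hii _ hy₂), map_sub, map_sub, smul_sub]
    change ι.adjoint (ι (y₁ t)) - ι.adjoint (ι (y₂ t)) = _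
    rw [e3, e4, h0]
    abel
  have hy : y₁ =ᵐ[timeMeasure 1] y₂ := hz.mono fun t ht => sub_eq_zero.1 ht
  refine ⟨hy, eqOn_Icc_of_ae_eq_timeMeasure one_pos ?_ hc₁ hc₂⟩
  filter_upwards [hcy₁, hcy₂, hy] with t h1 h2 h3
  rw [h1, h2, h3]

/-- Any weak solution is the one given by the solution operator. -/
lemma eq_solutionOp (hι : Function.Injective ι) (hd : DenseRange ι) (hG : IsGarding ι A)
    (hν : 0 < ν) (w : TimeL2 V × H) {y : ℝ → V} {c : ℝ → H}
    (hy : Integrable y (timeMeasure 1))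
    (h : HasWeakTimeDeriv 1 (fun t => gramOp ι (y t)) (fun t => w.1 t - ν • A (y t)))
    (hc : ContinuousOn c (Icc 0 1)) (hcy : ∀ᵐ t ∂(timeMeasure 1), c t = ι (y t))
    (h0 : c 0 = w.2) :
    y =ᵐ[timeMeasure 1] (solutionOp ι A ν w).1 ∧ EqOn c (solutionOp ι A ν w).2 (Icc 0 1) :=
  weakSolution_unique hι hG hν (TimeL2.integrable w.1) hy (TimeL2.integrable _) h
    (solutionOp_hasWeakTimeDeriv hι hd hG hν w) hc
    (solutionOp ι A ν w).2.continuous.continuousOn hcy (solutionOp_snd_ae hι hd hG hν w)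
    (h0.trans (solutionOp_snd_zero hι hd hG hν w).symm)

end LinearTheory

section ResolventFamily

/-! ### Operator families satisfying a resolvent identity -/

variable {W Z X K Y : Type*} [NormedAddCommGroup W] [NormedSpace ℝ W]
  [NormedAddCommGroup Z] [NormedSpace ℝ Z] [NormedAddCommGroup X] [NormedSpace ℝ X]
  [NormedAddCommGroup K] [NormedSpace ℝ K] [NormedAddCommGroup Y] [NormedSpace ℝ Y]
  {S : ℝ → W →L[ℝ] Z} {j : X →L[ℝ] W} {a : Z →L[ℝ] X}

/-- The identity `S ν' - S ν = -(ν' - ν) S ν j a S ν'` for `ν, ν' > 0`. -/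
def IsResolventFamily (S : ℝ → W →L[ℝ] Z) (j : X →L[ℝ] W) (a : Z →L[ℝ] X) : Prop :=
  ∀ ν > 0, ∀ ν' > 0, S ν' - S ν = -(ν' - ν) • (S ν ∘L j ∘L a ∘L S ν')

/-- The identity bounds `S ν' - S ν` by `|ν' - ν|` times `‖S ν'‖`. Near `ν` the prefactor is at most
`1/2`, so `‖S ν'‖ ≤ 2 ‖S ν‖`, and the identity then gives a Lipschitz bound at `ν`. -/
lemma IsResolventFamily.continuousAt (h : IsResolventFamily S j a) {ν : ℝ} (hν : 0 < ν) :
    ContinuousAt S ν := by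
  set T := S ν ∘L j ∘L a
  have hsub : ∀ ν' : ℝ, 0 < ν' → ‖S ν' - S ν‖ ≤ |ν' - ν| * (‖T‖ * ‖S ν'‖) := by
    intro ν' hν'
    rw [h ν hν ν' hν', norm_smul, norm_neg, Real.norm_eq_abs]
    exact mul_le_mul_of_nonneg_left (T.opNorm_comp_le (S ν')) (abs_nonneg _)
  have hlim : Filter.Tendsto (fun ν' : ℝ => |ν' - ν| * ‖T‖) (𝓝 ν) (𝓝 0) := by
    have : Continuous fun ν' : ℝ => |ν' - ν| * ‖T‖ := by fun_prop
    simpa using this.tendsto ν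
  have hb : ∀ᶠ ν' in 𝓝 ν, ‖S ν' - S ν‖ ≤ |ν' - ν| * ‖T‖ * (2 * ‖S ν‖) := by
    filter_upwards [lt_mem_nhds hν, hlim.eventually_le_const (show (0 : ℝ) < 1 / 2 by norm_num)]
      with ν' h1 h2
    have h3 := hsub ν' h1
    have h4 : ‖S ν'‖ ≤ ‖S ν' - S ν‖ + ‖S ν‖ := by
      simpa using norm_add_le (S ν' - S ν) (S ν)
    have h5 : |ν' - ν| * (‖T‖ * ‖S ν'‖) ≤ 1 / 2 * ‖S ν'‖ := by
      rw [← mul_assoc]; exact mul_le_mul_of_nonneg_right h2 (norm_nonneg _)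
    have h6 : ‖S ν'‖ ≤ 2 * ‖S ν‖ := by linarith
    rw [← mul_assoc] at h3
    exact h3.trans (mul_le_mul_of_nonneg_left h6 (by positivity))
  rw [ContinuousAt, tendsto_iff_norm_sub_tendsto_zero]
  refine squeeze_zero' (Filter.Eventually.of_forall fun _ => norm_nonneg _) hb ?_
  simpa using hlim.mul_const (2 * ‖S ν‖)

/-- By the resolvent identity the difference quotient equals `-(S ν ∘ j ∘ a ∘ S ν')` exactly, so
continuity alone gives the limit. -/
lemma IsResolventFamily.hasDerivAt (h : IsResolventFamily S j a) {ν : ℝ} (hν : 0 < ν) :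
    HasDerivAt S (-(S ν ∘L j ∘L a ∘L S ν)) ν := by
  rw [hasDerivAt_iff_tendsto_slope]
  have h1 : Filter.Tendsto (fun ν' => -(S ν ∘L j ∘L a ∘L S ν')) (𝓝[≠] ν)
      (𝓝 (-(S ν ∘L j ∘L a ∘L S ν))) :=
    ((continuousAt_const.clm_comp (continuousAt_const.clm_comp (continuousAt_const.clm_comp
      (h.continuousAt hν)))).neg).tendsto.mono_left nhdsWithin_le_nhds
  refine h1.congr' ?_
  filter_upwards [self_mem_nhdsWithin, nhdsWithin_le_nhds (lt_mem_nhds hν)] with ν' h2 h3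
  have h4 : ν' - ν ≠ 0 := sub_ne_zero.2 h2
  rw [slope_def_module, h ν hν ν' h3, smul_smul, mul_neg, inv_mul_cancel₀ h4, neg_one_smul]

/-- The derivative of `ν ↦ e (S ν w)`. -/
lemma IsResolventFamily.hasDerivAt_apply (h : IsResolventFamily S j a) {ν : ℝ} (hν : 0 < ν)
    (e : Z →L[ℝ] Y) (w : W) :
    HasDerivAt (fun ν => e (S ν w)) (-e (S ν (j (a (S ν w))))) ν := by
  have h1 := (h.hasDerivAt hν).clm_apply (hasDerivAt_const ν w)
  have h2 := e.hasFDerivAt.comp_hasDerivAt ν h1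
  convert! h2 using 1
  simp

lemma IsResolventFamily.continuousAt_deriv_apply (h : IsResolventFamily S j a) {ν : ℝ}
    (hν : 0 < ν) (e : Z →L[ℝ] Y) (w : W) :
    ContinuousAt (fun ν => -e (S ν (j (a (S ν w))))) ν := by
  have hS := h.continuousAt hν
  have h1 : ContinuousAt (fun ν => S ν w) ν := hS.clm_apply continuousAt_const
  have h2 : ContinuousAt (fun ν => j (a (S ν w))) ν :=
    (j.continuous.comp a.continuous).continuousAt.comp h1
  exact (e.continuous.continuousAt.comp (hS.clm_apply h2)).neg

/-- The derivative of `ν ↦ ν • (e ∘ S ν ∘ k)`. -/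
lemma IsResolventFamily.hasDerivAt_smul_comp (h : IsResolventFamily S j a) {ν : ℝ} (hν : 0 < ν)
    (e : Z →L[ℝ] Y) (k : K →L[ℝ] W) :
    HasDerivAt (fun ν => ν • (e ∘L S ν ∘L k))
      (e ∘L S ν ∘L k - ν • (e ∘L S ν ∘L j ∘L a ∘L S ν ∘L k)) ν := by
  have h1 := (hasDerivAt_const ν e).clm_comp ((h.hasDerivAt hν).clm_comp (hasDerivAt_const ν k))
  have h2 := (hasDerivAt_id ν).smul h1
  convert! h2 using 1
  ext1 w
  simp [add_comm, sub_eq_add_neg]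

lemma IsResolventFamily.continuousAt_deriv_smul_comp (h : IsResolventFamily S j a) {ν : ℝ}
    (hν : 0 < ν) (e : Z →L[ℝ] Y) (k : K →L[ℝ] W) :
    ContinuousAt (fun ν => e ∘L S ν ∘L k - ν • (e ∘L S ν ∘L j ∘L a ∘L S ν ∘L k)) ν := by
  have hS := h.continuousAt hν
  have h1 : ContinuousAt (fun ν => S ν ∘L k) ν := hS.clm_comp continuousAt_const
  exact (continuousAt_const.clm_comp h1).sub (continuousAt_id.smul (continuousAt_const.clm_comp
    (hS.clm_comp (continuousAt_const.clm_comp (continuousAt_const.clm_comp h1)))))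

end ResolventFamily

/-! ### Duality and dependence of the solution operator on `ν` -/

section LinearTheory

variable {V H : Type*} [NormedAddCommGroup V] [InnerProductSpace ℝ V] [CompleteSpace V]
  [NormedAddCommGroup H] [InnerProductSpace ℝ H] [CompleteSpace H]
  {ι : V →L[ℝ] H} {A : V →L[ℝ] V} {ν : ℝ}

omit [CompleteSpace V] in
lemma integrable_inner_of_bounded {f g : ℝ → V} (hf : Integrable f (timeMeasure 1))
    (hg : ContinuousOn g (Icc 0 1)) : Integrable (fun t => ⟪f t, g t⟫_ℝ) (timeMeasure 1) := by
  obtain ⟨M, hM⟩ := isCompact_Icc.exists_bound_of_continuousOn hg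
  refine (hf.norm.mul_const M).mono' ?_ ?_
  · exact hf.1.inner ((hg.mono Ioo_subset_Icc_self).aestronglyMeasurable measurableSet_Ioo)
  · filter_upwards [ae_timeMeasure_mem 1] with t ht
    exact (norm_inner_le_norm _ _).trans
      (mul_le_mul_of_nonneg_left (hM t (Ioo_subset_Icc_self ht)) (norm_nonneg _))

/-- Duality between the evolution equation and its adjoint. -/
lemma solutionOp_duality (hι : Function.Injective ι) (hd : DenseRange ι) (hG : IsGarding ι A)
    (hν : 0 < ν) {p : ℝ → V} {c : ℝ → H} (hp : MemLp p 2 (timeMeasure 1))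
    (h : HasWeakTimeDeriv 1 (fun t => gramOp ι (p t)) (fun t => ν • A.adjoint (p t)))
    (hc : ContinuousOn c (Icc 0 1)) (hcp : ∀ᵐ t ∂(timeMeasure 1), c t = ι (p t))
    (w : TimeL2 V × H) :
    ⟪(solutionOp ι A ν w).2 1, c 1⟫_ℝ
      = ⟪w.2, c 0⟫_ℝ + ⟪w.1, hp.toLp p⟫_ℝ := by
  -- Both sides are continuous in `w`, so the integration by parts is needed only for `C¹` states.
  refine (denseRange_evolutionDatum hι hd hG hν).induction_on
    (p := fun w : TimeL2 V × H => ⟪(solutionOp ι A ν w).2 1, c 1⟫_ℝ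
      = ⟪w.2, c 0⟫_ℝ + ⟪w.1, hp.toLp p⟫_ℝ) w (isClosed_eq ?_ ?_) fun d => ?_
  · exact ((BoundedContinuousFunction.evalCLM ℝ (1 : ℝ)).continuous.comp
      (continuous_snd.comp (solutionOp ι A ν).continuous)).inner continuous_const
  · exact (continuous_snd.inner continuous_const).add
      (continuous_fst.inner continuous_const)
  have hpi : Integrable p (timeMeasure 1) := hp.integrable one_le_two
  set g : ℝ → V := fun t => ν • A.adjoint (p t) with hgdef
  have hg : Integrable g (timeMeasure 1) := (A.adjoint.integrable_comp hpi).smul ν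
  have htr := adjoint_trace_eq_primitive hpi hg h hc hcp
  have hζ : Integrable (fun t => d.2 t) (timeMeasure 1) :=
    (d.2.continuous.integrableOn_Icc (a := 0) (b := 1)).mono_set Ioo_subset_Icc_self
  rw [solutionOp_datum hι hd hG hν, evolutionPath_snd, evolutionDatum_snd,
    clampedPrimitive_apply _ (by simp)]
  set I := ∫ s in (0 : ℝ)..1, d.2 s with hI
  set G := ∫ s in (0 : ℝ)..1, g s with hGdef
  have hc1 : ι.adjoint (c 1) = ι.adjoint (c 0) + G := htr 1 (by simp)
  -- Integration by parts in the form of Fubini: the integral is moved from `ζ = d.2` onto `g`, and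
  -- `∫ g` over `[s, 1]` is a difference of values of `ι† c`, the function whose derivative the weak
  -- equation supplies.
  have hswap : ∫ t, ⟪g t, ∫ s in (0 : ℝ)..t, d.2 s⟫_ℝ ∂(timeMeasure 1)
      = ∫ s, ⟪∫ t in s..1, g t, d.2 s⟫_ℝ ∂(timeMeasure 1) :=
    integral_bilin_primitive_swap (innerSL ℝ : V →L[ℝ] V →L[ℝ] ℝ) hg hζ
  have hrest : ∀ t ∈ Icc (0 : ℝ) 1, ∫ s in t..1, g s = ι.adjoint (c 1) - ι.adjoint (c t) := by
    intro t ht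
    rw [hc1, htr t ht, hGdef, ← intervalIntegral.integral_interval_sub_left
      hg.intervalIntegrable_timeMeasure (hg.intervalIntegrable_timeMeasure.mono_unit (by simp) ht)]
    abel
  have hac : ContinuousOn (fun t => ι.adjoint (c t)) (Icc 0 1) :=
    ι.adjoint.continuous.comp_continuousOn hc
  have e1 : ∫ s, ⟪∫ t in s..1, g t, d.2 s⟫_ℝ ∂(timeMeasure 1)
      = ⟪ι.adjoint (c 1), I⟫_ℝ - ∫ s, ⟪d.2 s, ι.adjoint (c s)⟫_ℝ ∂(timeMeasure 1) := by
    have h1 : ⟪ι.adjoint (c 1), I⟫_ℝ = ∫ s, ⟪ι.adjoint (c 1), d.2 s⟫_ℝ ∂(timeMeasure 1) := by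
      rw [integral_inner hζ, hI, integral_timeMeasure_one]
    rw [h1, ← integral_sub (hζ.const_inner _) (integrable_inner_of_bounded hζ hac)]
    refine integral_congr_ae ?_
    filter_upwards [ae_timeMeasure_mem 1] with s hs
    rw [hrest s (Ioo_subset_Icc_self hs), inner_sub_left, real_inner_comm (ι.adjoint (c s))]
  have e2 : ⟪(evolutionDatum ι A ν d).1, hp.toLp p⟫_ℝ
      = (∫ s, ⟪d.2 s, ι.adjoint (c s)⟫_ℝ ∂(timeMeasure 1)) + ⟪G, d.1⟫_ℝ
        + ∫ t, ⟪g t, ∫ s in (0 : ℝ)..t, d.2 s⟫_ℝ ∂(timeMeasure 1) := by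
    have h1 : ⟪G, d.1⟫_ℝ = ∫ t, ⟪g t, d.1⟫_ℝ ∂(timeMeasure 1) := by
      rw [real_inner_comm, hGdef, ← integral_timeMeasure_one, ← integral_inner hg]
      simp only [real_inner_comm]
    have hsum : Integrable (fun t => ⟪d.2 t, ι.adjoint (c t)⟫_ℝ + ⟪g t, d.1⟫_ℝ) (timeMeasure 1) :=
      (integrable_inner_of_bounded hζ hac).add (hg.inner_const _)
    rw [h1, ← integral_add (integrable_inner_of_bounded hζ hac) (hg.inner_const _),
      ← integral_add hsum
        (integrable_inner_of_bounded hg hζ.continuousOn_primitive), L2.inner_def]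
    refine integral_congr_ae ?_
    filter_upwards [evolutionDatum_fst_ae ι A ν d, hp.coeFn_toLp, hcp, ae_timeMeasure_mem 1]
      with t h1 h2 h3 h4
    rw [h1, h2, h3, clampedPrimitive_apply _ (Ioo_subset_Icc_self h4), inner_add_left,
      ← inner_gramOp_right, map_add, smul_add, inner_add_left, hgdef]
    simp only [real_inner_smul_left, ContinuousLinearMap.adjoint_inner_left]
    rw [real_inner_comm (A d.1), real_inner_comm (A _) (p t), ← add_assoc]
    rfl
  rw [e2, hswap, e1, map_add, inner_add_left, ← ContinuousLinearMap.adjoint_inner_right,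
    ← ContinuousLinearMap.adjoint_inner_right, ← ContinuousLinearMap.adjoint_inner_right, hc1,
    inner_add_right, real_inner_comm d.1 G, real_inner_comm I]
  ring

/-- The operator `(y, c) ↦ A y`. -/
noncomputable def diffusionOp (A : V →L[ℝ] V) (H : Type*) [NormedAddCommGroup H]
    [InnerProductSpace ℝ H] : TimeL2 V × (ℝ →ᵇ H) →L[ℝ] TimeL2 V :=
  A.compLpL 2 (timeMeasure 1) ∘L ContinuousLinearMap.fst ℝ (TimeL2 V) (ℝ →ᵇ H)

/-- The evaluation `(y, c) ↦ c(1)`. -/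
noncomputable def finalValue (V H : Type*) [NormedAddCommGroup V] [InnerProductSpace ℝ V]
    [NormedAddCommGroup H] [InnerProductSpace ℝ H] : TimeL2 V × (ℝ →ᵇ H) →L[ℝ] H :=
  BoundedContinuousFunction.evalCLM ℝ (1 : ℝ) ∘L ContinuousLinearMap.snd ℝ (TimeL2 V) (ℝ →ᵇ H)

/-- Resolvent identity for the solution operators. -/
lemma isResolventFamily_solutionOp (hι : Function.Injective ι) (hd : DenseRange ι)
    (hG : IsGarding ι A) :
    IsResolventFamily (solutionOp ι A) (ContinuousLinearMap.inl ℝ (TimeL2 V) H)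
      (diffusionOp A H) := by
  intro ν hν ν' hν'
  set T := solutionOp ι A ν ∘L ContinuousLinearMap.inl ℝ (TimeL2 V) H ∘L diffusionOp A H
  change _ = -(ν' - ν) • (T ∘L solutionOp ι A ν')
  refine ContinuousLinearMap.ext fun w => ?_
  refine (denseRange_evolutionDatum hι hd hG hν').induction_on
    (p := fun w => (solutionOp ι A ν' - solutionOp ι A ν) w
      = (-(ν' - ν) • (T ∘L solutionOp ι A ν')) w) w
    (isClosed_eq (ContinuousLinearMap.continuous _) (ContinuousLinearMap.continuous _)) fun d => ?_
  -- The path of `d` does not depend on `ν`; only its datum does, affinely through `ν A z`. Applying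
  -- `solutionOp ι A ν` to this relation gives the resolvent identity.
  have h1 : evolutionDatum ι A ν' d = evolutionDatum ι A ν d
      + (ν' - ν) • (A.compLpL 2 (timeMeasure 1) (evolutionPath ι d).1, (0 : H)) := by
    refine Prod.ext ?_ ?_
    · change (evolutionDatum ι A ν' d).1 = (evolutionDatum ι A ν d).1
        + (ν' - ν) • A.compLpL 2 (timeMeasure 1) (evolutionPath ι d).1
      ext1
      filter_upwards [evolutionDatum_fst_ae ι A ν' d, evolutionDatum_fst_ae ι A ν d,
        Lp.coeFn_add (evolutionDatum ι A ν d).1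
          ((ν' - ν) • A.compLpL 2 (timeMeasure 1) (evolutionPath ι d).1),
        Lp.coeFn_smul (ν' - ν) (A.compLpL 2 (timeMeasure 1) (evolutionPath ι d).1),
        A.coeFn_compLpL (evolutionPath ι d).1, evolutionPath_fst_ae ι d] with t h1 h2 h3 h4 h5 h6
      rw [h3, Pi.add_apply, h1, h2, h4, Pi.smul_apply, h5, h6, sub_smul]
      abel
    · change ι d.1 = ι d.1 + (ν' - ν) • (0 : H)
      simp
  have h2 := congrArg (solutionOp ι A ν) h1
  rw [map_add, map_smul, solutionOp_datum hι hd hG hν] at h2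
  rw [sub_apply, smul_apply,
    ContinuousLinearMap.comp_apply, solutionOp_datum hι hd hG hν', h2, neg_smul]
  change evolutionPath ι d - (_ + _) = -(_ • solutionOp ι A ν _)
  abel_nf
  rfl

section Controlled

variable {U : Type*} [NormedAddCommGroup U] [InnerProductSpace ℝ U]

/-- The final value `y(1)` of the solution of `(J y)' + ν A y = f`, `y(0) = h`. -/
noncomputable def endOp (ι : V →L[ℝ] H) (A : V →L[ℝ] V) (ν : ℝ) : TimeL2 V × H →L[ℝ] H :=
  finalValue V H ∘L solutionOp ι A ν

/-- The final value of the state as a linear function of the control. -/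
noncomputable def controlEndOp (ι : V →L[ℝ] H) (A : V →L[ℝ] V) (B : U →L[ℝ] V) (ν : ℝ) :
    TimeL2 U →L[ℝ] H :=
  ν • (finalValue V H ∘L solutionOp ι A ν
    ∘L (ContinuousLinearMap.inl ℝ (TimeL2 V) H ∘L B.compLpL 2 (timeMeasure 1)))

/-- The data `(ν B u, y₀)` of the controlled equation. -/
noncomputable def controlDatum (B : U →L[ℝ] V) (y₀ : H) (ν : ℝ) (u : TimeL2 U) : TimeL2 V × H :=
  (ν • B.compLpL 2 (timeMeasure 1) u, y₀)

omit [CompleteSpace V] [CompleteSpace H] in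
lemma controlDatum_eq (B : U →L[ℝ] V) (y₀ : H) (ν : ℝ) (u : TimeL2 U) :
    controlDatum B y₀ ν u = ν • (B.compLpL 2 (timeMeasure 1) u, (0 : H)) + (0, y₀) :=
  Prod.ext (by simp [controlDatum]) (by simp [controlDatum])

lemma endOp_controlDatum (B : U →L[ℝ] V) (y₀ : H) (u : TimeL2 U) :
    endOp ι A ν (controlDatum B y₀ ν u) = controlEndOp ι A B ν u + endOp ι A ν (0, y₀) := by
  rw [controlDatum_eq, map_add, map_smul]
  rfl

/-- The derivative of `ν ↦ controlEndOp ν`. -/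
noncomputable def controlEndOpDeriv (ι : V →L[ℝ] H) (A : V →L[ℝ] V) (B : U →L[ℝ] V) (ν : ℝ) :
    TimeL2 U →L[ℝ] H :=
  finalValue V H ∘L solutionOp ι A ν
      ∘L (ContinuousLinearMap.inl ℝ (TimeL2 V) H ∘L B.compLpL 2 (timeMeasure 1))
    - ν • (finalValue V H ∘L solutionOp ι A ν ∘L ContinuousLinearMap.inl ℝ (TimeL2 V) H
      ∘L diffusionOp A H ∘L solutionOp ι A ν
      ∘L (ContinuousLinearMap.inl ℝ (TimeL2 V) H ∘L B.compLpL 2 (timeMeasure 1)))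

/-- The derivative of `ν ↦ endOp ν w`. -/
noncomputable def endOpDeriv (ι : V →L[ℝ] H) (A : V →L[ℝ] V) (w : TimeL2 V × H) (ν : ℝ) : H :=
  -endOp ι A ν (A.compLpL 2 (timeMeasure 1) (solutionOp ι A ν w).1, 0)

lemma hasDerivAt_endOp (hι : Function.Injective ι) (hd : DenseRange ι) (hG : IsGarding ι A)
    (hν : 0 < ν) (w : TimeL2 V × H) :
    HasDerivAt (fun ν => endOp ι A ν w) (endOpDeriv ι A w ν) ν :=
  (isResolventFamily_solutionOp hι hd hG).hasDerivAt_apply hν (finalValue V H) w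

lemma continuousAt_endOpDeriv (hι : Function.Injective ι) (hd : DenseRange ι)
    (hG : IsGarding ι A) (hν : 0 < ν) (w : TimeL2 V × H) : ContinuousAt (endOpDeriv ι A w) ν :=
  (isResolventFamily_solutionOp hι hd hG).continuousAt_deriv_apply hν (finalValue V H) w

lemma hasDerivAt_controlEndOp (hι : Function.Injective ι) (hd : DenseRange ι) (hG : IsGarding ι A)
    (hν : 0 < ν) (B : U →L[ℝ] V) :
    HasDerivAt (controlEndOp ι A B) (controlEndOpDeriv ι A B ν) ν :=
  (isResolventFamily_solutionOp hι hd hG).hasDerivAt_smul_comp hν (finalValue V H) _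

lemma continuousAt_controlEndOpDeriv (hι : Function.Injective ι) (hd : DenseRange ι)
    (hG : IsGarding ι A) (hν : 0 < ν) (B : U →L[ℝ] V) :
    ContinuousAt (controlEndOpDeriv ι A B) ν :=
  (isResolventFamily_solutionOp hι hd hG).continuousAt_deriv_smul_comp hν (finalValue V H) _

/-- Differentiating `(J y)' + ν A y = ν B u` in `ν` with `y(0)` fixed gives the same equation for
`∂y/∂ν`, with source `B u - A y` and initial value zero. The right-hand side is its value at time
one. -/
lemma controlEndOpDeriv_add (B : U →L[ℝ] V) (y₀ : H) (u : TimeL2 U) :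
    controlEndOpDeriv ι A B ν u + endOpDeriv ι A (0, y₀) ν
      = endOp ι A ν (B.compLpL 2 (timeMeasure 1) u
        - A.compLpL 2 (timeMeasure 1) (solutionOp ι A ν (controlDatum B y₀ ν u)).1, 0) := by
  set E : TimeL2 V →L[ℝ] H := endOp ι A ν ∘L ContinuousLinearMap.inl ℝ (TimeL2 V) H with hE
  set R : TimeL2 V × H →L[ℝ] TimeL2 V := diffusionOp A H ∘L solutionOp ι A ν with hR
  change E (B.compLpL 2 (timeMeasure 1) u)
      - ν • E (R (B.compLpL 2 (timeMeasure 1) u, 0)) + -E (R (0, y₀))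
    = E (B.compLpL 2 (timeMeasure 1) u - R (controlDatum B y₀ ν u))
  rw [controlDatum_eq, map_add, map_smul, map_sub, map_add, map_smul]
  abel

end Controlled

end LinearTheory

section ConvexMinimization

/-! ### Minimal norm problems over bounded closed convex sets -/

open Filter

variable {K Y : Type*} [NormedAddCommGroup K] [InnerProductSpace ℝ K]
  [NormedAddCommGroup Y] [InnerProductSpace ℝ Y]

/-- First order condition for elements of minimal norm of a convex set. -/
lemma Convex.inner_nonneg_of_norm_le {C : Set Y} (hC : Convex ℝ C) {x : Y} (hx : x ∈ C)
    (hmin : ∀ y ∈ C, ‖x‖ ≤ ‖y‖) {y : Y} (hy : y ∈ C) : 0 ≤ ⟪x, y - x⟫_ℝ := by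
  have h : ‖(0 : Y) - x‖ = ⨅ w : C, ‖(0 : Y) - w‖ := by
    have : Nonempty C := ⟨⟨x, hx⟩⟩
    refine le_antisymm (le_ciInf fun w => by simpa using hmin w w.2) ?_
    exact ciInf_le (f := fun w : C => ‖(0 : Y) - w‖) ⟨0, by rintro _ ⟨w, rfl⟩; positivity⟩ ⟨x, hx⟩
  have := (norm_eq_iInf_iff_real_inner_le_zero hC hx).1 h y hy
  rw [zero_sub, inner_neg_left] at this
  linarith

/-- Expand the square and use the first order condition. The estimate turns convergence of norms
into strong convergence and shows that the element of least norm is unique. -/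
lemma Convex.norm_sub_sq_le {C : Set Y} (hC : Convex ℝ C) {x : Y} (hx : x ∈ C)
    (hmin : ∀ y ∈ C, ‖x‖ ≤ ‖y‖) {y : Y} (hy : y ∈ C) : ‖y - x‖ ^ 2 ≤ ‖y‖ ^ 2 - ‖x‖ ^ 2 := by
  have h1 := hC.inner_nonneg_of_norm_le hx hmin hy
  rw [inner_sub_right, real_inner_self_eq_norm_sq] at h1
  rw [norm_sub_sq_real, real_inner_comm]
  linarith

/-- A decreasing sequence of nonempty bounded closed convex sets has a common point. -/
lemma exists_forall_mem_of_antitone_convex [CompleteSpace K] {C : ℕ → Set K} (hanti : Antitone C)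
    (hcl : ∀ n, IsClosed (C n)) (hcv : ∀ n, Convex ℝ (C n)) (hne : ∀ n, (C n).Nonempty)
    (hb : Bornology.IsBounded (C 0)) : ∃ x, ∀ n, x ∈ C n := by
  -- Take the element of least norm in each set. These norms increase and are bounded, so
  -- `Convex.norm_sub_sq_le` makes the sequence Cauchy; its limit lies in every set.
  have hmin : ∀ n, ∃ x ∈ C n, ∀ y ∈ C n, ‖x‖ ≤ ‖y‖ := by
    intro n
    obtain ⟨x, hx, h⟩ := exists_norm_eq_iInf_of_complete_convex (hne n) (hcl n).isComplete (hcv n) 0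
    refine ⟨x, hx, fun y hy => ?_⟩
    simp only [zero_sub, norm_neg] at h
    rw [h]
    exact ciInf_le (f := fun w : C n => ‖(w : K)‖)
      ⟨0, by rintro _ ⟨w, rfl⟩; positivity⟩ ⟨y, hy⟩
  choose c hc hcmin using hmin
  obtain ⟨R, hR⟩ := hb.exists_norm_le
  have hmono : Monotone fun n => ‖c n‖ ^ 2 := fun m n hmn =>
    pow_le_pow_left₀ (norm_nonneg _) (hcmin m _ (hanti hmn (hc n))) 2
  have hbdd : BddAbove (range fun n => ‖c n‖ ^ 2) := ⟨R ^ 2, by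
    rintro _ ⟨n, rfl⟩
    exact pow_le_pow_left₀ (norm_nonneg _) (hR _ (hanti (Nat.zero_le n) (hc n))) 2⟩
  have hcau := (tendsto_atTop_ciSup hmono hbdd).cauchySeq
  have hcauchy : CauchySeq c := by
    rw [Metric.cauchySeq_iff'] at hcau ⊢
    intro ε hε
    obtain ⟨N, hN⟩ := hcau (ε ^ 2) (by positivity)
    refine ⟨N, fun n hn => ?_⟩
    have h1 := hN n hn
    rw [Real.dist_eq] at h1
    have h2 := (hcv N).norm_sub_sq_le (hc N) (hcmin N) (hanti hn (hc n))
    rw [dist_eq_norm]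
    exact lt_of_pow_lt_pow_left₀ 2 hε.le (h2.trans_lt ((le_abs_self _).trans_lt h1))
  obtain ⟨x, hx⟩ := cauchySeq_tendsto_of_complete hcauchy
  refine ⟨x, fun n => (hcl n).mem_of_tendsto hx ?_⟩
  filter_upwards [eventually_ge_atTop n] with m hm using hanti hm (hc m)

variable [CompleteSpace K] {C : Set K}

omit [CompleteSpace K] in
lemma convex_sublevel_norm_affine (hcv : Convex ℝ C) (T : K →L[ℝ] Y) (b : Y) (r : ℝ) :
    Convex ℝ (C ∩ {u | ‖T u + b‖ ≤ r}) := by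
  have h := (convexOn_univ_norm (E := Y)).comp_affineMap
    (T.toLinearMap.toAffineMap + AffineMap.const ℝ K b)
  refine hcv.inter fun u hu v hv s t hs ht hst => ?_
  have h1 := h.2 (mem_univ u) (mem_univ v) hs ht hst
  refine h1.trans ?_
  calc s • ‖T u + b‖ + t • ‖T v + b‖ ≤ s * r + t * r :=
        add_le_add (mul_le_mul_of_nonneg_left hu hs) (mul_le_mul_of_nonneg_left hv ht)
    _ = r := by rw [← add_mul, hst, one_mul]

omit [CompleteSpace K] in
lemma isClosed_sublevel_norm_affine (hcl : IsClosed C) (T : K →L[ℝ] Y) (b : Y) (r : ℝ) :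
    IsClosed (C ∩ {u | ‖T u + b‖ ≤ r}) :=
  hcl.inter (isClosed_le (T.continuous.add continuous_const).norm continuous_const)

/-- The norm of an affine function attains its minimum on a bounded closed convex set. -/
lemma exists_isMinOn_norm_affine (hne : C.Nonempty) (hcl : IsClosed C) (hcv : Convex ℝ C)
    (hb : Bornology.IsBounded C) (T : K →L[ℝ] Y) (b : Y) :
    ∃ u ∈ C, ∀ v ∈ C, ‖T u + b‖ ≤ ‖T v + b‖ := by
  set m := sInf ((fun u => ‖T u + b‖) '' C) with hm
  have hbb : BddBelow ((fun u => ‖T u + b‖) '' C) := ⟨0, by rintro _ ⟨u, _, rfl⟩; positivity⟩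
  obtain ⟨u, hu⟩ := exists_forall_mem_of_antitone_convex
    (C := fun n : ℕ => C ∩ {u | ‖T u + b‖ ≤ m + 1 / ((n : ℝ) + 1)})
    (fun n k hnk u hu => ⟨hu.1,
      (show ‖T u + b‖ ≤ m + 1 / ((k : ℝ) + 1) from hu.2).trans
        (add_le_add le_rfl (Nat.one_div_le_one_div hnk))⟩)
    (fun n => isClosed_sublevel_norm_affine hcl T b _)
    (fun n => convex_sublevel_norm_affine hcv T b _)
    (fun n => by
      obtain ⟨_, ⟨u, hu, rfl⟩, h⟩ := exists_lt_of_csInf_lt (hne.image _)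
        (lt_add_of_pos_right m (show (0 : ℝ) < 1 / ((n : ℝ) + 1) by positivity))
      exact ⟨u, hu, h.le⟩)
    (hb.subset fun u hu => hu.1)
  refine ⟨u, (hu 0).1, fun v hv => ?_⟩
  have h1 : ‖T u + b‖ ≤ m := by
    refine ge_of_tendsto' (x := atTop) (f := fun n : ℕ => m + 1 / ((n : ℝ) + 1)) ?_
      fun n => (hu n).2
    simpa using tendsto_const_nhds.add tendsto_one_div_add_atTop_nhds_zero_nat (a := m)
  exact h1.trans (csInf_le hbb ⟨v, hv, rfl⟩)

/-- Minimizing sequences converge weakly if the minimizer is unique. -/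
lemma tendsto_of_tendsto_norm_affine (hcl : IsClosed C) (hcv : Convex ℝ C)
    (hb : Bornology.IsBounded C) {T : K →L[ℝ] Y} {b : Y} {u₀ : K}
    (huniq : ∀ u ∈ C, ‖T u + b‖ ≤ ‖T u₀ + b‖ → u = u₀)
    {α : Type*} {l : Filter α} {u : α → K} (hu : ∀ i, u i ∈ C)
    (hlim : Tendsto (fun i => ‖T (u i) + b‖) l (𝓝 ‖T u₀ + b‖)) (ℓ : K →L[ℝ] ℝ) :
    Tendsto (fun i => ℓ (u i)) l (𝓝 (ℓ u₀)) := by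
  -- A one-sided bound suffices, since it is also applied to `-ℓ`. If it failed, almost-minimizers
  -- in the half-space `ℓ ≥ ℓ u₀ + η` would form nested convex sets with a common point, a minimizer
  -- different from `u₀`.
  have key : ∀ ℓ : K →L[ℝ] ℝ, ∀ η > 0, ∀ᶠ i in l, ℓ (u i) < ℓ u₀ + η := by
    intro ℓ η hη
    have : ∃ n : ℕ, ∀ v ∈ C, ‖T v + b‖ ≤ ‖T u₀ + b‖ + 1 / ((n : ℝ) + 1) → ℓ v < ℓ u₀ + η := by
      by_contra! hcon
      obtain ⟨v, hv⟩ := exists_forall_mem_of_antitone_convex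
        (C := fun n : ℕ => (C ∩ {v | ‖T v + b‖ ≤ ‖T u₀ + b‖ + 1 / ((n : ℝ) + 1)})
          ∩ {v | ℓ u₀ + η ≤ ℓ v})
        (fun n k hnk u hu => ⟨⟨hu.1.1,
          (show ‖T u + b‖ ≤ ‖T u₀ + b‖ + 1 / ((k : ℝ) + 1) from hu.1.2).trans
            (add_le_add le_rfl (Nat.one_div_le_one_div hnk))⟩, hu.2⟩)
        (fun n => (isClosed_sublevel_norm_affine hcl T b _).inter
          (isClosed_le continuous_const ℓ.continuous))
        (fun n => (convex_sublevel_norm_affine hcv T b _).inter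
          (convex_halfSpace_ge ℓ.isLinear _))
        (fun n => by
          obtain ⟨v, h1, h2, h3⟩ := hcon n
          exact ⟨v, ⟨h1, h2⟩, h3⟩)
        (hb.subset fun u hu => hu.1.1)
      have h1 : ‖T v + b‖ ≤ ‖T u₀ + b‖ := by
        refine ge_of_tendsto' (x := atTop)
          (f := fun n : ℕ => ‖T u₀ + b‖ + 1 / ((n : ℝ) + 1)) ?_ fun n => (hv n).1.2
        simpa using tendsto_const_nhds.add tendsto_one_div_add_atTop_nhds_zero_nat
          (a := ‖T u₀ + b‖)
      have h2 : ℓ u₀ + η ≤ ℓ v := (hv 0).2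
      rw [huniq v (hv 0).1.1 h1] at h2
      linarith
    obtain ⟨n, hn⟩ := this
    filter_upwards [hlim.eventually_le_const
      (lt_add_of_pos_right _ (show (0 : ℝ) < 1 / ((n : ℝ) + 1) by positivity))] with i hi
    exact hn _ (hu i) hi
  rw [Metric.tendsto_nhds]
  intro η hη
  filter_upwards [key ℓ η hη, key (-ℓ) η hη] with i h1 h2
  rw [Real.dist_eq, abs_lt]
  simp only [neg_apply] at h2
  constructor <;> linarith

omit [CompleteSpace K] in
/-- Along minimizing sequences the norm-minimal image is attained strongly. -/
lemma tendsto_affine_of_tendsto_norm (hcv : Convex ℝ C) {T : K →L[ℝ] Y} {b : Y} {u₀ : K}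
    (hu₀ : u₀ ∈ C) (hmin : ∀ v ∈ C, ‖T u₀ + b‖ ≤ ‖T v + b‖)
    {α : Type*} {l : Filter α} {u : α → K} (hu : ∀ i, u i ∈ C)
    (hlim : Tendsto (fun i => ‖T (u i) + b‖) l (𝓝 ‖T u₀ + b‖)) :
    Tendsto (fun i => T (u i) + b) l (𝓝 (T u₀ + b)) := by
  have hC : Convex ℝ ((fun u => T u + b) '' C) := by
    exact hcv.affine_image (T.toLinearMap.toAffineMap + AffineMap.const ℝ K b)
  have h1 : ∀ i, ‖(T (u i) + b) - (T u₀ + b)‖ ^ 2 ≤ ‖T (u i) + b‖ ^ 2 - ‖T u₀ + b‖ ^ 2 := fun i =>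
    hC.norm_sub_sq_le ⟨u₀, hu₀, rfl⟩ (by rintro _ ⟨v, hv, rfl⟩; exact hmin v hv) ⟨u i, hu i, rfl⟩
  have h2 : Tendsto (fun i => ‖(T (u i) + b) - (T u₀ + b)‖ ^ 2) l (𝓝 0) := by
    refine squeeze_zero (fun _ => by positivity) h1 ?_
    have := (hlim.pow 2).sub_const (‖T u₀ + b‖ ^ 2)
    rwa [sub_self] at this
  rw [tendsto_iff_norm_sub_tendsto_zero]
  have h3 := h2.sqrt
  simpa [Real.sqrt_sq] using h3

omit [CompleteSpace K] in
/-- Weak times strong convergence. -/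
lemma tendsto_inner_of_weak_of_strong (hb : Bornology.IsBounded C)
    {α : Type*} {l : Filter α}
    {u : α → K} {u₀ : K} (hu : ∀ i, u i ∈ C)
    (hw : ∀ ℓ : K →L[ℝ] ℝ, Tendsto (fun i => ℓ (u i)) l (𝓝 (ℓ u₀)))
    {M : α → K →L[ℝ] Y} {M₀ : K →L[ℝ] Y} (hM : Tendsto M l (𝓝 M₀))
    {q : α → Y} {q₀ : Y} (hq : Tendsto q l (𝓝 q₀)) :
    Tendsto (fun i => ⟪M i (u i), q i⟫_ℝ) l (𝓝 ⟪M₀ u₀, q₀⟫_ℝ) := by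
  obtain ⟨R, hR⟩ := hb.exists_norm_le
  have h1 : Tendsto (fun i => (innerSL ℝ (q i)) ∘L M i - (innerSL ℝ q₀) ∘L M₀) l (𝓝 0) := by
    have hc : Tendsto (fun i => (innerSL ℝ (q i)) ∘L M i) l (𝓝 ((innerSL ℝ q₀) ∘L M₀)) := by
      have hq' : Tendsto (fun i => innerSL ℝ (q i)) l (𝓝 (innerSL ℝ q₀)) :=
        ((innerSL ℝ).continuous.tendsto q₀).comp hq
      exact ((continuous_fst.clm_comp continuous_snd).tendsto (innerSL ℝ q₀, M₀)).comp
        (hq'.prodMk_nhds hM)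
    simpa using hc.sub_const ((innerSL ℝ q₀) ∘L M₀)
  have h2 : Tendsto (fun i => ((innerSL ℝ (q i)) ∘L M i - (innerSL ℝ q₀) ∘L M₀) (u i)) l
      (𝓝 0) := by
    refine squeeze_zero_norm (fun i => ((_ : K →L[ℝ] ℝ).le_opNorm (u i)).trans
      (mul_le_mul_of_nonneg_left (hR _ (hu i)) (norm_nonneg _))) ?_
    simpa using h1.norm.mul_const R
  have h3 := h2.add (hw ((innerSL ℝ q₀) ∘L M₀))
  simp only [zero_add] at h3
  rw [real_inner_comm]
  refine h3.congr fun i => ?_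
  simp [real_inner_comm]

/-- The minimal norm of the affine function `u ↦ L u + b` over `C`. -/
noncomputable def minNorm (C : Set K) (T : K →L[ℝ] Y) (b : Y) : ℝ :=
  sInf ((fun u => ‖T u + b‖) '' C)

omit [CompleteSpace K] in
lemma minNorm_eq {T : K →L[ℝ] Y} {b : Y} {u : K} (hu : u ∈ C)
    (hmin : ∀ v ∈ C, ‖T u + b‖ ≤ ‖T v + b‖) : minNorm C T b = ‖T u + b‖ :=
  IsLeast.csInf_eq ⟨⟨u, hu, rfl⟩, by rintro _ ⟨v, hv, rfl⟩; exact hmin v hv⟩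

omit [CompleteSpace K] in
lemma minNorm_le {T : K →L[ℝ] Y} {b : Y} {u : K} (hu : u ∈ C) : minNorm C T b ≤ ‖T u + b‖ :=
  csInf_le ⟨0, by rintro _ ⟨u, _, rfl⟩; positivity⟩ ⟨u, hu, rfl⟩

/-! ### Differentiating the minimal norm in a parameter -/

section Parametric

variable {L : ℝ → K →L[ℝ] Y} {b : ℝ → Y} {L' : K →L[ℝ] Y} {b' : Y} {ν₀ : ℝ}

omit [CompleteSpace K] in
/-- Uniform first order expansion on bounded sets. -/
lemma isLittleO_affine_family (hb : Bornology.IsBounded C) (hL : HasDerivAt L L' ν₀)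
    (hbd : HasDerivAt b b' ν₀) : ∃ r : ℝ → ℝ, r =o[𝓝 ν₀] (fun ν => ν - ν₀) ∧
      ∀ u ∈ C, ∀ ν, ‖(L ν u + b ν) - (L ν₀ u + b ν₀) - (ν - ν₀) • (L' u + b')‖ ≤ r ν := by
  obtain ⟨R, hR⟩ := hb.exists_norm_le
  refine ⟨fun ν => ‖L ν - L ν₀ - (ν - ν₀) • L'‖ * R + ‖b ν - b ν₀ - (ν - ν₀) • b'‖, ?_, ?_⟩
  · refine Asymptotics.IsLittleO.add ?_ (hasDerivAt_iff_isLittleO.1 hbd).norm_left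
    simp only [mul_comm _ R]
    exact (hasDerivAt_iff_isLittleO.1 hL).norm_left.const_mul_left R
  · intro u hu ν
    have h1 : (L ν u + b ν) - (L ν₀ u + b ν₀) - (ν - ν₀) • (L' u + b')
        = (L ν - L ν₀ - (ν - ν₀) • L') u + (b ν - b ν₀ - (ν - ν₀) • b') := by
      simp only [sub_apply, smul_apply, smul_add]
      abel
    rw [h1]
    refine (norm_add_le _ _).trans (add_le_add_left ?_ _)
    exact ((_ : K →L[ℝ] Y).le_opNorm u).trans
      (mul_le_mul_of_nonneg_left (hR u hu) (norm_nonneg _))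

omit [CompleteSpace K] in
/-- Minimizers for nearby parameters form a minimizing family at `ν₀`. -/
lemma tendsto_norm_affine_minimizers (hb : Bornology.IsBounded C) (hL : HasDerivAt L L' ν₀)
    (hbd : HasDerivAt b b' ν₀) {m : ℝ → K} (hm : ∀ ν, m ν ∈ C)
    (hmin : ∀ ν, ∀ v ∈ C, ‖L ν (m ν) + b ν‖ ≤ ‖L ν v + b ν‖) :
    Tendsto (fun ν => (L ν (m ν) + b ν) - (L ν₀ (m ν) + b ν₀)) (𝓝 ν₀) (𝓝 0) ∧
    Tendsto (fun ν => ‖L ν₀ (m ν) + b ν₀‖) (𝓝 ν₀) (𝓝 ‖L ν₀ (m ν₀) + b ν₀‖) := by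
  obtain ⟨R, hR⟩ := hb.exists_norm_le
  have hLc : Tendsto (fun ν => ‖L ν - L ν₀‖ * R + ‖b ν - b ν₀‖) (𝓝 ν₀) (𝓝 0) := by
    have h1 := (tendsto_iff_norm_sub_tendsto_zero.1 hL.continuousAt.tendsto).mul_const R
    have h2 := tendsto_iff_norm_sub_tendsto_zero.1 hbd.continuousAt.tendsto
    simpa using h1.add h2
  have hbound : ∀ u ∈ C, ∀ ν, ‖(L ν u + b ν) - (L ν₀ u + b ν₀)‖
      ≤ ‖L ν - L ν₀‖ * R + ‖b ν - b ν₀‖ := by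
    intro u hu ν
    have h1 : (L ν u + b ν) - (L ν₀ u + b ν₀) = (L ν - L ν₀) u + (b ν - b ν₀) := by
      simp only [sub_apply]; abel
    rw [h1]
    refine (norm_add_le _ _).trans (add_le_add_left ?_ _)
    exact ((_ : K →L[ℝ] Y).le_opNorm u).trans
      (mul_le_mul_of_nonneg_left (hR u hu) (norm_nonneg _))
  refine ⟨squeeze_zero_norm (fun ν => hbound _ (hm ν) ν) hLc, ?_⟩
  -- The factor `2` comes from changing the parameter twice, from `ν₀` to `ν` at `m ν` and back at
  -- `m ν₀`, with optimality of `m ν` at `ν` in between.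
  refine tendsto_of_tendsto_of_tendsto_of_le_of_le (g := fun _ => ‖L ν₀ (m ν₀) + b ν₀‖)
    (h := fun ν => ‖L ν₀ (m ν₀) + b ν₀‖ + 2 * (‖L ν - L ν₀‖ * R + ‖b ν - b ν₀‖))
    tendsto_const_nhds ?_ (fun ν => hmin ν₀ _ (hm ν)) fun ν => ?_
  · simpa using tendsto_const_nhds.add (hLc.const_mul 2)
  · have h1 := hbound _ (hm ν) ν
    have h2 := hbound _ (hm ν₀) ν
    have h3 := hmin ν _ (hm ν₀)
    have h4 : ‖L ν₀ (m ν) + b ν₀‖ ≤ ‖L ν (m ν) + b ν‖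
        + ‖(L ν (m ν) + b ν) - (L ν₀ (m ν) + b ν₀)‖ := norm_le_norm_add_norm_sub _ _
    have h5 : ‖L ν (m ν₀) + b ν‖ ≤ ‖L ν₀ (m ν₀) + b ν₀‖
        + ‖(L ν (m ν₀) + b ν) - (L ν₀ (m ν₀) + b ν₀)‖ := norm_le_norm_add_norm_sub' _ _
    simp only
    linarith

lemma tendsto_unit {α : Type*} {l : Filter α} {x : α → Y} {x₀ : Y} (hx : Tendsto x l (𝓝 x₀))
    (h0 : x₀ ≠ 0) : Tendsto (fun i => ‖x i‖⁻¹ • x i) l (𝓝 (‖x₀‖⁻¹ • x₀)) :=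
  (hx.norm.inv₀ (norm_ne_zero_iff.2 h0)).smul hx

/-- Danskin's theorem: the minimal norm is differentiable where the minimizer is unique. -/
lemma hasDerivAt_minNorm (hne : C.Nonempty) (hcl : IsClosed C) (hcv : Convex ℝ C)
    (hb : Bornology.IsBounded C) (hL : HasDerivAt L L' ν₀) (hbd : HasDerivAt b b' ν₀)
    {u₀ : K} (hu₀ : u₀ ∈ C) (hmin₀ : ∀ v ∈ C, ‖L ν₀ u₀ + b ν₀‖ ≤ ‖L ν₀ v + b ν₀‖)
    (huniq : ∀ u ∈ C, ‖L ν₀ u + b ν₀‖ ≤ ‖L ν₀ u₀ + b ν₀‖ → u = u₀) (hpos : L ν₀ u₀ + b ν₀ ≠ 0) :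
    HasDerivAt (fun ν => minNorm C (L ν) (b ν))
      ⟪L' u₀ + b', ‖L ν₀ u₀ + b ν₀‖⁻¹ • (L ν₀ u₀ + b ν₀)⟫_ℝ ν₀ := by
  choose m hm hmin using fun ν => exists_isMinOn_norm_affine hne hcl hcv hb (L ν) (b ν)
  have hm0 : m ν₀ = u₀ := huniq _ (hm ν₀) (hmin ν₀ u₀ hu₀)
  have hN : ∀ ν, minNorm C (L ν) (b ν) = ‖L ν (m ν) + b ν‖ := fun ν => minNorm_eq (hm ν) (hmin ν)
  set x₀ := L ν₀ u₀ + b ν₀ with hx₀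
  set D := ⟪L' u₀ + b', ‖x₀‖⁻¹ • x₀⟫_ℝ with hD
  obtain ⟨hdiff, hmn⟩ := tendsto_norm_affine_minimizers hb hL hbd hm hmin
  rw [hm0] at hmn
  have hstrong := tendsto_affine_of_tendsto_norm hcv hu₀ hmin₀ hm hmn
  have hweak := tendsto_of_tendsto_norm_affine hcl hcv hb huniq hm hmn
  have hq := tendsto_unit hstrong hpos
  rw [← hx₀] at hq
  -- The unit vector `q ν` linearises the norm at `L ν₀ (m ν) + b ν₀` from below. It converges
  -- strongly, while `m ν` converges only weakly; together this suffices for the limit `D`.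
  set q : ℝ → Y := fun ν => ‖L ν₀ (m ν) + b ν₀‖⁻¹ • (L ν₀ (m ν) + b ν₀) with hqdef
  have hG : Tendsto (fun ν => ⟪L' (m ν) + b', q ν⟫_ℝ) (𝓝 ν₀) (𝓝 D) := by
    simp only [inner_add_left, hD]
    exact (tendsto_inner_of_weak_of_strong hb hm hweak tendsto_const_nhds hq).add
      (tendsto_const_nhds.inner hq)
  obtain ⟨r, hr, hrC⟩ := isLittleO_affine_family hb hL hbd
  have hφ : HasDerivAt (fun ν => ‖L ν u₀ + b ν‖) D ν₀ := by
    have h1 : HasDerivAt (fun ν => L ν u₀ + b ν) (L' u₀ + b') ν₀ := by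
      have := (hL.clm_apply (hasDerivAt_const ν₀ u₀)).add hbd
      simp only [map_zero, add_zero] at this
      exact this
    have h2 := h1.norm_sq.sqrt (by rw [← hx₀]; exact pow_ne_zero 2 (norm_ne_zero_iff.2 hpos))
    simp only [Real.sqrt_sq (norm_nonneg _)] at h2
    convert h2 using 1
    rw [hD, real_inner_smul_right, real_inner_comm, ← hx₀]
    field_simp
  rw [hasDerivAt_iff_isLittleO] at hφ ⊢
  have hlow : (fun ν => ‖ν - ν₀‖ * ‖⟪L' (m ν) + b', q ν⟫_ℝ - D‖) =o[𝓝 ν₀] (fun ν => ν - ν₀) := by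
    have h1 : (fun ν => ‖⟪L' (m ν) + b', q ν⟫_ℝ - D‖) =o[𝓝 ν₀] (fun _ => (1 : ℝ)) := by
      rw [Asymptotics.isLittleO_one_iff]
      exact tendsto_iff_norm_sub_tendsto_zero.1 hG
    have h2 := (Asymptotics.isBigO_refl (fun ν : ℝ => ‖ν - ν₀‖) (𝓝 ν₀)).mul_isLittleO h1
    simp only [mul_one] at h2
    exact h2.of_norm_right
  -- The upper estimate tests the minimum at `ν` with `u₀`. The lower one pairs `L ν (m ν) + b ν`
  -- with `q ν`, expands to first order uniformly on `C`, and uses `‖L ν₀ (m ν) + b ν₀‖ ≥ ‖x₀‖`.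
  refine (Asymptotics.IsBigO.of_bound 1 ?_).trans_isLittleO ((hr.add hlow).add hφ.norm_left)
  have hev : ∀ᶠ ν in 𝓝 ν₀, L ν₀ (m ν) + b ν₀ ≠ 0 := hstrong.eventually_ne hpos
  filter_upwards [hev] with ν hν
  rw [one_mul]
  refine le_trans ?_ (le_abs_self _)
  rw [hN ν, hN ν₀, hm0, ← hx₀]
  have hr0 : 0 ≤ r ν := (norm_nonneg _).trans (hrC _ hu₀ ν)
  have hup : ‖L ν (m ν) + b ν‖ ≤ ‖L ν u₀ + b ν‖ := hmin ν _ hu₀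
  have hx : ‖x₀‖ ≤ ‖L ν₀ (m ν) + b ν₀‖ := hmin₀ _ (hm ν)
  have hq1 : ‖q ν‖ = 1 := by
    rw [hqdef]; simp only
    rw [norm_smul, norm_inv, norm_norm, inv_mul_cancel₀ (norm_ne_zero_iff.2 hν)]
  have hq2 : ⟪L ν₀ (m ν) + b ν₀, q ν⟫_ℝ = ‖L ν₀ (m ν) + b ν₀‖ := by
    rw [hqdef]; simp only
    rw [real_inner_smul_right, real_inner_self_eq_norm_sq]
    have := norm_ne_zero_iff.2 hν
    field_simp
  have hq3 : ⟪L ν (m ν) + b ν, q ν⟫_ℝ ≤ ‖L ν (m ν) + b ν‖ := by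
    have := real_inner_le_norm (L ν (m ν) + b ν) (q ν)
    rwa [hq1, mul_one] at this
  have hq4 : -r ν ≤ ⟪(L ν (m ν) + b ν) - (L ν₀ (m ν) + b ν₀) - (ν - ν₀) • (L' (m ν) + b'),
      q ν⟫_ℝ := by
    have h1 := abs_real_inner_le_norm
      ((L ν (m ν) + b ν) - (L ν₀ (m ν) + b ν₀) - (ν - ν₀) • (L' (m ν) + b')) (q ν)
    rw [hq1, mul_one] at h1
    have h2 := (abs_le.1 (h1.trans (hrC _ (hm ν) ν))).1
    exact h2
  rw [inner_sub_left, inner_sub_left, hq2, real_inner_smul_left] at hq4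
  set g := ⟪L' (m ν) + b', q ν⟫_ℝ
  have hgD : -(‖ν - ν₀‖ * ‖g - D‖) ≤ (ν - ν₀) * g - (ν - ν₀) * D := by
    rw [← mul_sub, ← norm_mul]; exact neg_abs_le _
  have hφ2 := le_abs_self (‖L ν u₀ + b ν‖ - ‖x₀‖ - (ν - ν₀) * D)
  have hφ3 := abs_nonneg (‖L ν u₀ + b ν‖ - ‖x₀‖ - (ν - ν₀) * D)
  have hg0 : 0 ≤ ‖ν - ν₀‖ * ‖g - D‖ := by positivity
  simp only [smul_eq_mul, Real.norm_eq_abs (_ - _ - _)] at *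
  rw [abs_le]
  constructor <;> linarith

/-- The derivative in Danskin's theorem depends continuously on the parameter. -/
lemma continuousAt_deriv_minNorm (hcl : IsClosed C) (hcv : Convex ℝ C)
    (hb : Bornology.IsBounded C) {L' : ℝ → K →L[ℝ] Y} {b' : ℝ → Y}
    (hL : HasDerivAt L (L' ν₀) ν₀) (hbd : HasDerivAt b (b' ν₀) ν₀)
    (hL' : ContinuousAt L' ν₀) (hb' : ContinuousAt b' ν₀) {m : ℝ → K} (hm : ∀ ν, m ν ∈ C)
    (hmin : ∀ ν, ∀ v ∈ C, ‖L ν (m ν) + b ν‖ ≤ ‖L ν v + b ν‖)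
    (huniq : ∀ u ∈ C, ‖L ν₀ u + b ν₀‖ ≤ ‖L ν₀ (m ν₀) + b ν₀‖ → u = m ν₀)
    (hpos : L ν₀ (m ν₀) + b ν₀ ≠ 0) :
    ContinuousAt (fun ν => ⟪L' ν (m ν) + b' ν,
      ‖L ν (m ν) + b ν‖⁻¹ • (L ν (m ν) + b ν)⟫_ℝ) ν₀ := by
  obtain ⟨hdiff, hmn⟩ := tendsto_norm_affine_minimizers hb hL hbd hm hmin
  have hstrong := tendsto_affine_of_tendsto_norm hcv (hm ν₀) (hmin ν₀) hm hmn
  have hweak := tendsto_of_tendsto_norm_affine hcl hcv hb huniq hm hmn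
  have hx : Tendsto (fun ν => L ν (m ν) + b ν) (𝓝 ν₀) (𝓝 (L ν₀ (m ν₀) + b ν₀)) := by
    simpa using hdiff.add hstrong
  have hq := tendsto_unit hx hpos
  simp only [ContinuousAt, inner_add_left]
  exact (tendsto_inner_of_weak_of_strong hb hm hweak hL'.tendsto hq).add (hb'.tendsto.inner hq)

end Parametric

end ConvexMinimization

/-! ### Jointly measurable representatives of `L²(ϱ)`-valued maps -/

section Sections

variable {α β : Type*} [MeasurableSpace α] [MeasurableSpace β] {μ : Measure α} {ϱ : Measure β}
  [SFinite ϱ]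

/-- `F` is a jointly measurable representative of the `L²`-valued map `f`. -/
def IsJointRep (f : Lp (Lp ℝ 2 ϱ) 2 μ) (F : Lp ℝ 2 (μ.prod ϱ)) : Prop :=
  ∀ᵐ t ∂μ, ∀ᵐ x ∂ϱ, F (t, x) = f t x

lemma IsJointRep.add {f g : Lp (Lp ℝ 2 ϱ) 2 μ} {F G : Lp ℝ 2 (μ.prod ϱ)}
    (hf : IsJointRep f F) (hg : IsJointRep g G) : IsJointRep (f + g) (F + G) := by
  filter_upwards [hf, hg, Measure.ae_ae_of_ae_prod (Lp.coeFn_add F G), Lp.coeFn_add f g]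
    with t h₁ h₂ h₃ h₄
  rw [h₄]
  filter_upwards [h₁, h₂, h₃, Lp.coeFn_add (f t) (g t)] with x e₁ e₂ e₃ e₄
  rw [e₃, Pi.add_apply, e₁, e₂, Pi.add_apply, e₄, Pi.add_apply]

lemma IsJointRep.sub {f g : Lp (Lp ℝ 2 ϱ) 2 μ} {F G : Lp ℝ 2 (μ.prod ϱ)}
    (hf : IsJointRep f F) (hg : IsJointRep g G) : IsJointRep (f - g) (F - G) := by
  filter_upwards [hf, hg, Measure.ae_ae_of_ae_prod (Lp.coeFn_sub F G), Lp.coeFn_sub f g]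
    with t h₁ h₂ h₃ h₄
  rw [h₄]
  filter_upwards [h₁, h₂, h₃, Lp.coeFn_sub (f t) (g t)] with x e₁ e₂ e₃ e₄
  rw [e₃, Pi.sub_apply, e₁, e₂, Pi.sub_apply, e₄, Pi.sub_apply]

variable [SFinite μ]

lemma IsJointRep.norm_eq {f : Lp (Lp ℝ 2 ϱ) 2 μ} {F : Lp ℝ 2 (μ.prod ϱ)} (h : IsJointRep f F) :
    ‖F‖ = ‖f‖ := by
  rw [← sq_eq_sq₀ (norm_nonneg _) (norm_nonneg _), L2_norm_sq, L2_norm_sq,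
    integral_prod _ ((Lp.memLp F).integrable_norm_pow two_ne_zero)]
  refine integral_congr_ae ?_
  filter_upwards [h] with t ht
  rw [L2_norm_sq]
  refine integral_congr_ae ?_
  filter_upwards [ht] with x hx
  rw [hx]

/-- Passing to joint representatives is linear and isometric, so representatives of a convergent
sequence are Cauchy. -/
lemma isClosed_setOf_exists_isJointRep :
    IsClosed {f : Lp (Lp ℝ 2 ϱ) 2 μ | ∃ F, IsJointRep f F} := by
  refine IsSeqClosed.isClosed fun f f₀ hf hlim => ?_
  choose F hF using hf
  have hcau : CauchySeq F := by
    have := hlim.cauchySeq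
    rw [Metric.cauchySeq_iff] at this ⊢
    intro ε hε
    obtain ⟨N, hN⟩ := this ε hε
    refine ⟨N, fun m hm n hn => ?_⟩
    rw [dist_eq_norm, ((hF m).sub (hF n)).norm_eq, ← dist_eq_norm]
    exact hN m hm n hn
  obtain ⟨F₀, hF₀⟩ := cauchySeq_tendsto_of_complete hcau
  refine ⟨F₀, ?_⟩
  -- Three nested subsequences identify the limit: `a` for convergence of `f n t` in `L²(ϱ)`, `b`
  -- for convergence of `F n` on the product, and finally `c`, depending on `t`, for pointwise
  -- convergence in `x`.
  obtain ⟨a, ha, hfa⟩ := (tendstoInMeasure_of_tendsto_Lp hlim).exists_seq_tendsto_ae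
  obtain ⟨b, hb, hFb⟩ :=
    (tendstoInMeasure_of_tendsto_Lp (hF₀.comp ha.tendsto_atTop)).exists_seq_tendsto_ae
  filter_upwards [hfa, Measure.ae_ae_of_ae_prod hFb, ae_all_iff.2 hF] with t h₁ h₂ h₃
  obtain ⟨c, hc, hfc⟩ :=
    (tendstoInMeasure_of_tendsto_Lp (h₁.comp hb.tendsto_atTop)).exists_seq_tendsto_ae
  filter_upwards [hfc, h₂, ae_all_iff.2 h₃] with x e₁ e₂ e₃
  refine tendsto_nhds_unique (e₂.comp hc.tendsto_atTop) (e₁.congr fun n => ?_)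
  exact (e₃ _).symm

/-- Controls are `L²(ω)`-valued functions of time, but unique continuation concerns measurable
subsets of `(0,1) × ω`; this is the bridge. It is clear for indicator functions in time, and
persists under sums and limits. -/
lemma exists_isJointRep [IsFiniteMeasure μ] (f : Lp (Lp ℝ 2 ϱ) 2 μ) : ∃ F, IsJointRep f F := by
  refine Lp.induction (by simp) (fun f => ∃ F, IsJointRep f F) (fun c s hs hμs => ?_)
    (fun f g hf hg _ => ?_) isClosed_setOf_exists_isJointRep f
  · have hm : MemLp ((s ×ˢ (univ : Set β)).indicator fun z : α × β => c z.2) 2 (μ.prod ϱ) :=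
      ((Lp.memLp c).comp_snd μ).indicator (hs.prod MeasurableSet.univ)
    refine ⟨hm.toLp _, ?_⟩
    rw [Lp.simpleFunc.coe_indicatorConst]
    filter_upwards [Measure.ae_ae_of_ae_prod hm.coeFn_toLp,
      indicatorConstLp_coeFn (p := 2) (hs := hs) (hμs := hμs.ne) (c := c)] with t h₁ h₂
    rw [h₂]
    by_cases ht : t ∈ s
    · filter_upwards [h₁] with x hx
      simp [hx, ht]
    · rw [indicator_of_notMem ht]
      filter_upwards [h₁, Lp.coeFn_zero ℝ 2 ϱ] with x hx h0
      rw [hx, h0]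
      simp [ht]
  · rintro ⟨F, hF⟩ ⟨G, hG⟩
    exact ⟨F + G, hF.add hG⟩

omit [SFinite ϱ] [SFinite μ] in
/-- An integrable function on a product whose integrals over rectangles vanish is zero. -/
lemma ae_eq_zero_of_forall_setIntegral_prod_eq_zero {g : α × β → ℝ} (hg : Integrable g (μ.prod ϱ))
    (h : ∀ s t, MeasurableSet s → MeasurableSet t → ∫ z in s ×ˢ t, g z ∂(μ.prod ϱ) = 0) :
    g =ᵐ[μ.prod ϱ] 0 := by
  have huniv : ∫ z, g z ∂(μ.prod ϱ) = 0 := by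
    simpa using h univ univ MeasurableSet.univ MeasurableSet.univ
  have key : ∀ r, MeasurableSet r → ∫ z in r, g z ∂(μ.prod ϱ) = 0 := by
    intro r hr
    induction r, hr using MeasurableSpace.induction_on_inter generateFrom_prod.symm
      isPiSystem_prod with
    | empty => simp
    | basic r hr =>
      obtain ⟨s, hs, t, ht, rfl⟩ := hr
      exact h s t hs ht
    | compl r hr ih =>
      have := integral_add_compl hr hg
      linarith
    | iUnion r hd hm ih =>
      rw [integral_iUnion hm hd hg.integrableOn]
      simp [ih]
  exact hg.ae_eq_zero_of_forall_setIntegral_eq_zero fun s hs _ => key s hs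

omit [SFinite ϱ] in
/-- Multiplication by the indicator function of `s` on `Lᵖ`. -/
noncomputable def indicatorOp {E : Type*} [NormedAddCommGroup E] [NormedSpace ℝ E] {s : Set α}
    (hs : MeasurableSet s) : Lp E 2 μ →L[ℝ] Lp E 2 μ :=
  LinearMap.mkContinuous
    { toFun := fun f => ((Lp.memLp f).indicator hs).toLp _
      map_add' := fun f g => by
        rw [← MemLp.toLp_add, MemLp.toLp_eq_toLp_iff]
        filter_upwards [Lp.coeFn_add f g] with x hx
        by_cases h : x ∈ s
        · simp only [indicator_of_mem h, Pi.add_apply, hx]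
        · simp [h]
      map_smul' := fun c f => by
        rw [RingHom.id_apply, ← MemLp.toLp_const_smul, MemLp.toLp_eq_toLp_iff]
        filter_upwards [Lp.coeFn_smul c f] with x hx
        by_cases h : x ∈ s
        · simp only [indicator_of_mem h, Pi.smul_apply, hx]
        · simp [h] }
    1 fun f => by
      rw [one_mul]
      refine Lp.norm_le_norm_of_ae_le ?_
      filter_upwards [((Lp.memLp f).indicator hs).coeFn_toLp] with x hx
      exact hx ▸ norm_indicator_le_norm_self _ _

omit [SFinite μ] in
lemma coeFn_indicatorOp {E : Type*} [NormedAddCommGroup E] [NormedSpace ℝ E] {s : Set α}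
    (hs : MeasurableSet s) (f : Lp E 2 μ) : indicatorOp hs f =ᵐ[μ] s.indicator f :=
  ((Lp.memLp f).indicator hs).coeFn_toLp

/-- Multiplication by the indicator function of `s ×ˢ r` on `L²(μ; L²(ϱ))`. -/
noncomputable def rectangleOp {s : Set α} {r : Set β} (hs : MeasurableSet s)
    (hr : MeasurableSet r) : Lp (Lp ℝ 2 ϱ) 2 μ →L[ℝ] Lp (Lp ℝ 2 ϱ) 2 μ :=
  indicatorOp hs ∘L (indicatorOp hr).compLpL 2 μ

omit [SFinite ϱ] [SFinite μ] in
lemma coeFn_rectangleOp {s : Set α} {r : Set β} (hs : MeasurableSet s)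
    (hr : MeasurableSet r) (f : Lp (Lp ℝ 2 ϱ) 2 μ) :
    ∀ᵐ t ∂μ, ∀ᵐ x ∂ϱ, rectangleOp hs hr f t x = (s ×ˢ r).indicator (fun _ => f t x) (t, x) := by
  filter_upwards [coeFn_indicatorOp hs ((indicatorOp hr).compLpL 2 μ f),
    ContinuousLinearMap.coeFn_compLpL (indicatorOp (μ := ϱ) hr) f] with t h₁ h₂
  have h₃ : rectangleOp hs hr f t = s.indicator (fun t => indicatorOp hr (f t)) t := by
    refine h₁.trans ?_
    by_cases ht : t ∈ s <;> simp [ht, h₂]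
  rw [h₃]
  by_cases ht : t ∈ s
  · filter_upwards [coeFn_indicatorOp hr (f t)] with x hx
    by_cases hx' : x ∈ r <;> simp [ht, hx, hx']
  · rw [indicator_of_notMem ht]
    filter_upwards [Lp.coeFn_zero ℝ 2 ϱ] with x hx
    rw [hx]
    simp [ht]

omit [SFinite μ] in
lemma IsJointRep.rectangleOp {f : Lp (Lp ℝ 2 ϱ) 2 μ} {F : Lp ℝ 2 (μ.prod ϱ)} (h : IsJointRep f F)
    {s : Set α} {r : Set β} (hs : MeasurableSet s) (hr : MeasurableSet r) :
    IsJointRep (_root_.rectangleOp hs hr f) (indicatorOp (hs.prod hr) F) := by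
  filter_upwards [h, coeFn_rectangleOp hs hr f,
    Measure.ae_ae_of_ae_prod (coeFn_indicatorOp (hs.prod hr) F)] with t h₁ h₂ h₃
  filter_upwards [h₁, h₂, h₃] with x e₁ e₂ e₃
  rw [e₂, e₃]
  by_cases hx : (t, x) ∈ s ×ˢ r
  · rw [indicator_of_mem hx, indicator_of_mem hx, e₁]
  · rw [indicator_of_notMem hx, indicator_of_notMem hx]

lemma IsJointRep.inner_eq {f g : Lp (Lp ℝ 2 ϱ) 2 μ} {F G : Lp ℝ 2 (μ.prod ϱ)}
    (hf : IsJointRep f F) (hg : IsJointRep g G) : ⟪F, G⟫_ℝ = ⟪f, g⟫_ℝ := by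
  rw [real_inner_eq_norm_add_mul_self_sub_norm_mul_self_sub_norm_mul_self_div_two,
    real_inner_eq_norm_add_mul_self_sub_norm_mul_self_sub_norm_mul_self_div_two,
    (hf.add hg).norm_eq, hf.norm_eq, hg.norm_eq]

/-- If `w` stays orthogonal to `b` after restriction to every rectangle, then `w b = 0`. -/
lemma IsJointRep.ae_eq_zero_or_eq_zero {w b : Lp (Lp ℝ 2 ϱ) 2 μ} {W F : Lp ℝ 2 (μ.prod ϱ)}
    (hw : IsJointRep w W) (hb : IsJointRep b F)
    (h : ∀ (s : Set α) (r : Set β) (hs : MeasurableSet s) (hr : MeasurableSet r),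
      ⟪_root_.rectangleOp hs hr w, b⟫_ℝ = 0) : ∀ᵐ z ∂(μ.prod ϱ), W z = 0 ∨ F z = 0 := by
  have hint : Integrable (fun z => W z * F z) (μ.prod ϱ) :=
    (Lp.memLp W).integrable_mul (Lp.memLp F)
  have h0 := ae_eq_zero_of_forall_setIntegral_prod_eq_zero hint fun s r hs hr => by
    have h1 := h s r hs hr
    rw [← (hw.rectangleOp hs hr).inner_eq hb, L2.inner_def] at h1
    rw [← integral_indicator (hs.prod hr), ← h1]
    refine integral_congr_ae ?_
    filter_upwards [coeFn_indicatorOp (hs.prod hr) W] with z hz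
    rw [hz]
    by_cases hm : z ∈ s ×ˢ r
    · simp only [indicator_of_mem hm, RCLike.inner_apply]
      simp [mul_comm]
    · simp only [indicator_of_notMem hm, inner_zero_left]
  filter_upwards [h0] with z hz
  exact mul_eq_zero.1 hz

end Sections

/-! ### Sets of `L²` functions with pointwise constraints -/

section PointwiseConstraints

variable {α E : Type*} [MeasurableSpace α] {μ : Measure α} [NormedAddCommGroup E]

lemma isClosed_setOf_ae_mem {C : α → Set E} (hC : ∀ x, IsClosed (C x)) :
    IsClosed {u : Lp E 2 μ | ∀ᵐ x ∂μ, u x ∈ C x} := by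
  refine IsSeqClosed.isClosed fun u u₀ hu hlim => ?_
  obtain ⟨a, -, ha⟩ := (tendstoInMeasure_of_tendsto_Lp hlim).exists_seq_tendsto_ae
  have hall : ∀ᵐ x ∂μ, ∀ n, u n x ∈ C x := ae_all_iff.2 hu
  filter_upwards [ha, hall] with x h₁ h₂
  exact (hC x).mem_of_tendsto h₁ (Filter.Eventually.of_forall fun n => h₂ _)

lemma convex_setOf_ae_mem [NormedSpace ℝ E] {C : α → Set E} (hC : ∀ x, Convex ℝ (C x)) :
    Convex ℝ {u : Lp E 2 μ | ∀ᵐ x ∂μ, u x ∈ C x} := by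
  intro u hu v hv a b ha hb hab
  filter_upwards [hu, hv, Lp.coeFn_add (a • u) (b • v), Lp.coeFn_smul a u, Lp.coeFn_smul b v]
    with x h₁ h₂ h₃ h₄ h₅
  rw [h₃, Pi.add_apply, h₄, h₅]
  exact hC x h₁ h₂ ha hb hab

lemma isBounded_setOf_ae_mem [IsFiniteMeasure μ] {C : Set E} (hC : Bornology.IsBounded C) :
    Bornology.IsBounded {u : Lp E 2 μ | ∀ᵐ x ∂μ, u x ∈ C} := by
  obtain ⟨M, hM0, hM⟩ := hC.exists_pos_norm_le
  rw [isBounded_iff_forall_norm_le]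
  refine ⟨_, fun u hu => Lp.norm_le_of_ae_bound hM0.le ?_⟩
  have hu : ∀ᵐ x ∂μ, u x ∈ C := hu
  filter_upwards [hu] with x hx using hM _ hx

lemma nonempty_setOf_ae_mem [IsFiniteMeasure μ] {C : Set E} (hC : C.Nonempty) :
    {u : Lp E 2 μ | ∀ᵐ x ∂μ, u x ∈ C}.Nonempty := by
  obtain ⟨c, hc⟩ := hC
  refine ⟨(memLp_const c).toLp _, ?_⟩
  show ∀ᵐ x ∂μ, _
  filter_upwards [(memLp_const (μ := μ) (p := 2) c).coeFn_toLp] with x hx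
  rwa [hx]

end PointwiseConstraints

/-! ### Weak derivatives under rescaling and reversal of time -/

section TimeChange

variable {E F : Type*} [NormedAddCommGroup E] [NormedSpace ℝ E]
  [NormedAddCommGroup F] [NormedSpace ℝ F]

lemma map_mul_left_timeMeasure {c : ℝ} (hc : 0 < c) (T : ℝ) :
    (timeMeasure T).map (fun t => c * t) = ENNReal.ofReal c⁻¹ • timeMeasure (c * T) := by
  have hpre : (fun t => c * t) ⁻¹' Ioo 0 (c * T) = Ioo 0 T := by
    ext t
    simp only [mem_preimage, mem_Ioo, mul_lt_mul_iff_right₀ hc, mul_pos_iff_of_pos_left hc]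
  rw [timeMeasure, timeMeasure, ← hpre, ← Measure.restrict_map (measurable_const_mul c)
    measurableSet_Ioo, Real.map_volume_mul_left hc.ne', Measure.restrict_smul,
    abs_of_pos (inv_pos.2 hc)]

lemma measurableEmbedding_mul_left {c : ℝ} (hc : 0 < c) :
    MeasurableEmbedding (fun t : ℝ => c * t) :=
  (Homeomorph.mulLeft₀ c hc.ne').measurableEmbedding

lemma ae_comp_mul_left {c : ℝ} (hc : 0 < c) {T : ℝ} {p : ℝ → Prop}
    (h : ∀ᵐ t ∂(timeMeasure (c * T)), p t) : ∀ᵐ t ∂(timeMeasure T), p (c * t) := by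
  refine ae_of_ae_map (measurable_const_mul c).aemeasurable ?_
  rw [map_mul_left_timeMeasure hc]
  exact Measure.ae_smul_measure h _

omit [NormedSpace ℝ E] in
lemma MeasureTheory.MemLp.comp_mul_left {c : ℝ} (hc : 0 < c) {T : ℝ} {f : ℝ → E}
    (h : MemLp f 2 (timeMeasure (c * T))) : MemLp (fun t => f (c * t)) 2 (timeMeasure T) := by
  refine (memLp_map_measure_iff ?_ (measurable_const_mul c).aemeasurable).1 ?_ <;>
    rw [map_mul_left_timeMeasure hc]
  · exact h.1.smul_measure _
  · exact h.smul_measure ENNReal.ofReal_ne_top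

lemma integral_comp_mul_left_timeMeasure {c : ℝ} (hc : 0 < c) (T : ℝ) (f : ℝ → E) :
    ∫ t, f (c * t) ∂(timeMeasure T) = c⁻¹ • ∫ t, f t ∂(timeMeasure (c * T)) := by
  rw [← (measurableEmbedding_mul_left hc).integral_map, map_mul_left_timeMeasure hc,
    integral_smul_measure, ENNReal.toReal_ofReal (inv_pos.2 hc).le]

lemma HasWeakTimeDeriv.comp_mul_left {c : ℝ} (hc : 0 < c) {T : ℝ} {f g : ℝ → E}
    (h : HasWeakTimeDeriv (c * T) f g) :
    HasWeakTimeDeriv T (fun t => f (c * t)) (fun t => c • g (c * t)) := by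
  intro φ hφ hs hsub
  have hψ : ContDiff ℝ (⊤ : ℕ∞) fun s => φ (c⁻¹ * s) := hφ.comp (by fun_prop)
  have hψs : HasCompactSupport fun s => φ (c⁻¹ * s) :=
    hs.comp_homeomorph (Homeomorph.mulLeft₀ c⁻¹ (inv_ne_zero hc.ne'))
  have hψsub : tsupport (fun s => φ (c⁻¹ * s)) ⊆ Ioo 0 (c * T) := by
    intro s hs'
    have h1 : c⁻¹ * s ∈ Ioo 0 T :=
      hsub (tsupport_comp_subset_preimage φ (continuous_const_mul c⁻¹) hs')
    refine ⟨(mul_pos_iff_of_pos_left (inv_pos.2 hc)).1 h1.1, ?_⟩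
    have := mul_lt_mul_of_pos_left h1.2 hc
    rwa [mul_inv_cancel_left₀ hc.ne'] at this
  have key := h _ hψ hψs hψsub
  have hd : ∀ s, deriv (fun s => φ (c⁻¹ * s)) s = c⁻¹ * deriv φ (c⁻¹ * s) := fun s => by
    rw [deriv_comp_mul_left, smul_eq_mul]
  have e1 : ∫ t, deriv φ t • f (c * t) ∂(timeMeasure T)
      = ∫ s, deriv (fun s => φ (c⁻¹ * s)) s • f s ∂(timeMeasure (c * T)) := by
    have := integral_comp_mul_left_timeMeasure hc T
      (fun s => deriv φ (c⁻¹ * s) • f s)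
    simp only [inv_mul_cancel_left₀ hc.ne'] at this
    rw [this, ← integral_smul]
    simp only [hd, smul_smul]
  have e2 : ∫ t, φ t • c • g (c * t) ∂(timeMeasure T)
      = ∫ s, φ (c⁻¹ * s) • g s ∂(timeMeasure (c * T)) := by
    have := integral_comp_mul_left_timeMeasure hc T
      (fun s => φ (c⁻¹ * s) • c • g s)
    simp only [inv_mul_cancel_left₀ hc.ne'] at this
    rw [this, ← integral_smul]
    refine integral_congr_ae (Filter.Eventually.of_forall fun s => ?_)
    show c⁻¹ • φ (c⁻¹ * s) • c • g s = _
    rw [smul_comm (φ _) c, inv_smul_smul₀ hc.ne']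
  rw [e1, e2, key]

lemma HasWeakTimeDeriv.comp_one_sub {f g : ℝ → E} (h : HasWeakTimeDeriv 1 f g) :
    HasWeakTimeDeriv 1 (fun t => f (1 - t)) (fun t => -g (1 - t)) := by
  intro φ hφ hs hsub
  have hψ : ContDiff ℝ (⊤ : ℕ∞) fun s => φ (1 - s) := hφ.comp (by fun_prop)
  have hψs : HasCompactSupport fun s => φ (1 - s) :=
    hs.comp_homeomorph (Homeomorph.subLeft 1)
  have hψsub : tsupport (fun s => φ (1 - s)) ⊆ Ioo 0 1 := by
    intro s hs'
    have h1 : 1 - s ∈ Ioo (0 : ℝ) 1 :=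
      hsub (tsupport_comp_subset_preimage φ (by fun_prop : Continuous fun s : ℝ => 1 - s) hs')
    constructor <;> linarith [h1.1, h1.2]
  have key := h _ hψ hψs hψsub
  have hd : ∀ s, deriv (fun s => φ (1 - s)) s = -deriv φ (1 - s) := fun s => by
    rw [deriv_comp_const_sub]
  have hmp := measurePreserving_one_sub
  have hme : MeasurableEmbedding (fun t : ℝ => 1 - t) :=
    (Homeomorph.subLeft (1 : ℝ)).measurableEmbedding
  have e1 : ∫ t, deriv φ t • f (1 - t) ∂(timeMeasure 1)
      = ∫ s, deriv φ (1 - s) • f s ∂(timeMeasure 1) := by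
    simpa using hmp.integral_comp hme (fun s => deriv φ (1 - s) • f s)
  have e2 : ∫ t, φ t • g (1 - t) ∂(timeMeasure 1) = ∫ s, φ (1 - s) • g s ∂(timeMeasure 1) := by
    simpa using hmp.integral_comp hme (fun s => φ (1 - s) • g s)
  simp only [hd, neg_smul, integral_neg] at key
  simp only [smul_neg, integral_neg, neg_neg]
  rw [e1, e2]
  exact neg_injective key

lemma HasWeakTimeDeriv.clm_comp [CompleteSpace E] [CompleteSpace F] (L : E →L[ℝ] F) {T : ℝ}
    {f g : ℝ → E}
    (h : HasWeakTimeDeriv T f g) (hf : Integrable f (timeMeasure T))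
    (hg : Integrable g (timeMeasure T)) :
    HasWeakTimeDeriv T (fun t => L (f t)) (fun t => L (g t)) := by
  intro φ hφ hs hsub
  have hφ' : Continuous (deriv φ) := hφ.continuous_deriv (by simp)
  have key := congrArg L (h φ hφ hs hsub)
  rw [map_neg, ← L.integral_comp_comm (hf.continuous_smul_timeMeasure hφ'),
    ← L.integral_comp_comm (hg.continuous_smul_timeMeasure hφ.continuous)] at key
  simpa only [map_smul] using key

end TimeChange

/-! ### Reduction to unit time and to operators on `V` -/

/-- The inverse Riesz isomorphism of a real Hilbert space. -/
noncomputable def rieszInv (V : Type*) [NormedAddCommGroup V] [InnerProductSpace ℝ V]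
    [CompleteSpace V] : StrongDual ℝ V →L[ℝ] V :=
  LinearMap.mkContinuous
    { toFun := (InnerProductSpace.toDual ℝ V).symm
      map_add' := map_add _
      map_smul' := fun c f => by simp }
    1 fun f => by simp

lemma inner_rieszInv {V : Type*} [NormedAddCommGroup V] [InnerProductSpace ℝ V]
    [CompleteSpace V] (f : StrongDual ℝ V) (v : V) : ⟪rieszInv V f, v⟫_ℝ = f v :=
  InnerProductSpace.toDual_symm_apply

lemma innerSL_rieszInv {V : Type*} [NormedAddCommGroup V] [InnerProductSpace ℝ V]
    [CompleteSpace V] (f : StrongDual ℝ V) : innerSL ℝ (rieszInv V f) = f := by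
  ext v
  exact inner_rieszInv f v

namespace ControlSystem

section Scaling

variable {V H : Type*} [NormedAddCommGroup V] [InnerProductSpace ℝ V]
  [NormedAddCommGroup H] [InnerProductSpace ℝ H]
  {ω : Type*} [MeasurableSpace ω] {ϱ : Measure ω} {S : ControlSystem V H ϱ}
  {c T ν τ : ℝ} {u : ℝ → Lp ℝ 2 ϱ} {y : ℝ → V} {h : H}

lemma HasTrace.comp_mul_left (hc : 0 < c) (hy : S.HasTrace (c * T) y (c * τ) h) :
    S.HasTrace T (fun t => y (c * t)) τ h := by
  obtain ⟨d, hd, hdy, hdτ⟩ := hy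
  refine ⟨fun t => d (c * t), hd.comp (by fun_prop) fun t ht => ?_, ae_comp_mul_left hc hdy, hdτ⟩
  exact ⟨mul_nonneg hc.le ht.1, mul_le_mul_of_nonneg_left ht.2 hc.le⟩

lemma IsState.comp_mul_left (hc : 0 < c) (hy : S.IsState (c * T) ν u y) :
    S.IsState T (c * ν) (fun t => u (c * t)) (fun t => y (c * t)) := by
  obtain ⟨⟨h₁, h₂, h₃⟩, h₄⟩ := hy
  refine ⟨⟨h₁.comp_mul_left hc, ?_, ?_⟩,
    HasTrace.comp_mul_left hc (by rwa [mul_zero])⟩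
  · simp only [mul_smul]
    exact (h₂.comp_mul_left hc).const_smul c
  · simp only [mul_smul]
    exact h₃.comp_mul_left hc

lemma IsFinalValue.comp_mul_left (hc : 0 < c) (hy : S.IsFinalValue (c * T) ν u h) :
    S.IsFinalValue T (c * ν) (fun t => u (c * t)) h := by
  obtain ⟨y, h₁, h₂⟩ := hy
  exact ⟨_, h₁.comp_mul_left hc, h₂.comp_mul_left hc⟩

lemma comp_mul_left_mem_UadT (hc : 0 < c) (hu : u ∈ S.UadT (c * T)) :
    (fun t => u (c * t)) ∈ S.UadT T :=
  ⟨hu.1.comp_mul_left hc, ae_comp_mul_left hc hu.2⟩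

/-- The attainable final values at time `ν` are those at time one of the rescaled equation. -/
lemma exists_isFinalValue_iff (hν : 0 < ν) :
    (∃ u ∈ S.UadT ν, S.IsFinalValue ν 1 u h) ↔ ∃ u ∈ S.UadT 1, S.IsFinalValue 1 ν u h := by
  constructor
  · rintro ⟨u, hu, hh⟩
    rw [← mul_one ν] at hu hh
    have := hh.comp_mul_left hν
    rw [mul_one ν] at this
    exact ⟨_, comp_mul_left_mem_UadT hν hu, this⟩
  · rintro ⟨u, hu, hh⟩
    have hi := inv_pos.2 hν
    -- The horizon `1` is written as `ν⁻¹ * ν`, so that rescaling by `ν⁻¹` stretches it to `ν` and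
    -- reduces the coefficient to one.
    rw [← inv_mul_cancel₀ hν.ne'] at hu
    rw [IsFinalValue, ← inv_mul_cancel₀ hν.ne'] at hh
    have := IsFinalValue.comp_mul_left hi hh
    rw [inv_mul_cancel₀ hν.ne'] at this
    exact ⟨_, comp_mul_left_mem_UadT hi hu, this⟩

end Scaling

section Riesz

variable {V H : Type*} [NormedAddCommGroup V] [InnerProductSpace ℝ V] [CompleteSpace V]
  [NormedAddCommGroup H] [InnerProductSpace ℝ H]
  {ω : Type*} [MeasurableSpace ω] {ϱ : Measure ω} (S : ControlSystem V H ϱ)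

/-- The Riesz representative `V → V` of the operator `A`. -/
noncomputable def opA : V →L[ℝ] V := rieszInv V ∘L S.a

/-- The Riesz representative `L²(ω, ϱ) → V` of the control operator. -/
noncomputable def opB : Lp ℝ 2 ϱ →L[ℝ] V := rieszInv V ∘L S.B

lemma inner_opA (v w : V) : ⟪S.opA v, w⟫_ℝ = S.a v w := inner_rieszInv _ _

lemma inner_opB (u : Lp ℝ 2 ϱ) (w : V) : ⟪S.opB u, w⟫_ℝ = S.B u w := inner_rieszInv _ _

lemma rieszInv_aStar (v : V) : rieszInv V (S.aStar v) = S.opA.adjoint v := by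
  refine ext_inner_right ℝ fun w => ?_
  rw [inner_rieszInv, ContinuousLinearMap.adjoint_inner_left, real_inner_comm, inner_opA]
  rfl

lemma adjoint_opB (v : V) : S.opB.adjoint v = S.BStar v := by
  refine ext_inner_right ℝ fun w => ?_
  rw [ContinuousLinearMap.adjoint_inner_left, real_inner_comm, inner_opB, BStar,
    InnerProductSpace.toDual_symm_apply]
  rfl

lemma isGarding : IsGarding S.ι S.opA := by
  obtain ⟨α, hα, ω₀, hω, h⟩ := S.garding
  exact ⟨α, hα, ω₀, hω, fun v => by rw [inner_opA]; exact h v⟩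

variable [CompleteSpace H]

lemma rieszInv_toVDual (v : V) : rieszInv V (S.toVDual v) = gramOp S.ι v := by
  refine ext_inner_right ℝ fun w => ?_
  rw [inner_rieszInv, inner_gramOp]
  rfl

/-- The Riesz map and its inverse commute with weak derivatives. The equation in `V*` thereby
becomes one in the Hilbert space `V`, where the abstract solution operator applies. -/
lemma memW_iff {y : ℝ → V} {y' : ℝ → StrongDual ℝ V} {T : ℝ} :
    S.MemW T y y' ↔ MemLp y 2 (timeMeasure T) ∧ MemLp (fun t => rieszInv V (y' t)) 2 (timeMeasure T)
      ∧ HasWeakTimeDeriv T (fun t => gramOp S.ι (y t)) (fun t => rieszInv V (y' t)) := by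
  constructor
  · rintro ⟨h₁, h₂, h₃⟩
    refine ⟨h₁, (rieszInv V).comp_memLp' h₂, ?_⟩
    simp only [← S.rieszInv_toVDual]
    exact h₃.clm_comp _ ((S.toVDual.comp_memLp' h₁).integrable one_le_two)
      (h₂.integrable one_le_two)
  · rintro ⟨h₁, h₂, h₃⟩
    have h₄ := (innerSL ℝ (E := V)).comp_memLp' h₂
    have h₅ := h₃.clm_comp (innerSL ℝ) (((gramOp S.ι).comp_memLp' h₁).integrable one_le_two)
      (h₂.integrable one_le_two)
    simp only [innerSL_rieszInv, Function.comp_def] at h₄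
    exact ⟨h₁, h₄, h₅.congr (.of_forall fun t => (congrArg _ (S.rieszInv_toVDual _)).symm.trans
      (innerSL_rieszInv _)) (.of_forall fun t => innerSL_rieszInv _)⟩

end Riesz

end ControlSystem

/-! ### States and adjoint states through the solution operator -/

namespace ControlSystem

variable {V H : Type*} [NormedAddCommGroup V] [InnerProductSpace ℝ V] [CompleteSpace V]
  [NormedAddCommGroup H] [InnerProductSpace ℝ H] [CompleteSpace H]
  {ω : Type*} [MeasurableSpace ω] {ϱ : Measure ω} (S : ControlSystem V H ϱ)

/-- The datum `(ν B u, y₀)` of the state equation. -/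
noncomputable def stateDatum (ν : ℝ) (u : TimeL2 (Lp ℝ 2 ϱ)) : TimeL2 V × H :=
  controlDatum S.opB S.y₀ ν u

/-- The linear part of the map from controls to final values. -/
noncomputable def finalOp (ν : ℝ) : TimeL2 (Lp ℝ 2 ϱ) →L[ℝ] H :=
  controlEndOp S.ι S.opA S.opB ν

/-- The offset of the final value from the desired state for the zero control. -/
noncomputable def finalOffset (ν : ℝ) : H := endOp S.ι S.opA ν (0, S.y₀) - S.y_d

lemma endOp_stateDatum_sub (ν : ℝ) (u : TimeL2 (Lp ℝ 2 ϱ)) :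
    endOp S.ι S.opA ν (S.stateDatum ν u) - S.y_d = S.finalOp ν u + S.finalOffset ν := by
  rw [stateDatum, endOp_controlDatum, finalOp, finalOffset, add_sub_assoc]

variable {S} {ν : ℝ}

omit [CompleteSpace H] in
lemma stateDatum_fst_ae (u : TimeL2 (Lp ℝ 2 ϱ)) :
    ∀ᵐ t ∂(timeMeasure 1), (S.stateDatum ν u).1 t = ν • S.opB (u t) := by
  filter_upwards [Lp.coeFn_smul ν (S.opB.compLpL 2 (timeMeasure 1) u),
    ContinuousLinearMap.coeFn_compLpL (μ := timeMeasure 1) (p := 2) S.opB u] with t h₁ h₂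
  exact h₁.trans (congrArg (ν • ·) h₂)

lemma isState_solutionOp (hν : 0 < ν) {u : ℝ → Lp ℝ 2 ϱ} (hu : MemLp u 2 (timeMeasure 1)) :
    S.IsState 1 ν u (solutionOp S.ι S.opA ν (S.stateDatum ν (hu.toLp u))).1 ∧
      S.HasTrace 1 (solutionOp S.ι S.opA ν (S.stateDatum ν (hu.toLp u))).1 1
        (endOp S.ι S.opA ν (S.stateDatum ν (hu.toLp u))) := by
  have h₁ := solutionOp_hasWeakTimeDeriv S.ι_injective S.ι_denseRange S.isGarding hν
    (S.stateDatum ν (hu.toLp u))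
  have h₂ := solutionOp_snd_ae S.ι_injective S.ι_denseRange S.isGarding hν
    (S.stateDatum ν (hu.toLp u))
  have h₃ := solutionOp_snd_zero S.ι_injective S.ι_denseRange S.isGarding hν
    (S.stateDatum ν (hu.toLp u))
  set w := solutionOp S.ι S.opA ν (S.stateDatum ν (hu.toLp u)) with hw
  have hc : ContinuousOn w.2 (Icc 0 1) := w.2.continuous.continuousOn
  refine ⟨⟨S.memW_iff.2 ⟨Lp.memLp _, ?_, ?_⟩, w.2, hc, h₂, h₃⟩, w.2, hc, h₂, rfl⟩
  · simp only [map_smul, map_sub]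
    exact ((S.opB.comp_memLp' hu).sub (S.opA.comp_memLp' (Lp.memLp w.1))).const_smul ν
  · refine h₁.congr (.of_forall fun _ => rfl) ?_
    filter_upwards [stateDatum_fst_ae (S := S) (ν := ν) (hu.toLp u), hu.coeFn_toLp] with t e₁ e₂
    rw [e₁, e₂, ← smul_sub, map_smul, map_sub]
    rfl

omit [CompleteSpace V] [CompleteSpace H] in
lemma HasTrace.eq_of_trace {y : ℝ → V} {c : ℝ → H} (hc : ContinuousOn c (Icc 0 1))
    (hcy : ∀ᵐ t ∂(timeMeasure 1), c t = S.ι (y t)) {τ : ℝ} (hτ : τ ∈ Icc (0 : ℝ) 1) {h : H}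
    (hy : S.HasTrace 1 y τ h) : c τ = h := by
  obtain ⟨d, hd, hdy, rfl⟩ := hy
  refine eqOn_Icc_of_ae_eq_timeMeasure one_pos ?_ hc hd hτ
  filter_upwards [hcy, hdy] with t e₁ e₂
  rw [e₁, e₂]

lemma IsState.eq_solutionOp (hν : 0 < ν) {u : ℝ → Lp ℝ 2 ϱ} (hu : MemLp u 2 (timeMeasure 1))
    {y : ℝ → V} (hy : S.IsState 1 ν u y) {h : H} (hh : S.HasTrace 1 y 1 h) :
    y =ᵐ[timeMeasure 1] (solutionOp S.ι S.opA ν (S.stateDatum ν (hu.toLp u))).1 ∧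
      h = endOp S.ι S.opA ν (S.stateDatum ν (hu.toLp u)) := by
  obtain ⟨hW, c, hc, hcy, hc0⟩ := hy
  obtain ⟨h₁, -, h₃⟩ := S.memW_iff.1 hW
  have h₄ : HasWeakTimeDeriv 1 (fun t => gramOp S.ι (y t))
      (fun t => (S.stateDatum ν (hu.toLp u)).1 t - ν • S.opA (y t)) := by
    refine h₃.congr (.of_forall fun _ => rfl) ?_
    filter_upwards [stateDatum_fst_ae (S := S) (ν := ν) (hu.toLp u), hu.coeFn_toLp] with t e₁ e₂
    rw [e₁, e₂, ← smul_sub, map_smul, map_sub]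
    rfl
  obtain ⟨e₁, e₂⟩ := _root_.eq_solutionOp S.ι_injective S.ι_denseRange S.isGarding hν _
    (h₁.integrable one_le_two) h₄ hc hcy hc0
  refine ⟨e₁, ?_⟩
  rw [← hh.eq_of_trace hc hcy (right_mem_Icc.2 zero_le_one), e₂ (right_mem_Icc.2 zero_le_one)]
  rfl

lemma isFinalValue_iff (hν : 0 < ν) {u : ℝ → Lp ℝ 2 ϱ} (hu : MemLp u 2 (timeMeasure 1)) {h : H} :
    S.IsFinalValue 1 ν u h ↔ h = endOp S.ι S.opA ν (S.stateDatum ν (hu.toLp u)) := by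
  constructor
  · rintro ⟨y, hy, hh⟩
    exact (hy.eq_solutionOp hν hu hh).2
  · rintro rfl
    exact ⟨_, isState_solutionOp hν hu⟩

/-- Solve forward in time with the adjoint operator, zero source and initial value `p₁`, then
reverse time. -/
lemma exists_isAdjointState (hν : 0 < ν) (p₁ : H) : ∃ p, S.IsAdjointState ν p₁ p := by
  have hG := S.isGarding.adjoint
  have h₁ := solutionOp_hasWeakTimeDeriv S.ι_injective S.ι_denseRange hG hν (0, p₁)
  have h₂ := solutionOp_snd_ae S.ι_injective S.ι_denseRange hG hν (0, p₁)
  have h₃ := solutionOp_snd_zero S.ι_injective S.ι_denseRange hG hν (0, p₁)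
  set w := solutionOp S.ι S.opA.adjoint ν (0, p₁)
  have hq : MemLp (fun t => w.1 (1 - t)) 2 (timeMeasure 1) :=
    (Lp.memLp w.1).comp_measurePreserving measurePreserving_one_sub
  refine ⟨fun t => w.1 (1 - t), S.memW_iff.2 ⟨hq, ?_, ?_⟩, fun t => w.2 (1 - t),
    (w.2.continuous.comp (by fun_prop)).continuousOn, ?_, ?_⟩
  · simp only [map_smul, rieszInv_aStar]
    exact (S.opA.adjoint.comp_memLp' hq).const_smul ν
  · have h₄ : HasWeakTimeDeriv 1 (fun t => gramOp S.ι (w.1 t))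
        (fun t => -(ν • S.opA.adjoint (w.1 t))) := by
      refine h₁.congr (.of_forall fun _ => rfl) ?_
      filter_upwards [Lp.coeFn_zero V 2 (timeMeasure 1)] with t ht
      rw [ht, Pi.zero_apply, zero_sub]
    simpa only [map_smul, rieszInv_aStar, neg_neg] using h₄.comp_one_sub
  · exact measurePreserving_one_sub.quasiMeasurePreserving.ae h₂
  · show w.2 (1 - 1) = p₁
    rw [sub_self, h₃]

/-- The duality between the final value of a linearised state and an adjoint state. -/
lemma IsAdjointState.duality (hν : 0 < ν) {p₁ : H} {p : ℝ → V} (h : S.IsAdjointState ν p₁ p)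
    (f : TimeL2 V) : ⟪endOp S.ι S.opA ν (f, 0), p₁⟫_ℝ = ⟪f, h.1.1.toLp p⟫_ℝ := by
  obtain ⟨hW, c, hc, hcp, rfl⟩ := id h
  obtain ⟨h₁, -, h₃⟩ := S.memW_iff.1 hW
  simp only [map_smul, rieszInv_aStar] at h₃
  have := solutionOp_duality S.ι_injective S.ι_denseRange S.isGarding hν h₁ h₃ hc hcp (f, 0)
  rw [inner_zero_left, zero_add] at this
  exact this

omit [CompleteSpace V] [CompleteSpace H] in
lemma IsAdjointState.eq_zero {p₁ : H} {p : ℝ → V} (h : S.IsAdjointState ν p₁ p)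
    (h0 : ∀ᵐ t ∂(timeMeasure 1), p t = 0) : p₁ = 0 := by
  refine (h.2.eq_of_trace (c := fun _ => 0) continuousOn_const ?_
    (right_mem_Icc.2 zero_le_one)).symm
  filter_upwards [h0] with t ht
  rw [ht, map_zero]

/-- The adjoint state, composed with `B*`, represents the derivative of the final value. -/
lemma IsAdjointState.inner_finalOp (hν : 0 < ν) {p₁ : H} {p : ℝ → V} (h : S.IsAdjointState ν p₁ p)
    (u : TimeL2 (Lp ℝ 2 ϱ)) : ⟪S.finalOp ν u, p₁⟫_ℝ
      = ν * ⟪u, S.opB.adjoint.compLpL 2 (timeMeasure 1) (h.1.1.toLp p)⟫_ℝ := by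
  have e : S.finalOp ν u = ν • endOp S.ι S.opA ν (S.opB.compLpL 2 (timeMeasure 1) u, 0) := rfl
  rw [e, real_inner_smul_left, h.duality hν, L2.inner_def, L2.inner_def]
  congr 1
  refine integral_congr_ae ?_
  filter_upwards [ContinuousLinearMap.coeFn_compLpL (μ := timeMeasure 1) (p := 2) S.opB u,
    ContinuousLinearMap.coeFn_compLpL (μ := timeMeasure 1) (p := 2) S.opB.adjoint
      (h.1.1.toLp p)] with t h₁ h₂
  rw [h₁, h₂, ContinuousLinearMap.adjoint_inner_right]

end ControlSystem

/-! ### Admissible controls, uniqueness of minimizers, derivative of `delta` -/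

namespace ControlSystem

section Admissible

variable {V H : Type*} [NormedAddCommGroup V] [InnerProductSpace ℝ V]
  [NormedAddCommGroup H] [InnerProductSpace ℝ H]
  {ω : Type*} [MeasurableSpace ω] {ϱ : Measure ω} (S : ControlSystem V H ϱ)

/-- The admissible controls on `(0, 1)` as a subset of `L²(0, 1; L²(ω, ϱ))`. -/
def admissible : Set (TimeL2 (Lp ℝ 2 ϱ)) := {u | ∀ᵐ t ∂(timeMeasure 1), u t ∈ S.Uad}

lemma isClosed_admissible : IsClosed S.admissible :=
  isClosed_setOf_ae_mem fun _ => isClosed_setOf_ae_mem (C := fun x => Icc (S.u_a x) (S.u_b x))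
    fun _ => isClosed_Icc

lemma convex_admissible : Convex ℝ S.admissible :=
  convex_setOf_ae_mem fun _ => convex_setOf_ae_mem (C := fun x => Icc (S.u_a x) (S.u_b x))
    fun _ => convex_Icc _ _

lemma toLp_mem_admissible {u : ℝ → Lp ℝ 2 ϱ} (hu : MemLp u 2 (timeMeasure 1)) :
    hu.toLp u ∈ S.admissible ↔ u ∈ S.UadT 1 := by
  have h : (∀ᵐ t ∂(timeMeasure 1), hu.toLp u t ∈ S.Uad) ↔ ∀ᵐ t ∂(timeMeasure 1), u t ∈ S.Uad :=
    Filter.eventually_congr (hu.coeFn_toLp.mono fun t ht => by rw [ht])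
  exact h.trans ⟨fun h => ⟨hu, h⟩, fun h => h.2⟩

lemma coe_mem_UadT {u : TimeL2 (Lp ℝ 2 ϱ)} (hu : u ∈ S.admissible) : ⇑u ∈ S.UadT 1 :=
  ⟨Lp.memLp u, hu⟩

/-- Two admissible controls may be interchanged on a rectangle. -/
lemma sub_rectangleOp_mem_admissible [SFinite ϱ] {u v : TimeL2 (Lp ℝ 2 ϱ)} (hu : u ∈ S.admissible)
    (hv : v ∈ S.admissible) {s : Set ℝ} {r : Set ω} (hs : MeasurableSet s)
    (hr : MeasurableSet r) : u - rectangleOp hs hr (u - v) ∈ S.admissible := by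
  have hu' : ∀ᵐ t ∂(timeMeasure 1), ∀ᵐ x ∂ϱ, u t x ∈ Icc (S.u_a x) (S.u_b x) := hu
  have hv' : ∀ᵐ t ∂(timeMeasure 1), ∀ᵐ x ∂ϱ, v t x ∈ Icc (S.u_a x) (S.u_b x) := hv
  show ∀ᵐ t ∂(timeMeasure 1), ∀ᵐ x ∂ϱ, _ ∈ Icc (S.u_a x) (S.u_b x)
  filter_upwards [hu', hv', Lp.coeFn_sub u (rectangleOp hs hr (u - v)), Lp.coeFn_sub u v,
    coeFn_rectangleOp hs hr (u - v)] with t h₁ h₂ h₃ h₄ h₅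
  rw [h₃, Pi.sub_apply]
  rw [h₄, Pi.sub_apply] at h₅
  filter_upwards [h₁, h₂, h₅, Lp.coeFn_sub (u t) (rectangleOp hs hr (u - v) t),
    Lp.coeFn_sub (u t) (v t)] with x e₁ e₂ e₃ e₄ e₅
  rw [e₄, Pi.sub_apply, e₃]
  by_cases hx : (t, x) ∈ s ×ˢ r
  · rw [indicator_of_mem hx, e₅, Pi.sub_apply, sub_sub_cancel]
    exact e₂
  · rw [indicator_of_notMem hx, sub_zero]
    exact e₁

end Admissible

variable {V H : Type*} [NormedAddCommGroup V] [InnerProductSpace ℝ V] [CompleteSpace V]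
  [NormedAddCommGroup H] [InnerProductSpace ℝ H] [CompleteSpace H]
  {ω : Type*} [MeasurableSpace ω] {ϱ : Measure ω} {S : ControlSystem V H ϱ} {ν : ℝ}

omit [CompleteSpace H] in
/-- Under unique continuation, an adjoint state with nonzero terminal value has `B* p ≠ 0` almost
everywhere, so only `w = 0` is orthogonal to `B* p` on all rectangles. -/
lemma UniqueContinuation.eq_zero [SFinite ϱ] (hS : S.UniqueContinuation ν) {p₁ : H}
    (hp₁ : p₁ ≠ 0) {p : ℝ → V} (hp : S.IsAdjointState ν p₁ p) {w : TimeL2 (Lp ℝ 2 ϱ)}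
    (h : ∀ (s : Set ℝ) (r : Set ω) (hs : MeasurableSet s) (hr : MeasurableSet r),
      ⟪rectangleOp hs hr w,
        S.opB.adjoint.compLpL 2 (timeMeasure 1) (hp.1.1.toLp p)⟫_ℝ = 0) : w = 0 := by
  obtain ⟨W, hW⟩ := exists_isJointRep w
  obtain ⟨F, hF⟩ := exists_isJointRep (S.opB.adjoint.compLpL 2 (timeMeasure 1) (hp.1.1.toLp p))
  have hWF := hW.ae_eq_zero_or_eq_zero hF h
  have hΛ : MeasurableSet {z | W z ≠ 0} :=
    ((Lp.stronglyMeasurable W).measurable (measurableSet_singleton 0)).compl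
  by_contra hw
  -- The norm of `W` equals that of `w`, so `w ≠ 0` gives `W` a support of positive measure, on
  -- which `B* p` must vanish.
  have hne : (timeMeasure 1).prod ϱ {z | W z ≠ 0} ≠ 0 := by
    intro h0
    have h1 : W =ᵐ[(timeMeasure 1).prod ϱ] 0 := h0
    have h2 : W = 0 := Lp.ext (h1.trans (Lp.coeFn_zero _ _ _).symm)
    have h3 := hW.norm_eq
    rw [h2, norm_zero] at h3
    exact hw (norm_eq_zero.1 h3.symm)
  refine hp₁ (hp.eq_zero (hS p₁ p hp _ hΛ hne ?_))
  filter_upwards [Measure.ae_ae_of_ae_prod hWF, hF, hp.1.1.coeFn_toLp,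
    ContinuousLinearMap.coeFn_compLpL (μ := timeMeasure 1) (p := 2) S.opB.adjoint
      (hp.1.1.toLp p)] with t h₁ h₂ h₃ h₄
  rw [h₄, h₃, adjoint_opB] at h₂
  filter_upwards [h₁, h₂] with x e₁ e₂ hx
  rw [← e₂]
  exact e₁.resolve_left hx

/-- The optimal final value is unique by convexity in `H`. That it determines the control is the
bang-bang argument: `B* p` is nonzero almost everywhere, so two minimizers cannot be exchanged on a
rectangle to first order without being equal. -/
lemma minimizer_unique [SFinite ϱ] (hν : 0 < ν) (hS : S.UniqueContinuation ν)
    {u v : TimeL2 (Lp ℝ 2 ϱ)} (hu : u ∈ S.admissible) (hv : v ∈ S.admissible)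
    (hmin : ∀ w ∈ S.admissible,
      ‖S.finalOp ν u + S.finalOffset ν‖ ≤ ‖S.finalOp ν w + S.finalOffset ν‖)
    (hvu : ‖S.finalOp ν v + S.finalOffset ν‖ ≤ ‖S.finalOp ν u + S.finalOffset ν‖)
    (hpos : S.finalOp ν u + S.finalOffset ν ≠ 0) : v = u := by
  set z := S.finalOp ν u + S.finalOffset ν with hz
  set D : Set H := (fun w => S.finalOp ν w + S.finalOffset ν) '' S.admissible with hD
  have hDc : Convex ℝ D := by
    have := (S.convex_admissible.linear_image (S.finalOp ν).toLinearMap).translate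
      (S.finalOffset ν)
    convert this using 1
    rw [image_image, hD]
    refine image_congr fun w _ => ?_
    exact add_comm _ _
  have hzD : z ∈ D := ⟨u, hu, rfl⟩
  have hDmin : ∀ q ∈ D, ‖z‖ ≤ ‖q‖ := by
    rintro _ ⟨w, hw, rfl⟩
    exact hmin w hw
  have hvz : S.finalOp ν v + S.finalOffset ν = z := by
    have h1 := hDc.norm_sub_sq_le hzD hDmin (mem_image_of_mem _ hv)
    have h2 : ‖S.finalOp ν v + S.finalOffset ν‖ ^ 2 ≤ ‖z‖ ^ 2 :=
      pow_le_pow_left₀ (norm_nonneg _) hvu 2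
    have h3 : ‖S.finalOp ν v + S.finalOffset ν - z‖ ^ 2 ≤ 0 := by
      simpa using h1.trans (sub_nonpos.2 h2)
    exact sub_eq_zero.1 (norm_eq_zero.1 (pow_eq_zero_iff two_ne_zero |>.1
      (le_antisymm h3 (sq_nonneg _))))
  obtain ⟨p, hp⟩ := exists_isAdjointState (S := S) hν z
  -- Only the first control needs the optimal final value `z`. As `u` and `v` both have it, the
  -- inequality holds with the roles exchanged, and the two together give equality.
  have key : ∀ (s : Set ℝ) (r : Set ω) (hs : MeasurableSet s) (hr : MeasurableSet r)
      {u v : TimeL2 (Lp ℝ 2 ϱ)}, u ∈ S.admissible → v ∈ S.admissible →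
      S.finalOp ν u + S.finalOffset ν = z →
      ⟪rectangleOp hs hr (u - v),
        S.opB.adjoint.compLpL 2 (timeMeasure 1) (hp.1.1.toLp p)⟫_ℝ ≤ 0 := by
    intro s r hs hr u v hu hv hu'
    have h1 := hDc.inner_nonneg_of_norm_le hzD hDmin
      (mem_image_of_mem _ (S.sub_rectangleOp_mem_admissible hu hv hs hr))
    have h2 : S.finalOp ν (u - rectangleOp hs hr (u - v)) + S.finalOffset ν - z
        = -S.finalOp ν (rectangleOp hs hr (u - v)) := by
      rw [← hu', map_sub]
      abel
    rw [h2, inner_neg_right, real_inner_comm, hp.inner_finalOp hν] at h1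
    nlinarith
  refine (sub_eq_zero.1 (hS.eq_zero hpos hp fun s r hs hr => ?_))
  refine le_antisymm (key s r hs hr hv hu hvz) ?_
  have := key s r hs hr hu hv rfl
  rw [← neg_sub, map_neg, inner_neg_left] at this
  linarith

/-- For positive times, `δ` is the minimal norm of an affine map of the controls on `(0, 1)`. -/
lemma delta_eq (hne : S.Uad.Nonempty) (hν : 0 < ν) :
    S.delta ν = minNorm S.admissible (S.finalOp ν) (S.finalOffset ν) - S.δ₀ := by
  have hne' : S.admissible.Nonempty := nonempty_setOf_ae_mem hne
  have hset : {d | ∃ u ∈ S.UadT ν, ∃ h, S.IsFinalValue ν 1 u h ∧ d = ‖h - S.y_d‖ - S.δ₀}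
      = (fun r => r - S.δ₀) '' ((fun u => ‖S.finalOp ν u + S.finalOffset ν‖) '' S.admissible) := by
    ext d
    constructor
    · rintro ⟨u, hu, h, hh, rfl⟩
      obtain ⟨v, hv, hvh⟩ := (exists_isFinalValue_iff hν).1 ⟨u, hu, hh⟩
      refine ⟨_, ⟨hv.1.toLp v, (S.toLp_mem_admissible hv.1).2 hv, rfl⟩, ?_⟩
      rw [(isFinalValue_iff hν hv.1).1 hvh, endOp_stateDatum_sub]
    · rintro ⟨_, ⟨v, hv, rfl⟩, rfl⟩
      have hv' := S.coe_mem_UadT hv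
      obtain ⟨u, hu, hh⟩ := (exists_isFinalValue_iff hν).2
        ⟨v, hv', (isFinalValue_iff hν hv'.1).2 rfl⟩
      refine ⟨u, hu, _, hh, ?_⟩
      rw [endOp_stateDatum_sub, Lp.toLp_coeFn]
  have hb : BddBelow ((fun u => ‖S.finalOp ν u + S.finalOffset ν‖) '' S.admissible) :=
    ⟨0, by rintro _ ⟨u, -, rfl⟩; exact norm_nonneg _⟩
  have hmono : Monotone fun r : ℝ => r - S.δ₀ := fun a b h => sub_le_sub_right h _
  rw [delta, hset, ← hmono.map_csInf_of_continuousAt (by fun_prop) (hne'.image _) hb]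
  rfl

lemma mem_minimizers_iff (hν : 0 < ν) {u : ℝ → Lp ℝ 2 ϱ} (hu : MemLp u 2 (timeMeasure 1)) :
    u ∈ S.minimizers ν ↔ hu.toLp u ∈ S.admissible ∧ ∀ v ∈ S.admissible,
      ‖S.finalOp ν (hu.toLp u) + S.finalOffset ν‖ ≤ ‖S.finalOp ν v + S.finalOffset ν‖ := by
  constructor
  · rintro ⟨hU, h, hh, hmin⟩
    refine ⟨(S.toLp_mem_admissible hu).2 hU, fun v hv => ?_⟩
    have hv' := S.coe_mem_UadT hv
    have := hmin v hv' _ ((isFinalValue_iff hν hv'.1).2 rfl)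
    rwa [(isFinalValue_iff hν hu).1 hh, endOp_stateDatum_sub, endOp_stateDatum_sub,
      Lp.toLp_coeFn] at this
  · rintro ⟨hU, hmin⟩
    refine ⟨(S.toLp_mem_admissible hu).1 hU, _, (isFinalValue_iff hν hu).2 rfl,
      fun v hv h hh => ?_⟩
    rw [(isFinalValue_iff hν hv.1).1 hh, endOp_stateDatum_sub, endOp_stateDatum_sub]
    exact hmin _ ((S.toLp_mem_admissible hv.1).2 hv)

/-- The derivative of the affine map `u ↦ y(1) - y_d` with respect to `ν`, tested with the terminal
value of an adjoint state. -/
lemma IsAdjointState.integral_eq (hν : 0 < ν) {p₁ : H} {p : ℝ → V} (hp : S.IsAdjointState ν p₁ p)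
    {u : ℝ → Lp ℝ 2 ϱ} (hu : MemLp u 2 (timeMeasure 1)) {y : ℝ → V}
    (hy : y =ᵐ[timeMeasure 1] (solutionOp S.ι S.opA ν (S.stateDatum ν (hu.toLp u))).1) :
    ∫ t, (S.B (u t) - S.a (y t)) (p t) ∂(timeMeasure 1)
      = ⟪controlEndOpDeriv S.ι S.opA S.opB ν (hu.toLp u)
          + endOpDeriv S.ι S.opA (0, S.y₀) ν, p₁⟫_ℝ := by
  rw [controlEndOpDeriv_add, hp.duality hν, L2.inner_def]
  refine integral_congr_ae ?_
  filter_upwards [hy, hu.coeFn_toLp, hp.1.1.coeFn_toLp,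
    Lp.coeFn_sub (S.opB.compLpL 2 (timeMeasure 1) (hu.toLp u)) (S.opA.compLpL 2 (timeMeasure 1)
      (solutionOp S.ι S.opA ν (S.stateDatum ν (hu.toLp u))).1),
    ContinuousLinearMap.coeFn_compLpL (μ := timeMeasure 1) (p := 2) S.opB (hu.toLp u),
    ContinuousLinearMap.coeFn_compLpL (μ := timeMeasure 1) (p := 2) S.opA
      (solutionOp S.ι S.opA ν (S.stateDatum ν (hu.toLp u))).1] with t h₁ h₂ h₃ h₄ h₅ h₆
  refine Eq.trans ?_ (congrArg (fun x => ⟪x, hp.1.1.toLp p t⟫_ℝ) h₄).symm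
  rw [Pi.sub_apply, h₅, h₆, h₂, h₃, ← h₁]
  rw [inner_sub_left, inner_opB, inner_opA]
  rfl

lemma exists_minimizer (hne : S.Uad.Nonempty) (hbdd : Bornology.IsBounded S.Uad) (ν : ℝ) :
    ∃ u ∈ S.admissible, ∀ v ∈ S.admissible,
      ‖S.finalOp ν u + S.finalOffset ν‖ ≤ ‖S.finalOp ν v + S.finalOffset ν‖ :=
  exists_isMinOn_norm_affine (nonempty_setOf_ae_mem hne) S.isClosed_admissible
    S.convex_admissible (isBounded_setOf_ae_mem hbdd) _ _

/-- `δ(ν) > -δ₀` says that the minimal distance to `y_d` is positive; this keeps the norm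
differentiable and the adjoint terminal value nonzero. -/
lemma offset_ne_zero (hne : S.Uad.Nonempty) (hν : 0 < ν) (hδ : -S.δ₀ < S.delta ν)
    {u : TimeL2 (Lp ℝ 2 ϱ)} (hu : u ∈ S.admissible) : S.finalOp ν u + S.finalOffset ν ≠ 0 := by
  intro h0
  have := minNorm_le (T := S.finalOp ν) (b := S.finalOffset ν) hu
  rw [delta_eq hne hν] at hδ
  rw [h0, norm_zero] at this
  linarith

lemma hasDerivAt_delta [SFinite ϱ] (hne : S.Uad.Nonempty) (hbdd : Bornology.IsBounded S.Uad)
    (hν : 0 < ν) (hδ : -S.δ₀ < S.delta ν) (hS : S.UniqueContinuation ν)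
    {u : TimeL2 (Lp ℝ 2 ϱ)} (hu : u ∈ S.admissible) (hmin : ∀ v ∈ S.admissible,
      ‖S.finalOp ν u + S.finalOffset ν‖ ≤ ‖S.finalOp ν v + S.finalOffset ν‖) :
    HasDerivAt S.delta ⟪controlEndOpDeriv S.ι S.opA S.opB ν u
      + endOpDeriv S.ι S.opA (0, S.y₀) ν, ‖S.finalOp ν u + S.finalOffset ν‖⁻¹ •
        (S.finalOp ν u + S.finalOffset ν)⟫_ℝ ν := by
  have hpos := offset_ne_zero hne hν hδ hu
  have h := hasDerivAt_minNorm (nonempty_setOf_ae_mem hne) S.isClosed_admissible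
    S.convex_admissible (isBounded_setOf_ae_mem hbdd)
    (hasDerivAt_controlEndOp S.ι_injective S.ι_denseRange S.isGarding hν S.opB)
    ((hasDerivAt_endOp S.ι_injective S.ι_denseRange S.isGarding hν (0, S.y₀)).sub_const S.y_d)
    hu hmin (fun v hv hvu => minimizer_unique hν hS hu hv hmin hvu hpos) hpos
  refine (h.sub_const S.δ₀).congr_of_eventuallyEq ?_
  filter_upwards [lt_mem_nhds hν] with ν' hν'
  exact delta_eq hne hν'

end ControlSystem

theorem mainTheorem7 {V H : Type*}
    [NormedAddCommGroup V] [InnerProductSpace ℝ V] [CompleteSpace V]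
    [NormedAddCommGroup H] [InnerProductSpace ℝ H] [CompleteSpace H]
    {ω : Type*} [MeasurableSpace ω] {ϱ : Measure ω} [SigmaFinite ϱ]
    (S : ControlSystem V H ϱ)
    (hne : S.Uad.Nonempty) (hbdd : Bornology.IsBounded S.Uad) :
    (∀ ν : ℝ, 0 < ν → -S.δ₀ < S.delta ν → S.UniqueContinuation ν →
      ∃ d : ℝ, S.derivativeValues ν = {d} ∧ HasDerivAt S.delta d ν) ∧
    ((∀ ν : ℝ, 0 < ν → -S.δ₀ < S.delta ν → S.UniqueContinuation ν) →
      ∀ ν : ℝ, 0 < ν → -S.δ₀ < S.delta ν → ContDiffAt ℝ 1 S.delta ν) := by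
  -- Minimizers of the affine problem are chosen for every real `ν`, also `ν ≤ 0`, so that `m` is a
  -- family on all of `ℝ` as `continuousAt_deriv_minNorm` requires.
  choose m hm hmin using fun ν => S.exists_minimizer hne hbdd ν
  have huniq : ∀ ν, 0 < ν → -S.δ₀ < S.delta ν → S.UniqueContinuation ν → ∀ v ∈ S.admissible,
      ‖S.finalOp ν v + S.finalOffset ν‖ ≤ ‖S.finalOp ν (m ν) + S.finalOffset ν‖ → v = m ν :=
    fun ν hν hδ hS v hv hle => ControlSystem.minimizer_unique hν hS (hm ν) hv (hmin ν) hle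
      (ControlSystem.offset_ne_zero hne hν hδ (hm ν))
  have hder : ∀ ν, 0 < ν → -S.δ₀ < S.delta ν → S.UniqueContinuation ν → _ :=
    fun ν hν hδ hS => S.hasDerivAt_delta hne hbdd hν hδ hS (hm ν) (hmin ν)
  refine ⟨fun ν hν hδ hS => ⟨_, ?_, hder ν hν hδ hS⟩, fun hS ν hν hδ => ?_⟩
  -- Elements of `minimizers` are functions, so uniqueness means that all of them represent the one
  -- class `m ν`; the integral depends only on that class.
  · have hrep : ∀ u : ℝ → Lp ℝ 2 ϱ, u ∈ S.minimizers ν →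
        ∃ hu : MemLp u 2 (timeMeasure 1), hu.toLp u = m ν := fun u hu => by
      have hu' := (ControlSystem.mem_minimizers_iff hν hu.1.1).1 hu
      exact ⟨hu.1.1, huniq ν hν hδ hS _ hu'.1 (hu'.2 _ (hm ν))⟩
    refine eq_singleton_iff_unique_mem.2 ⟨?_, ?_⟩
    · have hu : MemLp (m ν) 2 (timeMeasure 1) := Lp.memLp _
      have hum : hu.toLp (m ν) = m ν := Lp.toLp_coeFn _ _
      obtain ⟨hst, htr⟩ := ControlSystem.isState_solutionOp (S := S) hν hu
      obtain ⟨p, hp⟩ := ControlSystem.exists_isAdjointState (S := S) hν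
        (‖endOp S.ι S.opA ν (S.stateDatum ν (hu.toLp (m ν))) - S.y_d‖⁻¹ •
          (endOp S.ι S.opA ν (S.stateDatum ν (hu.toLp (m ν))) - S.y_d))
      refine ⟨m ν, (ControlSystem.mem_minimizers_iff hν hu).2 ?_, _, _, p, hst, htr, hp, ?_⟩
      · rw [hum]
        exact ⟨hm ν, hmin ν⟩
      · rw [hp.integral_eq hν hu Filter.EventuallyEq.rfl, hum, S.endOp_stateDatum_sub]
    · rintro d ⟨u, hu, y, h, p, hst, htr, hp, rfl⟩
      obtain ⟨hu', hum⟩ := hrep u hu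
      obtain ⟨hy, rfl⟩ := hst.eq_solutionOp hν hu' htr
      rw [hp.integral_eq hν hu' hy, hum, S.endOp_stateDatum_sub]
  -- Differentiability from the first part makes `delta` continuous at `ν`, so the derivative
  -- formula is available in a whole neighbourhood.
  · have hnhds : ∀ᶠ ν' in 𝓝 ν, 0 < ν' ∧ -S.δ₀ < S.delta ν' :=
      (lt_mem_nhds hν).and ((hder ν hν hδ (hS ν hν hδ)).continuousAt.eventually
        (lt_mem_nhds hδ))
    refine contDiffAt_one_iff.2 ⟨_, _, hnhds, ?_,
      fun ν' hν' => (hder ν' hν'.1 hν'.2 (hS ν' hν'.1 hν'.2)).hasFDerivAt⟩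
    intro ν' hν'
    refine ContinuousAt.continuousWithinAt ?_
    refine ((ContinuousLinearMap.smulRightL ℝ ℝ ℝ 1).continuous.continuousAt).comp ?_
    exact continuousAt_deriv_minNorm S.isClosed_admissible S.convex_admissible
      (isBounded_setOf_ae_mem hbdd)
      (hasDerivAt_controlEndOp S.ι_injective S.ι_denseRange S.isGarding hν'.1 S.opB)
      ((hasDerivAt_endOp S.ι_injective S.ι_denseRange S.isGarding hν'.1 (0, S.y₀)).sub_const S.y_d)
      (continuousAt_controlEndOpDeriv S.ι_injective S.ι_denseRange S.isGarding hν'.1 S.opB)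
      (continuousAt_endOpDeriv S.ι_injective S.ι_denseRange S.isGarding hν'.1 (0, S.y₀))
      hm hmin (huniq ν' hν'.1 hν'.2 (hS ν' hν'.1 hν'.2))
      (ControlSystem.offset_ne_zero hne hν'.1 hν'.2 (hm ν'))
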